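/- All graphs are finite, simple and undirected; multigraphs are finite and undirected and may contain loops and parallel edges. Let $k$ be a positive integer. A $k$-path (respectively $k$-cycle) in a graph $G$ is a not necessarily induced path (respectively cycle) of order $k$ in $G$. Let $\nu_k(G)$ be the maximum number of pairwise vertex-disjoint $k$-paths in $G$, and let $\tau_k(G)$ be the minimum cardinality of a set of vertices of $G$ that intersects every $k$-path in $G$. Let $\mathcal{G}_k$ be the set of all graphs $G$ such that $\nu_k(H)=\tau_k(H)$ for every induced subgraph $H$ of $G$, and let $\mathcal{G}'_k$ be the set of all graphs in $\mathcal{G}_k$ that contain no cycle of order less than $k$. For a multigraph $H$, let $Sub_k(H)$ arise from $H$ by subdividing every edge of $H$ exactly $k-1$ times, that is, every edge between distinct vertices $u$ and $v$ is replaced by a path of order $k+1$ between $u$ and $v$ whose internal vertices have degree $2$, and every loop at a vertex $u$ is replaced by a $k$-cycle containing $u$ and $k-1$ further vertices of degree $2$. A cutvertex of a graph $G$ is a vertex $x$ such that $G-x$ has more components than $G$. A block of $G$ is a maximal connected subgraph $B$ of $G$ such that $B$ itself has no cutvertex, and a block is trivial if it is $K_1$ or $K_2$. Let $\mathcal{H}'_k$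 be the set of all graphs $G$ such that for every non-trivial block $B$ of $G$ there is a multigraph $H$ with $B=Sub_k(H)$ such that every component $K$ of $G-V(H)$ that contains a vertex from $V(B)\setminus V(H)$ is a tree without a $k$-path. **Theorem.** $\mathcal{G}'_k=\mathcal{H}'_k$ for every positive odd integer $k$. -/

import Mathlib

universe u v

namespace PathKE

/-! ### Paths of order `k`, matchings and vertex covers -/

section Paths

variable {V : Type u}

/-- `P` is a `k`-path of `G`: a (not necessarily induced) subgraph that is a path on `k` vertices. -/
def IsKPath (G : SimpleGraph V) (k : ℕ) (P : G.Subgraph) : Prop :=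
  ∃ (a b : V) (p : G.Walk a b), p.IsPath ∧ p.length + 1 = k ∧ p.toSubgraph = P

/-- A `k`-matching: a set of pairwise (vertex-)disjoint `k`-paths. -/
def IsKMatching (G : SimpleGraph V) (k : ℕ) (M : Set G.Subgraph) : Prop :=
  (∀ P ∈ M, IsKPath G k P) ∧ M.Pairwise fun P Q => Disjoint P.verts Q.verts

/-- A `k`-vertex cover: a set of vertices intersecting every `k`-path. -/
def IsKVertexCover (G : SimpleGraph V) (k : ℕ) (X : Set V) : Prop :=
  ∀ P : G.Subgraph, IsKPath G k P → (X ∩ P.verts).Nonempty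

/-- The `k`-matching number `ν_k(G)` (of a finite graph). -/
noncomputable def nu (k : ℕ) (G : SimpleGraph V) : ℕ :=
  sSup {n | ∃ M : Set G.Subgraph, IsKMatching G k M ∧ M.ncard = n}

/-- The `k`-vertex cover number `τ_k(G)` (of a finite graph). -/
noncomputable def tau (k : ℕ) (G : SimpleGraph V) : ℕ :=
  sInf {n | ∃ X : Set V, IsKVertexCover G k X ∧ X.ncard = n}

end Paths

/-- The class `𝒢_k` (on the vertex set `V`): `ν_k = τ_k` for every induced subgraph. -/
def classG (k : ℕ) (V : Type u) : Set (SimpleGraph V) :=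
  {G | ∀ S : Set V, nu k (G.induce S) = tau k (G.induce S)}

/-- The class `𝒢'_k` (on the vertex set `V`): the graphs in `𝒢_k` without cycles of order
less than `k`. -/
def classG' (k : ℕ) (V : Type u) : Set (SimpleGraph V) :=
  {G | G ∈ classG k V ∧ ∀ (a : V) (c : G.Walk a a), c.IsCycle → k ≤ c.length}

/-! ### Blocks -/

/-- `x` is a cutvertex of the (finite) graph `G`: `G - x` has more components than `G`. -/
def IsCutvertex {V : Type u} (G : SimpleGraph V) (x : V) : Prop :=
  Nat.card G.ConnectedComponent < Nat.card (G.induce {x}ᶜ).ConnectedComponent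

/-- A block of `G`: a maximal connected subgraph that has no cutvertex of its own. -/
def IsBlock {V : Type u} (G : SimpleGraph V) (B : G.Subgraph) : Prop :=
  Maximal (fun C : G.Subgraph => C.Connected ∧ ∀ x : C.verts, ¬ IsCutvertex C.coe x) B

/-- A block is non-trivial if it is neither `K₁` nor `K₂`; as blocks are connected,
this means that it has more than two vertices. -/
def IsNontrivialBlock {V : Type u} (G : SimpleGraph V) (B : G.Subgraph) : Prop :=
  IsBlock G B ∧ 2 < B.verts.ncard

/-! ### Subdivisions of multigraphs -/

section Subdivision

variable {α : Type u} {β : Type v}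

/-- `(src, tgt)` is an orientation of the multigraph `H`: each edge `e` of `H` has the two ends
`src e` and `tgt e`. -/
def IsOrientation (H : Graph α β) (src tgt : β → α) : Prop :=
  ∀ e ∈ H.edgeSet, H.IsLink e (src e) (tgt e)

/-- The `i`-th vertex, `0 ≤ i ≤ k`, on the subdivided edge `e`: the vertex number `0` is `src e`,
the vertex number `k` is `tgt e`, and the others are the new vertices `(e, i)`. -/
def subPos (k : ℕ) (src tgt : β → α) (e : β) (i : ℕ) : α ⊕ (β × ℕ) :=
  if i = 0 then Sum.inl (src e) else if i = k then Sum.inl (tgt e) else Sum.inr (e, i)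

/-- The vertex set of the `k`-subdivision: the vertices of `H`, and `k - 1` new vertices
`(e, 1), …, (e, k - 1)` for each edge `e` of `H`. -/
def subVerts (k : ℕ) (H : Graph α β) : Set (α ⊕ (β × ℕ)) :=
  {p | (∃ x ∈ H.vertexSet, p = Sum.inl x) ∨
    ∃ e ∈ H.edgeSet, ∃ i, 0 < i ∧ i < k ∧ p = Sum.inr (e, i)}

theorem subPos_mem (k : ℕ) (H : Graph α β) (src tgt : β → α) (h : IsOrientation H src tgt)
    {e : β} (he : e ∈ H.edgeSet) {i : ℕ} (hi : i ≤ k) :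
    subPos k src tgt e i ∈ subVerts k H := by
  unfold subPos
  split_ifs with h0 hk
  · exact Or.inl ⟨_, (h e he).left_mem, rfl⟩
  · exact Or.inl ⟨_, (h e he).right_mem, rfl⟩
  · exact Or.inr ⟨e, he, i, by omega, by omega, rfl⟩

/-- The `k`-subdivision `Sub_k(H)` of a multigraph `H`, again as a multigraph: every edge `e` of `H`
is replaced by the `k` edges `(e, 0), …, (e, k - 1)`, where `(e, i)` joins the vertices number `i`
and `i + 1` on the subdivided edge `e`. The orientation only serves to number the new vertices:
up to isomorphism, the result does not depend on it. -/
def Sub (k : ℕ) (H : Graph α β) (src tgt : β → α) (h : IsOrientation H src tgt) :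
    Graph (α ⊕ (β × ℕ)) (β × ℕ) where
  vertexSet := subVerts k H
  edgeSet := {d | d.1 ∈ H.edgeSet ∧ d.2 < k}
  IsLink d p q := (d.1 ∈ H.edgeSet ∧ d.2 < k) ∧
    s(p, q) = s(subPos k src tgt d.1 d.2, subPos k src tgt d.1 (d.2 + 1))
  isLink_symm d _ := ⟨fun p q hpq => ⟨hpq.1, by rw [Sym2.eq_swap]; exact hpq.2⟩⟩
  eq_or_eq_of_isLink_of_isLink d p q r s h1 h2 := by
    have h3 := h1.2.trans h2.2.symm
    rw [Sym2.eq_iff] at h3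
    rcases h3 with h3 | h3
    · exact Or.inl h3.1
    · exact Or.inr h3.1
  edge_mem_iff_exists_isLink d :=
    ⟨fun hd => ⟨_, _, hd, rfl⟩, fun ⟨_, _, hd⟩ => hd.1⟩
  left_mem_of_isLink d p q hpq := by
    obtain ⟨⟨he, hk⟩, hs⟩ := hpq
    rw [Sym2.eq_iff] at hs
    rcases hs with hs | hs
    · rw [hs.1]; exact subPos_mem k H src tgt h he hk.le
    · rw [hs.1]; exact subPos_mem k H src tgt h he hk

end Subdivision

/-- "`B = Sub_k(H)` for some finite multigraph `H`, whose vertex set `V(H)` is the subset `W` of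
`V(B)`": the multigraph `Sub_k(H)` is simple, `φ` is an isomorphism from it to `B`, and `W` is the
set of the vertices of `B` that correspond under `φ` to vertices of `H`. -/
def IsSubdivisionWith {V : Type u} {G : SimpleGraph V} (k : ℕ) (B : G.Subgraph) (W : Set V) :
    Prop :=
  ∃ (α β : Type u) (_ : Finite α) (_ : Finite β) (H : Graph α β) (src tgt : β → α)
    (h : IsOrientation H src tgt) (φ : (Sub k H src tgt h).toSimpleGraph ≃g B.coe),
    (Sub k H src tgt h).Simple ∧ W = {w | ∃ y, (∃ x : α, y.1 = Sum.inl x) ∧ (φ y : V) = w}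

/-- The class `ℋ'_k` (on the vertex set `V`): for every non-trivial block `B` there is a multigraph
`H` with `B = Sub_k(H)` such that every component `K` of `G - V(H)` that contains a vertex of
`V(B) \ V(H)` is a tree without a `k`-path. Here `W` is `V(H)`. -/
def classH' (k : ℕ) (V : Type u) : Set (SimpleGraph V) :=
  {G | ∀ B : G.Subgraph, IsNontrivialBlock G B → ∃ W : Set V, IsSubdivisionWith k B W ∧
    ∀ K : (G.induce Wᶜ).ConnectedComponent, (∃ x ∈ K.supp, (x : V) ∈ B.verts) →
      K.toSimpleGraph.IsTree ∧ ∀ P : K.toSimpleGraph.Subgraph, ¬ IsKPath K.toSimpleGraph k P}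

end PathKE

/-! Both classes coincide with a third one, `CycCoverable`: every cycle, of order `n` say, carries a
set `X` of `n / k` of its vertices that meets each `k`-path meeting the cycle. Such an `X` is
necessarily one residue class modulo `k` of positions on the cycle.

From `CycCoverable` to `𝒢'_k`: a cycle splits into `n / k` arcs of order `k`, so it can be removed
together with `X` at no loss; in a part without cycles, a smallest pendant piece containing a
`k`-path has a root meeting all `k`-paths that touch the piece (`CycCoverable.konigIn`).

From `𝒢'_k` to `CycCoverable`: König-Egerváry on a single cycle shows that `k` divides every cycle
order. As `k = 2h + 1` is odd, every ear of a cycle then has length divisible by `k`, and a `k`-path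
meets a cycle in one arc with a pendant path at each end. A `k`-path avoiding the class of `r`
yields a pendant path of some length `δ ≤ h` attached at distance `δ` from that class. If every
class were avoided, the punctured intervals whose radii are the lengths of pendant paths would cover
all residues. A minimal cover admits a set `U` of more residues than intervals, with at most one in
each half interval (`exists_sparse_residues`). In the cycle plus the chosen pendant paths, each
`k`-path has at least `|U|` vertices of a set with fewer than `(n / k + 1) |U|` vertices
(`PendSystem.card_le_ncard_inter`), so the matching number is at most `n / k`. A cover of that size
is a residue class, which one of the pendant paths avoids.

From `CycCoverable` to `ℋ'_k`: a branch vertex of a block lies in every cover of every cycle through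
it, so the covers in a block fit together to a set `W` (`exists_isHub`), the vertex set of the
required multigraph. A `k`-path in a component of `G - W` that meets the block would give a long
pendant path at a vertex outside `W`.

From `ℋ'_k` to `CycCoverable`: the vertices of `V(H)` on a cycle are spaced at distance `k`, and a
`k`-path that meets the cycle but misses them would return to the block or lie in a forbidden
component. -/

namespace KPath

variable {V : Type u} {G : SimpleGraph V}

/-! ### Paths and cycles as sequences of vertices -/

/-- The list `l` is the vertex sequence of a path of `G`. -/
structure IsPathList (G : SimpleGraph V) (l : List V) : Prop where
  chain : l.IsChain G.Adj
  nodup : l.Nodup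

theorem IsPathList.reverse {l : List V} (h : IsPathList G l) : IsPathList G l.reverse :=
  ⟨by rw [List.isChain_reverse]; exact h.chain.imp fun _ _ h => h.symm,
    List.nodup_reverse.2 h.nodup⟩

theorem IsPathList.infix {l l' : List V} (h : IsPathList G l) (h' : l' <:+: l) :
    IsPathList G l' :=
  ⟨h.chain.infix h', h.nodup.sublist h'.sublist⟩

theorem IsPathList.mono {G' : SimpleGraph V} (hG : G ≤ G') {l : List V} (h : IsPathList G l) :
    IsPathList G' l :=
  ⟨h.chain.imp fun _ _ h => hG h, h.nodup⟩

theorem exists_walk_of_isChain {l : List V} {a b : V} (h : l.IsChain G.Adj)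
    (ha : l.head? = some a) (hb : l.getLast? = some b) :
    ∃ w : G.Walk a b, w.support = l := by
  have hne : l ≠ [] := by rintro rfl; simp at ha
  rw [List.head?_eq_some_head hne] at ha
  rw [List.getLast?_eq_some_getLast hne] at hb
  obtain rfl := Option.some.inj ha
  obtain rfl := Option.some.inj hb
  exact ⟨SimpleGraph.Walk.ofSupport l hne h, SimpleGraph.Walk.support_ofSupport hne h⟩

/-- `c` runs periodically through the vertices of a cycle of `G` of order `n`. -/
structure IsCyc (G : SimpleGraph V) (n : ℕ) (c : ℤ → V) : Prop where
  three_le : 3 ≤ n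
  eq_iff : ∀ i j, c i = c j ↔ (n : ℤ) ∣ i - j
  adj : ∀ i, G.Adj (c i) (c (i + 1))

namespace IsCyc

variable {n : ℕ} {c : ℤ → V}

/-- Indexing by all integers turns rotation and reversal of a cycle into substitutions, so that a
base point and a direction can be fixed freely later on. -/
theorem shift (h : IsCyc G n c) (a : ℤ) : IsCyc G n (fun i => c (a + i)) where
  three_le := h.three_le
  eq_iff i j := by rw [h.eq_iff]; ring_nf
  adj i := by rw [← add_assoc]; exact h.adj _

theorem neg (h : IsCyc G n c) : IsCyc G n (fun i => c (-i)) where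
  three_le := h.three_le
  eq_iff i j := by rw [h.eq_iff, ← dvd_neg]; ring_nf
  adj i := by
    have := (h.adj (-(i + 1))).symm
    simpa using this

theorem mono {G' : SimpleGraph V} (hG : ∀ i, G.Adj (c i) (c (i + 1)) → G'.Adj (c i) (c (i + 1)))
    (h : IsCyc G n c) : IsCyc G' n c :=
  ⟨h.three_le, h.eq_iff, fun i => hG i (h.adj i)⟩

theorem adj_sub (h : IsCyc G n c) (i : ℤ) : G.Adj (c i) (c (i - 1)) := by
  have := (h.adj (i - 1)).symm
  simpa using this

theorem range_neg (c : ℤ → V) : Set.range (fun i => c (-i)) = Set.range c := by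
  ext v
  constructor
  · rintro ⟨i, rfl⟩; exact ⟨-i, rfl⟩
  · rintro ⟨i, rfl⟩; exact ⟨-i, by simp⟩

theorem range_shift (c : ℤ → V) (a : ℤ) : Set.range (fun i => c (a + i)) = Set.range c := by
  ext v
  constructor
  · rintro ⟨i, rfl⟩; exact ⟨a + i, rfl⟩
  · rintro ⟨i, rfl⟩; exact ⟨i - a, by simp⟩

theorem eq_of_lt (h : IsCyc G n c) {i j : ℤ} (hij : c i = c j) (h1 : i - j < n) (h2 : j - i < n) :
    i = j := by
  have := Int.eq_zero_of_abs_lt_dvd ((h.eq_iff i j).1 hij) (by rw [abs_lt]; omega)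
  omega

/-- Every vertex of the cycle occurs among any `n` consecutive ones. -/
theorem exists_nat_lt (h : IsCyc G n c) (a i : ℤ) : ∃ j : ℕ, j < n ∧ c (a + j) = c i := by
  have hn : (0 : ℤ) < n := by have := h.three_le; omega
  have h0 := Int.emod_nonneg (i - a) hn.ne'
  have h1 := Int.emod_lt_of_pos (i - a) hn
  refine ⟨((i - a) % n).toNat, by omega, ?_⟩
  rw [h.eq_iff, Int.toNat_of_nonneg h0]
  refine ⟨-((i - a) / n), ?_⟩
  have := Int.emod_add_mul_ediv (i - a) n
  linarith

end IsCyc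

/-- The `L` consecutive vertices of `c` from position `p` on. -/
def arc (c : ℤ → V) (p : ℤ) (L : ℕ) : List V := (List.range L).map fun j : ℕ => c (p + j)

theorem length_arc (c : ℤ → V) (p : ℤ) (L : ℕ) : (arc c p L).length = L := by simp [arc]

theorem mem_arc {c : ℤ → V} {p : ℤ} {L : ℕ} {v : V} :
    v ∈ arc c p L ↔ ∃ j : ℕ, j < L ∧ c (p + j) = v := by simp [arc]

theorem arc_succ (c : ℤ → V) (p : ℤ) (L : ℕ) : arc c p (L + 1) = c p :: arc c (p + 1) L := by
  simp only [arc, List.range_succ_eq_map, List.map_cons, List.map_map]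
  congr 1
  · simp
  · apply List.map_congr_left
    intro j _
    simp only [Function.comp]
    congr 1
    push_cast; ring

theorem arc_succ' (c : ℤ → V) (p : ℤ) (L : ℕ) : arc c p (L + 1) = arc c p L ++ [c (p + L)] := by
  simp [arc, List.range_succ]

theorem head?_arc (c : ℤ → V) (p : ℤ) {L : ℕ} (hL : 0 < L) : (arc c p L).head? = some (c p) := by
  obtain ⟨L, rfl⟩ := Nat.exists_eq_succ_of_ne_zero hL.ne'
  rw [arc_succ]; rfl

theorem getLast?_arc (c : ℤ → V) (p : ℤ) (L : ℕ) :
    (arc c p (L + 1)).getLast? = some (c (p + L)) := by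
  rw [arc_succ']; simp

theorem mem_range_of_mem_arc {c : ℤ → V} {p : ℤ} {L : ℕ} {v : V} (h : v ∈ arc c p L) :
    v ∈ Set.range c := by
  obtain ⟨j, -, rfl⟩ := mem_arc.1 h
  exact ⟨_, rfl⟩

theorem IsCyc.isChain_arc {n : ℕ} {c : ℤ → V} (h : IsCyc G n c) (p : ℤ) (L : ℕ) :
    (arc c p L).IsChain G.Adj := by
  induction L generalizing p with
  | zero => simp [arc]
  | succ L ih =>
    rw [arc_succ, List.isChain_cons]
    refine ⟨fun y hy => ?_, ih _⟩
    rcases Nat.eq_zero_or_pos L with rfl | hL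
    · simp [arc] at hy
    · rw [head?_arc _ _ hL] at hy
      obtain rfl := Option.some.inj hy
      exact h.adj p

theorem IsCyc.nodup_arc {n : ℕ} {c : ℤ → V} (h : IsCyc G n c) (p : ℤ) {L : ℕ} (hL : L ≤ n) :
    (arc c p L).Nodup := by
  refine List.Nodup.map_on ?_ List.nodup_range
  intro i hi j hj hij
  rw [List.mem_range] at hi hj
  have := h.eq_of_lt hij (by omega) (by omega)
  omega

theorem IsCyc.isPathList_arc {n : ℕ} {c : ℤ → V} (h : IsCyc G n c) (p : ℤ) {L : ℕ} (hL : L ≤ n) :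
    IsPathList G (arc c p L) :=
  ⟨h.isChain_arc p L, h.nodup_arc p hL⟩

/-- A path with adjacent ends and at least three vertices closes up to a cycle. -/
theorem exists_isCyc_of_isPathList {l : List V} (hl : IsPathList G l) (h3 : 3 ≤ l.length)
    {a b : V} (ha : l.head? = some a) (hb : l.getLast? = some b) (hab : G.Adj b a) :
    ∃ c : ℤ → V, IsCyc G l.length c ∧ (∀ v, v ∈ Set.range c ↔ v ∈ l) ∧
      ∀ (i : ℕ) (hi : i < l.length), c i = l[i] := by
  have hn : (0 : ℤ) < l.length := by omega
  have hlt : ∀ i : ℤ, (i % l.length).toNat < l.length := fun i => by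
    have h0 := Int.emod_nonneg i hn.ne'
    have h1 := Int.emod_lt_of_pos i hn
    omega
  have hnat : ∀ (i : ℕ) (hi : i < l.length), ((i : ℤ) % l.length).toNat = i := by
    intro i hi
    rw [Int.emod_eq_of_lt (by omega) (by omega)]; simp
  refine ⟨fun i => l[(i % l.length).toNat]'(hlt i), ⟨h3, ?_, ?_⟩, ?_, ?_⟩
  · intro i j
    rw [hl.nodup.getElem_inj_iff, Int.dvd_iff_emod_eq_zero,
      ← Int.emod_eq_emod_iff_emod_sub_eq_zero]
    have h0 := Int.emod_nonneg i hn.ne'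
    have h1 := Int.emod_nonneg j hn.ne'
    omega
  · intro i
    have h0 := Int.emod_nonneg i hn.ne'
    have h1 := Int.emod_lt_of_pos i hn
    have h2 := Int.emod_add_mul_ediv i l.length
    rw [List.head?_eq_getElem?, List.getElem?_eq_getElem (by omega)] at ha
    rw [List.getLast?_eq_getElem?, List.getElem?_eq_getElem (by omega)] at hb
    have ha := Option.some.inj ha
    have hb := Option.some.inj hb
    by_cases hr : i % l.length + 1 < l.length
    · have h3 : (i + 1) % l.length = i % l.length + 1 := by
        rw [← Int.emod_add_emod, Int.emod_eq_of_lt (by omega) hr]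
      have := List.isChain_iff_getElem.1 hl.chain (i % l.length).toNat (by omega)
      convert this using 2
      omega
    · have h3 : (i + 1) % l.length = 0 := by
        rw [← Int.emod_add_emod, show i % (l.length : ℤ) + 1 = l.length by omega, Int.emod_self]
      convert hab using 1
      · rw [← hb]; congr 1; omega
      · rw [← ha]; congr 1; omega
  · intro v
    constructor
    · rintro ⟨i, rfl⟩; exact List.getElem_mem _
    · intro hv
      obtain ⟨i, hi, rfl⟩ := List.getElem_of_mem hv
      exact ⟨i, by simp only [hnat i hi]⟩
  · intro i hi
    simp only [hnat i hi]

theorem exists_isCyc_of_isCycle {a : V} {w : G.Walk a a} (hw : w.IsCycle) :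
    ∃ c : ℤ → V, IsCyc G w.length c ∧ ∀ v, v ∈ Set.range c ↔ v ∈ w.support := by
  have h3 := hw.three_le_length
  -- The support lists the base point twice; its tail lists every vertex once and ends at the base
  -- point.
  have hlen : w.support.tail.length = w.length := by simp
  have hch : (a :: w.support.tail).IsChain G.Adj := by
    rw [SimpleGraph.Walk.cons_tail_support]; exact w.isChain_adj_support
  obtain ⟨b, l, hbl⟩ : ∃ b l, w.support.tail = b :: l := by
    cases h : w.support.tail with
    | nil => rw [h] at hlen; simp at hlen; omega
    | cons b l => exact ⟨b, l, rfl⟩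
  have hlast : w.support.tail.getLast? = some a := by
    have h1 : w.support.getLast? = some a := by
      rw [List.getLast?_eq_some_getLast w.support_ne_nil, SimpleGraph.Walk.getLast_support]
    rw [← SimpleGraph.Walk.cons_tail_support, hbl] at h1
    rw [hbl]; simpa using h1
  have hab : G.Adj a b := by rw [hbl] at hch; exact hch.rel
  obtain ⟨c, hc, hr, -⟩ := exists_isCyc_of_isPathList (G := G) (l := w.support.tail)
    ⟨hch.tail, hw.support_nodup⟩ (by omega) (by rw [hbl]; rfl) hlast hab
  refine ⟨c, hlen ▸ hc, fun v => (hr v).trans ?_⟩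
  constructor
  · exact List.mem_of_mem_tail
  · rw [← SimpleGraph.Walk.cons_tail_support, List.mem_cons]
    rintro (rfl | h)
    · exact List.mem_of_getLast? hlast
    · simpa using h

theorem IsCyc.exists_isCycle {n : ℕ} {c : ℤ → V} (h : IsCyc G n c) :
    ∃ w : G.Walk (c 0) (c 0), w.IsCycle ∧ w.length = n := by
  have h3 := h.three_le
  obtain ⟨w, hw⟩ := exists_walk_of_isChain (h.isChain_arc 1 n) (head?_arc c 1 (by omega))
    (b := c 0) (by
      obtain ⟨m, rfl⟩ := Nat.exists_eq_succ_of_ne_zero (show n ≠ 0 by omega)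
      rw [getLast?_arc, Option.some_inj, h.eq_iff]
      exact ⟨1, by push_cast; ring⟩)
  have hl : w.length + 1 = n := by rw [← SimpleGraph.Walk.length_support, hw, length_arc]
  refine ⟨SimpleGraph.Walk.cons (by simpa using h.adj 0) w, ?_, by simpa using hl⟩
  rw [SimpleGraph.Walk.isCycle_iff_isPath_tail_and_le_length]
  refine ⟨?_, by simpa using by omega⟩
  rw [SimpleGraph.Walk.isPath_def, SimpleGraph.Walk.support_tail_of_not_nil _ (by simp),
    SimpleGraph.Walk.support_cons, List.tail_cons, hw]
  exact h.nodup_arc 1 le_rfl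

/-! ### Reachability inside a set of vertices -/

/-- The spanning subgraph of `G` formed by the edges with both ends in `S`. -/
def within (G : SimpleGraph V) (S : Set V) : SimpleGraph V where
  Adj a b := G.Adj a b ∧ a ∈ S ∧ b ∈ S
  symm := ⟨fun _ _ h => ⟨h.1.symm, h.2.2, h.2.1⟩⟩
  loopless := ⟨fun _ h => h.1.ne rfl⟩

theorem mem_of_reachable {S D : Set V} {a b : V} (h : (within G S).Reachable a b) (ha : a ∈ D)
    (hD : ∀ x ∈ D, ∀ y ∈ S, x ∈ S → G.Adj x y → y ∈ D) : b ∈ D := by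
  obtain ⟨w⟩ := h
  induction w with
  | nil => exact ha
  | cons hab _ ih => exact ih (hD _ ha _ hab.2.2 hab.2.1 hab.1)

theorem mem_of_reachable_within {S : Set V} {a b : V} (h : (within G S).Reachable a b)
    (ha : a ∈ S) : b ∈ S :=
  mem_of_reachable h ha fun _ _ _ hy _ _ => hy

theorem reachable_of_isChain {l : List V} {S : Set V} (h : l.IsChain G.Adj) (hS : ∀ v ∈ l, v ∈ S)
    {a b : V} (ha : a ∈ l) (hb : b ∈ l) : (within G S).Reachable a b := by
  have key : ∀ (l : List V) (x : V), (x :: l).IsChain G.Adj → (∀ v ∈ x :: l, v ∈ S) →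
      ∀ y ∈ x :: l, (within G S).Reachable x y := by
    intro l
    induction l with
    | nil => intro x _ _ y hy; rw [List.mem_singleton] at hy; rw [hy]
    | cons z l ih =>
      intro x hc hm y hy
      rcases List.mem_cons.1 hy with rfl | hy
      · exact SimpleGraph.Reachable.refl _
      · have hxz : (within G S).Adj x z := ⟨hc.rel, hm _ (by simp), hm _ (by simp)⟩
        exact hxz.reachable.trans (ih z hc.tail (fun v hv => hm v (List.mem_cons_of_mem _ hv)) y hy)
  cases l with
  | nil => simp at ha
  | cons x l => exact (key l x h hS a ha).symm.trans (key l x h hS b hb)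

theorem exists_pathList_of_reachable {S : Set V} {a b : V} (h : (within G S).Reachable a b)
    (ha : a ∈ S) : ∃ l : List V, IsPathList G l ∧ (∀ v ∈ l, v ∈ S) ∧ l.head? = some a ∧
      l.getLast? = some b := by
  classical
  obtain ⟨w, hw⟩ := h.exists_isPath
  refine ⟨w.support, ⟨w.isChain_adj_support.imp fun _ _ h => h.1, hw.support_nodup⟩, ?_, ?_, ?_⟩
  · intro v hv
    exact mem_of_reachable_within (w.takeUntil v hv).reachable ha
  · rw [List.head?_eq_some_head w.support_ne_nil, SimpleGraph.Walk.head_support]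
  · rw [List.getLast?_eq_some_getLast w.support_ne_nil, SimpleGraph.Walk.getLast_support]

/-- If two neighbours of `v` are joined by a path avoiding `v`, then `v` lies on a cycle. -/
theorem exists_isCyc_of_reachable {S : Set V} {v a b : V} (hv : v ∉ S)
    (h : (within G S).Reachable a b) (ha : a ∈ S) (hab : a ≠ b) (hva : G.Adj v a)
    (hvb : G.Adj v b) : ∃ n c, IsCyc G n c ∧ c 0 = v ∧ c 1 = a ∧ b ∈ Set.range c ∧
      Set.range c ⊆ insert v S := by
  obtain ⟨l, hl, hS, hh, ht⟩ := exists_pathList_of_reachable h ha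
  have hvl : v ∉ l := fun h => hv (hS v h)
  obtain ⟨l', rfl⟩ : ∃ l', l = a :: l' := by
    cases l with
    | nil => simp at hh
    | cons x l => exact ⟨l, by rw [Option.some.inj hh]⟩
  have hl' : l' ≠ [] := by
    rintro rfl
    exact hab (Option.some.inj ht)
  have hlen := List.length_pos_of_ne_nil hl'
  obtain ⟨c, hc, hr, hi⟩ := exists_isCyc_of_isPathList (G := G) (l := v :: a :: l') (a := v) (b := b)
    ⟨List.isChain_cons.2 ⟨fun y hy => by obtain rfl := Option.some.inj hy; exact hva, hl.chain⟩,
      List.nodup_cons.2 ⟨hvl, hl.nodup⟩⟩ (by simp; omega) rfl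
    (by rw [List.getLast?_cons_cons]; exact ht) hvb.symm
  refine ⟨_, c, hc, hi 0 (by simp), hi 1 (by simp), ?_, ?_⟩
  · exact (hr b).2 (List.mem_cons_of_mem _ (List.mem_of_getLast? ht))
  · intro x hx
    rcases List.mem_cons.1 ((hr x).1 hx) with rfl | hx
    · exact Set.mem_insert _ _
    · exact Set.mem_insert_of_mem _ (hS x hx)

/-! ### Vertex sets of `k`-paths -/

/-- `T` is the vertex set of a path of order `k`. -/
def IsKSet (G : SimpleGraph V) (k : ℕ) (T : Set V) : Prop :=
  ∃ l : List V, IsPathList G l ∧ l.length = k ∧ {v | v ∈ l} = T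

theorem isKSet_of_isKPath {k : ℕ} {P : G.Subgraph} (h : PathKE.IsKPath G k P) :
    IsKSet G k P.verts := by
  obtain ⟨a, b, p, hp, hl, rfl⟩ := h
  refine ⟨p.support, ⟨p.isChain_adj_support, hp.support_nodup⟩, by simpa using hl, ?_⟩
  ext v; simp

theorem IsKSet.exists_isKPath {k : ℕ} (hk : 0 < k) {T : Set V} (h : IsKSet G k T) :
    ∃ P : G.Subgraph, PathKE.IsKPath G k P ∧ P.verts = T := by
  obtain ⟨l, hl, hlen, rfl⟩ := h
  have hne : l ≠ [] := by rintro rfl; simp at hlen; omega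
  obtain ⟨w, hw⟩ := exists_walk_of_isChain hl.chain (List.head?_eq_some_head hne)
    (List.getLast?_eq_some_getLast hne)
  refine ⟨w.toSubgraph, ⟨_, _, w, ?_, ?_, rfl⟩, ?_⟩
  · rw [SimpleGraph.Walk.isPath_def, hw]; exact hl.nodup
  · rw [← SimpleGraph.Walk.length_support, hw, hlen]
  · ext v; simp [hw]

theorem IsKSet.nonempty {k : ℕ} (hk : 0 < k) {T : Set V} (h : IsKSet G k T) : T.Nonempty := by
  obtain ⟨l, hl, hlen, rfl⟩ := h
  obtain ⟨v, hv⟩ := List.exists_mem_of_ne_nil l (by rintro rfl; simp at hlen; omega)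
  exact ⟨v, hv⟩

theorem IsKSet.ncard_eq {k : ℕ} {T : Set V} (h : IsKSet G k T) : T.ncard = k := by
  classical
  obtain ⟨l, hl, hlen, rfl⟩ := h
  rw [show {v | v ∈ l} = (l.toFinset : Set V) by ext; simp, Set.ncard_coe_finset,
    List.toFinset_card_of_nodup hl.nodup, hlen]

theorem IsCyc.isKSet_arc {n : ℕ} {c : ℤ → V} (h : IsCyc G n c) (p : ℤ) {k : ℕ} (hk : k ≤ n) :
    IsKSet G k {v | v ∈ arc c p k} :=
  ⟨_, h.isPathList_arc p hk, length_arc _ _ _, rfl⟩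

theorem IsKSet.image_val {k : ℕ} {S : Set V} {T : Set S} (h : IsKSet (G.induce S) k T) :
    IsKSet G k (Subtype.val '' T) := by
  obtain ⟨l, hl, hlen, rfl⟩ := h
  refine ⟨l.map Subtype.val, ⟨?_, hl.nodup.map Subtype.val_injective⟩, by simpa using hlen, ?_⟩
  · rw [List.isChain_map]; exact hl.chain
  · ext v; simp

theorem IsKSet.preimage_val {k : ℕ} {S T : Set V} (h : IsKSet G k T) (hT : T ⊆ S) :
    IsKSet (G.induce S) k (Subtype.val ⁻¹' T) := by
  obtain ⟨l, hl, hlen, rfl⟩ := h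
  have hT' : ∀ x ∈ l, x ∈ S := fun x hx => hT hx
  lift l to List S using hT'
  refine ⟨l, ⟨?_, hl.nodup.of_map _⟩, by simpa using hlen, ?_⟩
  · exact (List.isChain_map Subtype.val).1 hl.chain
  · ext v; simp

/-! ### König-Egerváry property inside a set of vertices -/

/-- Inside `S` there are a `k`-matching and a `k`-vertex cover of the same cardinality. -/
def KonigIn (G : SimpleGraph V) (k : ℕ) (S : Set V) : Prop :=
  ∃ (M : Set (Set V)) (X : Set V), (∀ T ∈ M, IsKSet G k T ∧ T ⊆ S) ∧
    (M.Pairwise fun T T' => Disjoint T T') ∧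
    (∀ T, IsKSet G k T → T ⊆ S → (X ∩ T).Nonempty) ∧ X.ncard ≤ M.ncard

theorem ncard_le_of_matching_of_cover [Finite V] {k : ℕ} {M : Set G.Subgraph} {X : Set V}
    (hM : PathKE.IsKMatching G k M) (hX : PathKE.IsKVertexCover G k X) : M.ncard ≤ X.ncard := by
  have h : ∀ P ∈ M, ∃ x, x ∈ X ∩ P.verts := fun P hP => hX P (hM.1 P hP)
  rcases isEmpty_or_nonempty V with hV | hV
  · have : M = ∅ := Set.eq_empty_of_forall_notMem fun P hP => hV.elim (h P hP).choose
    simp [this]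
  · choose! f hf using h
    refine Set.ncard_le_ncard_of_injOn f (fun P hP => (hf P hP).1) (fun P hP Q hQ hPQ => ?_)
      (Set.toFinite X)
    by_contra hne
    exact Set.disjoint_left.1 (hM.2 hP hQ hne) (hf P hP).2 (hPQ ▸ (hf Q hQ).2)

/-- No matching is larger than a cover, so `KonigIn` records one inequality only. Vertex sets can
replace paths because disjoint nonempty paths have different vertex sets. -/
theorem nu_eq_tau_iff [Finite V] {k : ℕ} (hk : 0 < k) (G : SimpleGraph V) :
    PathKE.nu k G = PathKE.tau k G ↔ KonigIn G k Set.univ := by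
  have hbdd : BddAbove {n | ∃ M : Set G.Subgraph, PathKE.IsKMatching G k M ∧ M.ncard = n} := by
    refine ⟨Nat.card G.Subgraph, ?_⟩
    rintro n ⟨M, -, rfl⟩
    exact Set.ncard_le_card M
  have hne : {n | ∃ M : Set G.Subgraph, PathKE.IsKMatching G k M ∧ M.ncard = n}.Nonempty :=
    ⟨0, ∅, ⟨by simp, by simp⟩, by simp⟩
  have hne' : {n | ∃ X : Set V, PathKE.IsKVertexCover G k X ∧ X.ncard = n}.Nonempty :=
    ⟨_, Set.univ, fun P hP => by
      rw [Set.univ_inter]; exact (isKSet_of_isKPath hP).nonempty hk, rfl⟩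
  obtain ⟨M, hM, hMn⟩ := Nat.sSup_mem hne hbdd
  obtain ⟨X, hX, hXn⟩ := Nat.sInf_mem hne'
  change M.ncard = PathKE.nu k G at hMn
  change X.ncard = PathKE.tau k G at hXn
  constructor
  · intro h
    have hinj : Set.InjOn (fun P : G.Subgraph => P.verts) M := by
      intro P hP Q hQ hPQ
      by_contra hne
      obtain ⟨x, hx⟩ := (isKSet_of_isKPath (hM.1 P hP)).nonempty hk
      have hPQ : P.verts = Q.verts := hPQ
      exact Set.disjoint_left.1 (hM.2 hP hQ hne) hx (hPQ ▸ hx)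
    refine ⟨(fun P : G.Subgraph => P.verts) '' M, X, ?_, ?_, ?_, ?_⟩
    · rintro _ ⟨P, hP, rfl⟩
      exact ⟨isKSet_of_isKPath (hM.1 P hP), Set.subset_univ _⟩
    · rintro _ ⟨P, hP, rfl⟩ _ ⟨Q, hQ, rfl⟩ hne
      exact hM.2 hP hQ fun h => hne (by rw [h])
    · intro T hT _
      obtain ⟨P, hP, rfl⟩ := hT.exists_isKPath hk
      exact hX P hP
    · rw [hinj.ncard_image]; omega
  · rintro ⟨M', X', hM', hd, hX', hle⟩
    have h : ∀ T ∈ M', ∃ P : G.Subgraph, PathKE.IsKPath G k P ∧ P.verts = T :=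
      fun T hT => (hM' T hT).1.exists_isKPath hk
    choose! f hf using h
    have hinj : Set.InjOn f M' := fun T hT T' hT' h => by
      rw [← (hf T hT).2, ← (hf T' hT').2, h]
    have h1 : M'.ncard ≤ PathKE.nu k G := by
      refine le_csSup hbdd ⟨f '' M', ⟨?_, ?_⟩, hinj.ncard_image⟩
      · rintro _ ⟨T, hT, rfl⟩; exact (hf T hT).1
      · rintro _ ⟨T, hT, rfl⟩ _ ⟨T', hT', rfl⟩ hne
        rw [(hf T hT).2, (hf T' hT').2]
        exact hd hT hT' fun h => hne (by rw [h])
    have h2 : PathKE.tau k G ≤ X'.ncard :=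
      Nat.sInf_le ⟨X', fun P hP => hX' _ (isKSet_of_isKPath hP) (Set.subset_univ _), rfl⟩
    have h3 := ncard_le_of_matching_of_cover hM hX
    omega

theorem konigIn_induce {k : ℕ} [Finite V] {S : Set V} :
    KonigIn (G.induce S) k Set.univ ↔ KonigIn G k S := by
  have hval : Function.Injective (Subtype.val : S → V) := Subtype.val_injective
  constructor
  · rintro ⟨M, X, hM, hd, hX, hle⟩
    refine ⟨(Subtype.val '' ·) '' M, Subtype.val '' X, ?_, ?_, ?_, ?_⟩
    · rintro _ ⟨T, hT, rfl⟩
      exact ⟨(hM T hT).1.image_val, Subtype.coe_image_subset S T⟩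
    · rintro _ ⟨T, hT, rfl⟩ _ ⟨T', hT', rfl⟩ hne
      exact Set.disjoint_image_of_injective hval (hd hT hT' fun h => hne (by rw [h]))
    · intro T hT hTS
      obtain ⟨x, hx, hx'⟩ := hX _ (hT.preimage_val hTS) (Set.subset_univ _)
      exact ⟨x, ⟨x, hx, rfl⟩, hx'⟩
    · rw [Set.ncard_image_of_injective _ hval, Set.ncard_image_of_injective _ hval.image_injective]
      exact hle
  · rintro ⟨M, X, hM, hd, hX, hle⟩
    refine ⟨(Subtype.val ⁻¹' ·) '' M, Subtype.val ⁻¹' X, ?_, ?_, ?_, ?_⟩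
    · rintro _ ⟨T, hT, rfl⟩
      exact ⟨(hM T hT).1.preimage_val (hM T hT).2, Set.subset_univ _⟩
    · rintro _ ⟨T, hT, rfl⟩ _ ⟨T', hT', rfl⟩ hne
      exact (hd hT hT' fun h => hne (by rw [h])).preimage _
    · intro T hT _
      obtain ⟨x, hx, y, hy, rfl⟩ := hX _ hT.image_val (Subtype.coe_image_subset S T)
      exact ⟨y, hx, hy⟩
    · rw [Set.InjOn.ncard_image]
      · refine le_trans ?_ hle
        rw [← Set.ncard_image_of_injective _ hval]
        exact Set.ncard_le_ncard (Set.image_preimage_subset _ _) (Set.toFinite _)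
      · intro T hT T' hT' h
        have h : (Subtype.val ⁻¹' T : Set S) = Subtype.val ⁻¹' T' := h
        rw [Subtype.preimage_val_eq_preimage_val_iff] at h
        rwa [Set.inter_eq_right.2 (hM T hT).2, Set.inter_eq_right.2 (hM T' hT').2] at h

theorem mem_classG_iff [Finite V] {k : ℕ} (hk : 0 < k) :
    G ∈ PathKE.classG k V ↔ ∀ S : Set V, KonigIn G k S :=
  forall_congr' fun _ => (nu_eq_tau_iff hk _).trans konigIn_induce

/-! ### Covers of cycles -/

/-- A set meeting every window of length `k` of a cycle of order at least `k * |X|` consists of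
equally spaced vertices of the cycle. -/
theorem IsCyc.equally_spaced [Finite V] {n k : ℕ} {c : ℤ → V} (hc : IsCyc G n c) {X : Set V}
    (hle : k * X.ncard ≤ n) (hX : ∀ p : ℤ, ∃ j : ℕ, j < k ∧ c (p + j) ∈ X) :
    X ⊆ Set.range c ∧ k * X.ncard = n ∧ ∃ r : ℤ, ∀ j, c j ∈ X ↔ (k : ℤ) ∣ j - r := by
  classical
  have hk : 0 < k := by obtain ⟨j, hj, -⟩ := hX 0; omega
  -- Double counting: summed over the `n` windows, `w` gives `k * |X ∩ c| ≤ k * |X| ≤ n`, while each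
  -- term is at least one. So every window contains exactly one vertex of `X`.
  set w : ℤ → ℕ := fun p => ((Finset.range k).filter fun i : ℕ => c (p + i) ∈ X).card with hw
  have hw1 : ∀ p, 1 ≤ w p := fun p => by
    obtain ⟨j, hj, hj'⟩ := hX p
    exact Finset.card_pos.2 ⟨j, Finset.mem_filter.2 ⟨Finset.mem_range.2 hj, hj'⟩⟩
  have hcount : ∀ p : ℤ, ((Finset.range n).filter fun j : ℕ => c (p + j) ∈ X).card =
      (X ∩ Set.range c).ncard := by
    intro p
    rw [← Set.ncard_coe_finset]
    refine Set.ncard_congr (fun (j : ℕ) _ => c (p + j)) ?_ ?_ ?_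
    · intro j hj
      rw [Finset.mem_coe, Finset.mem_filter] at hj
      exact ⟨hj.2, _, rfl⟩
    · intro i j hi hj hij
      simp only [Finset.coe_filter, Finset.mem_range, Set.mem_ofPred_eq] at hi hj
      have := hc.eq_of_lt hij (by omega) (by omega)
      omega
    · rintro _ ⟨hx, i, rfl⟩
      obtain ⟨j, hj, hj'⟩ := hc.exists_nat_lt p i
      refine ⟨j, ?_, hj'⟩
      rw [Finset.mem_coe, Finset.mem_filter, Finset.mem_range, hj']
      exact ⟨hj, hx⟩
  have hsum : ∀ p : ℤ, ∑ j ∈ Finset.range n, w (p + j) = k * (X ∩ Set.range c).ncard := by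
    intro p
    simp only [hw, Finset.card_filter]
    rw [Finset.sum_comm]
    have : ∀ i ∈ Finset.range k, (∑ j ∈ Finset.range n, if c (p + j + i) ∈ X then 1 else 0) =
        (X ∩ Set.range c).ncard := by
      intro i _
      rw [← hcount (p + i), Finset.card_filter]
      refine Finset.sum_congr rfl fun j _ => ?_
      rw [show p + j + i = p + i + j by ring]
    rw [Finset.sum_congr rfl this, Finset.sum_const, Finset.card_range, smul_eq_mul]
  have hsub : (X ∩ Set.range c).ncard ≤ X.ncard :=
    Set.ncard_le_ncard Set.inter_subset_left (Set.toFinite X)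
  have hge : n ≤ k * (X ∩ Set.range c).ncard := by
    rw [← hsum 0]
    calc n = ∑ j ∈ Finset.range n, 1 := by simp
      _ ≤ _ := Finset.sum_le_sum fun j _ => hw1 _
  have hmul := Nat.mul_le_mul_left k hsub
  have hn : k * X.ncard = n := by omega
  have heq : (X ∩ Set.range c).ncard = X.ncard :=
    Nat.eq_of_mul_eq_mul_left hk (by omega)
  have hXc : X ⊆ Set.range c := by
    have := Set.eq_of_subset_of_ncard_le (Set.inter_subset_left : X ∩ Set.range c ⊆ X)
      heq.ge (Set.toFinite X)
    exact Set.inter_eq_left.1 this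
  have hone : ∀ p, w p = 1 := by
    intro p
    by_contra hne
    have h2 : 1 < w (p + (0 : ℕ)) := by
      have := hw1 p
      simp only [Nat.cast_zero, add_zero]; omega
    have : ∑ j ∈ Finset.range n, 1 < ∑ j ∈ Finset.range n, w (p + j) :=
      Finset.sum_lt_sum (fun j _ => hw1 _)
        ⟨0, Finset.mem_range.2 (by have := hc.three_le; omega), h2⟩
    rw [hsum p] at this
    simp at this
    omega
  have huniq : ∀ (p : ℤ) (i j : ℕ), i < k → j < k → c (p + i) ∈ X → c (p + j) ∈ X → i = j := by
    intro p i j hi hj hi' hj'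
    have := Finset.card_le_one.1 (hone p).le
    exact this i (by simp [hi, hi']) j (by simp [hj, hj'])
  -- The windows from `p` and `p + 1` differ only in the positions `p` and `p + k`, and each holds
  -- exactly one vertex of `X`.
  have hup : ∀ p, c p ∈ X → c (p + k) ∈ X := by
    intro p hp
    obtain ⟨j, hj, hj'⟩ := hX (p + 1)
    by_cases hjk : j + 1 = k
    · rwa [show p + 1 + (j : ℤ) = p + k by rw [← hjk]; push_cast; ring] at hj'
    · have := huniq p 0 (j + 1) hk (by omega) (by simpa using hp)
        (by push_cast; rwa [show p + ((j : ℤ) + 1) = p + 1 + j by ring])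
      omega
  have hdown : ∀ p, c p ∈ X → c (p - k) ∈ X := by
    intro p hp
    obtain ⟨j, hj, hj'⟩ := hX (p - k)
    rcases Nat.eq_zero_or_pos j with rfl | hj0
    · simpa using hj'
    · have := huniq (p - k + j) 0 (k - j) hk (by omega) (by simpa using hj')
        (by rw [Nat.cast_sub hj.le]; rwa [show p - (k : ℤ) + j + (k - j) = p by ring])
      omega
  obtain ⟨r, -, hr⟩ := hX 0
  refine ⟨hXc, hn, (0 : ℤ) + r, ?_⟩
  generalize (0 : ℤ) + (r : ℤ) = r at hr
  have hmulk : ∀ t : ℤ, c (r + k * t) ∈ X := by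
    intro t
    induction t with
    | zero => simpa using hr
    | succ t ih =>
      have := hup _ ih
      rwa [show r + (k : ℤ) * (t + 1) = r + k * t + k by ring]
    | pred t ih =>
      have := hdown _ ih
      rwa [show r + (k : ℤ) * (-t - 1) = r + k * (-t) - k by ring]
  intro j
  constructor
  · intro hj
    have h0 := Int.emod_nonneg (j - r) (by omega : (k : ℤ) ≠ 0)
    have h1 := Int.emod_lt_of_pos (j - r) (by omega : (0 : ℤ) < k)
    have h2 := Int.emod_add_mul_ediv (j - r) k
    have := huniq (r + k * ((j - r) / k)) 0 ((j - r) % k).toNat hk (by omega)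
      (by simpa using hmulk _)
      (by rw [Int.toNat_of_nonneg h0]; convert hj using 2; linarith)
    exact Int.dvd_of_emod_eq_zero (by omega)
  · rintro ⟨t, ht⟩
    have := hmulk t
    rwa [show r + (k : ℤ) * t = j by linarith] at this

/-! ### Covers of single cycles imply the König-Egerváry property -/

/-- `X` is a set of `n / k` vertices of the cycle `c` of order `n` that meets all paths of
order `k` meeting the cycle. -/
structure IsCycCover (G : SimpleGraph V) (k n : ℕ) (c : ℤ → V) (X : Set V) : Prop where
  subset : X ⊆ Set.range c
  card_eq : k * X.ncard = n
  inter_nonempty : ∀ T, IsKSet G k T → (T ∩ Set.range c).Nonempty → (T ∩ X).Nonempty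

/-- Every cycle has a cover in the sense of `IsCycCover`. -/
def CycCoverable (G : SimpleGraph V) (k : ℕ) : Prop :=
  ∀ n c, IsCyc G n c → ∃ X, IsCycCover G k n c X

theorem IsCycCover.dvd {k n : ℕ} {c : ℤ → V} {X : Set V} (h : IsCycCover G k n c X) : k ∣ n :=
  ⟨_, h.card_eq.symm⟩

theorem IsCycCover.spaced [Finite V] {k n : ℕ} (hk : 0 < k) {c : ℤ → V} {X : Set V}
    (h : IsCycCover G k n c X) (hc : IsCyc G n c) :
    ∃ r : ℤ, ∀ j, c j ∈ X ↔ (k : ℤ) ∣ j - r := by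
  refine (hc.equally_spaced h.card_eq.le fun p => ?_).2.2
  have hkn : k ≤ n := Nat.le_of_dvd (by have := hc.three_le; omega) h.dvd
  obtain ⟨v, hv, hvX⟩ := h.inter_nonempty _ (hc.isKSet_arc p hkn)
    ⟨c p, mem_arc.2 ⟨0, hk, by simp⟩, p, rfl⟩
  obtain ⟨j, hj, rfl⟩ := mem_arc.1 hv
  exact ⟨j, hj, hvX⟩

/-- Induction step by peeling off `D`: the `k`-paths of `S` touching `D` are met by `X₀`, all others
live in `S \ D`, and the two matchings are disjoint from each other. -/
theorem KonigIn.of_diff [Finite V] {k : ℕ} (hk : 0 < k) {S D X₀ : Set V} {M₀ : Set (Set V)}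
    (hDS : D ⊆ S) (hM₀ : ∀ T ∈ M₀, IsKSet G k T ∧ T ⊆ D)
    (hd₀ : M₀.Pairwise fun T T' => Disjoint T T') (hle₀ : X₀.ncard ≤ M₀.ncard)
    (hX₀ : ∀ T, IsKSet G k T → T ⊆ S → (T ∩ D).Nonempty → (T ∩ X₀).Nonempty)
    (h : KonigIn G k (S \ D)) : KonigIn G k S := by
  obtain ⟨M, X, hM, hd, hX, hle⟩ := h
  have hcross : ∀ T ∈ M, ∀ T' ∈ M₀, Disjoint T T' := fun T hT T' hT' =>
    Set.disjoint_left.2 fun x hx hx' => ((hM T hT).2 hx).2 ((hM₀ T' hT').2 hx')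
  refine ⟨M ∪ M₀, X ∪ X₀, ?_, ?_, ?_, ?_⟩
  · rintro T (hT | hT)
    · exact ⟨(hM T hT).1, (hM T hT).2.trans Set.sdiff_subset⟩
    · exact ⟨(hM₀ T hT).1, (hM₀ T hT).2.trans hDS⟩
  · rintro T (hT | hT) T' (hT' | hT') hne
    · exact hd hT hT' hne
    · exact hcross T hT T' hT'
    · exact (hcross T' hT' T hT).symm
    · exact hd₀ hT hT' hne
  · intro T hT hTS
    by_cases hTD : (T ∩ D).Nonempty
    · obtain ⟨x, hx, hx'⟩ := hX₀ T hT hTS hTD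
      exact ⟨x, Or.inr hx', hx⟩
    · obtain ⟨x, hx, hx'⟩ := hX T hT fun x hx => ⟨hTS hx, fun hxD => hTD ⟨x, hx, hxD⟩⟩
      exact ⟨x, Or.inl hx, hx'⟩
  · have hdisj : Disjoint M M₀ := by
      refine Set.disjoint_left.2 fun T hT hT' => ?_
      obtain ⟨x, hx⟩ := (hM T hT).1.nonempty hk
      exact Set.disjoint_left.1 (hcross T hT T hT') hx hx
    rw [Set.ncard_union_eq hdisj (Set.toFinite _) (Set.toFinite _)]
    exact (Set.ncard_union_le _ _).trans (by omega)

/-- In an acyclic part of the graph that contains a path of order `k`, some vertex `v` meets all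
such paths that meet some set `D`, which contains one of them. -/
theorem exists_vertex_cover_of_acyclic [Finite V] {k : ℕ} {S : Set V}
    (hS : ∀ n c, IsCyc G n c → ¬ Set.range c ⊆ S) {T₀ : Set V} (hT₀ : IsKSet G k T₀)
    (hk : 0 < k) (hT₀S : T₀ ⊆ S) : ∃ (D : Set V) (v : V) (T : Set V), D ⊆ S ∧ IsKSet G k T ∧ T ⊆ D ∧
      ∀ T, IsKSet G k T → T ⊆ S → (T ∩ D).Nonempty → v ∈ T := by
  -- The candidates are pieces `D` attached to the rest of `S` only at a root `v`; a smallest one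
  -- that still contains a `k`-path is chosen.
  let Q : ℕ → Prop := fun m => ∃ (v : V) (D : Set V), D.ncard = m ∧ v ∈ D ∧ D ⊆ S ∧
    (∀ a ∈ D, a ≠ v → ∀ b ∈ S, G.Adj a b → b ∈ D) ∧ ∃ T, IsKSet G k T ∧ T ⊆ D
  have hQ : ∃ m, Q m := by
    obtain ⟨v, hv⟩ := hT₀.nonempty hk
    exact ⟨_, v, S, rfl, hT₀S hv, subset_rfl, fun _ _ _ _ hb _ => hb, T₀, hT₀, hT₀S⟩
  classical
  obtain ⟨v, D, hDm, hvD, hDS, hcl, T, hT, hTD⟩ := Nat.find_spec hQ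
  refine ⟨D, v, T, hDS, hT, hTD, ?_⟩
  rintro T' ⟨l, hl, hlen, rfl⟩ hlS ⟨x, hxl, hxD⟩
  by_contra hvl
  have hvl : v ∉ l := hvl
  have hxl : x ∈ l := hxl
  have hlD : ∀ y ∈ l, y ∈ D \ {v} := by
    intro y hy
    refine mem_of_reachable (reachable_of_isChain hl.chain (S := {v | v ∈ l}) (fun _ h => h) hxl hy)
      ⟨hxD, fun h => hvl (h ▸ hxl)⟩ ?_
    rintro a ⟨ha, hav⟩ b hb - hab
    exact ⟨hcl a ha hav b (hlS hb) hab, fun h => hvl (h ▸ hb)⟩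
  set E : Set V := {y | (within G (D \ {v})).Reachable x y} with hE
  have hED : E ⊆ D \ {v} := fun y hy => mem_of_reachable_within hy (hlD x hxl)
  have hlE : ∀ y ∈ l, y ∈ E := fun y hy => reachable_of_isChain hl.chain hlD hxl hy
  -- A `k`-path touching `D` but missing `v` stays in one component `E` of `D - v`. Two neighbours
  -- of `v` in `E` would close a cycle, so `E` is a smaller candidate, with root `u`.
  obtain ⟨u, huE, hu⟩ : ∃ u ∈ E, ∀ a ∈ E, G.Adj a v → a = u := by
    by_cases hex : ∃ u ∈ E, G.Adj u v
    · obtain ⟨u, huE, huv⟩ := hex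
      refine ⟨u, huE, fun a ha hav => ?_⟩
      by_contra hne
      obtain ⟨n, c, hc, -, -, -, hr⟩ := exists_isCyc_of_reachable (S := D \ {v}) (v := v)
        (by simp) (SimpleGraph.Reachable.trans (SimpleGraph.Reachable.symm ha) huE)
        (hED ha) hne hav.symm huv.symm
      refine hS n c hc (hr.trans ?_)
      rw [Set.insert_sdiff_singleton, Set.insert_eq_of_mem hvD]
      exact hDS
    · exact ⟨x, SimpleGraph.Reachable.refl _, fun a ha hav => absurd ⟨a, ha, hav⟩ hex⟩
  have hlt : E.ncard < D.ncard :=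
    Set.ncard_lt_ncard ⟨hED.trans Set.sdiff_subset, fun h => (hED (h hvD)).2 rfl⟩ (Set.toFinite D)
  refine Nat.find_min hQ (m := E.ncard) (by omega)
    ⟨u, E, rfl, huE, (hED.trans Set.sdiff_subset).trans hDS, ?_, _, ⟨l, hl, hlen, rfl⟩, hlE⟩
  intro a ha hau b hb hab
  have hbv : b ≠ v := by rintro rfl; exact hau (hu a ha hab)
  have hbD : b ∈ D \ {v} := ⟨hcl a (hED ha).1 (hED ha).2 b hb hab, hbv⟩
  have hadj : (within G (D \ {v})).Adj a b := ⟨hab, hED ha, hbD⟩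
  exact SimpleGraph.Reachable.trans ha hadj.reachable

theorem CycCoverable.konigIn [Finite V] {k : ℕ} (hk : 0 < k) (h : CycCoverable G k) (S : Set V) :
    KonigIn G k S := by
  induction hm : S.ncard using Nat.strong_induction_on generalizing S with
  | _ m ih =>
  have key : ∀ D ⊆ S, D.Nonempty → KonigIn G k (S \ D) := fun D hDS hD => by
    refine ih _ ?_ _ rfl
    rw [← hm]
    obtain ⟨x, hx⟩ := hD
    exact Set.ncard_lt_ncard ⟨Set.sdiff_subset, fun h => (h (hDS hx)).2 hx⟩ (Set.toFinite S)
  by_cases hcyc : ∃ n c, IsCyc G n c ∧ Set.range c ⊆ S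
  · obtain ⟨n, c, hc, hcS⟩ := hcyc
    obtain ⟨X, hX⟩ := h n c hc
    have hn := hX.card_eq
    have hkn : k ≤ n := Nat.le_of_dvd (by have := hc.three_le; omega) hX.dvd
    -- The matching on the cycle consists of the arcs of order `k` that start at the multiples of
    -- `k`.
    have hdisj : ∀ i j : ℕ, i < X.ncard → j < X.ncard → i ≠ j →
        Disjoint {v | v ∈ arc c (k * i) k} {v | v ∈ arc c (k * j) k} := by
      have main : ∀ i j : ℕ, i < j → j < X.ncard →
          Disjoint {v | v ∈ arc c (k * i) k} {v | v ∈ arc c (k * j) k} := by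
        intro i j hij hj
        refine Set.disjoint_left.2 fun v hv hv' => ?_
        obtain ⟨a, ha, rfl⟩ := mem_arc.1 hv
        obtain ⟨b, hb, hab⟩ := mem_arc.1 hv'
        have h1 : (k : ℤ) * (i + 1) ≤ k * j := by
          exact_mod_cast Nat.mul_le_mul_left k hij
        have h2 : (k : ℤ) * (j + 1) ≤ n := by
          rw [← hn]; exact_mod_cast Nat.mul_le_mul_left k hj
        have h3 : (0 : ℤ) ≤ k * i := by positivity
        have := hc.eq_of_lt hab (by linarith) (by linarith)
        linarith
      intro i j hi hj hne
      rcases Nat.lt_or_gt_of_ne hne with h | h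
      · exact main i j h hj
      · exact (main j i h hi).symm
    refine KonigIn.of_diff hk hcS
      (M₀ := (fun i : ℕ => {v | v ∈ arc c (k * i) k}) '' {i | i < X.ncard}) (X₀ := X) ?_ ?_ ?_
      (fun T hT _ hTc => hX.inter_nonempty T hT hTc) (key _ hcS ⟨c 0, 0, rfl⟩)
    · rintro _ ⟨i, -, rfl⟩
      exact ⟨hc.isKSet_arc _ hkn, fun v hv => mem_range_of_mem_arc hv⟩
    · rintro _ ⟨i, hi, rfl⟩ _ ⟨j, hj, rfl⟩ hne
      exact hdisj i j hi hj fun h => hne (by rw [h])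
    · rw [Set.InjOn.ncard_image]
      · rw [show {i | i < X.ncard} = (Finset.range X.ncard : Set ℕ) by ext; simp,
          Set.ncard_coe_finset, Finset.card_range]
      · intro i hi j hj hij
        by_contra hne
        have := hdisj i j hi hj hne
        have hij : {v | v ∈ arc c (k * i) k} = {v | v ∈ arc c (k * j) k} := hij
        rw [hij, disjoint_self] at this
        have hmem : c (k * j) ∈ {v | v ∈ arc c (k * j) k} := mem_arc.2 ⟨0, hk, by simp⟩
        rw [this] at hmem
        exact hmem
  · push Not at hcyc
    by_cases hT : ∃ T, IsKSet G k T ∧ T ⊆ S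
    · obtain ⟨T₀, hT₀, hT₀S⟩ := hT
      obtain ⟨D, v, T, hDS, hT, hTD, hv⟩ := exists_vertex_cover_of_acyclic hcyc hT₀ hk hT₀S
      refine KonigIn.of_diff hk hDS (M₀ := {T}) (X₀ := {v}) ?_ ?_ (by simp) ?_
        (key D hDS ((hT.nonempty hk).mono hTD))
      · rintro _ rfl; exact ⟨hT, hTD⟩
      · exact Set.pairwise_singleton _ _
      · intro T' hT' hT'S hT'D
        exact ⟨v, hv T' hT' hT'S hT'D, rfl⟩
    · push Not at hT
      exact ⟨∅, ∅, by simp, by simp, fun T hTk hTS => absurd hTS (hT T hTk), by simp⟩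

theorem CycCoverable.mem_classG' [Finite V] {k : ℕ} (hk : 0 < k) (h : CycCoverable G k) :
    G ∈ PathKE.classG' k V := by
  refine ⟨(mem_classG_iff hk).2 (h.konigIn hk), fun a w hw => ?_⟩
  obtain ⟨c, hc, -⟩ := exists_isCyc_of_isCycle hw
  obtain ⟨X, hX⟩ := h _ c hc
  exact Nat.le_of_dvd (by have := hc.three_le; omega) hX.dvd

end KPath

namespace KPath

/-! ### Covering the integers modulo `k` by punctured intervals -/

section Residues

variable {k h : ℕ}

/-- The residue `r` lies in the punctured interval of radius `i x` around `x`. -/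
def Covers (i : ZMod k → ℕ) (x r : ZMod k) : Prop :=
  ∃ δ : ℕ, 1 ≤ δ ∧ δ ≤ i x ∧ (r = x + δ ∨ r = x - δ)

theorem exists_minimal_cover [NeZero k] {i : ZMod k → ℕ} (hcov : ∀ r, ∃ x, Covers i x r) :
    ∃ j : ZMod k → ℕ, (∀ x, j x ≤ i x) ∧ (∀ r, ∃ x, Covers j x r) ∧
      ∀ x, 0 < j x → ∃ σ : ℤ, (σ = 1 ∨ σ = -1) ∧
        ∀ y, Covers j y (x + (σ : ZMod k) * (j x : ZMod k)) → y = x := by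
  classical
  -- The sum of the radii is minimized. Lowering one positive radius by one then uncovers a residue,
  -- which was covered by that interval alone and only at its extreme distance.
  let Q : ℕ → Prop := fun m => ∃ j : ZMod k → ℕ, ∑ x, j x = m ∧ (∀ x, j x ≤ i x) ∧
    ∀ r, ∃ x, Covers j x r
  have hQ : ∃ m, Q m := ⟨_, i, rfl, fun _ => le_rfl, hcov⟩
  obtain ⟨j, hjm, hji, hj⟩ := Nat.find_spec hQ
  refine ⟨j, hji, hj, fun x hx => ?_⟩
  have hlt : ∑ y, Function.update j x (j x - 1) y < Nat.find hQ := by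
    rw [← hjm]
    refine Finset.sum_lt_sum (fun y _ => ?_) ⟨x, Finset.mem_univ _, by simp; omega⟩
    by_cases hy : y = x
    · subst hy; simp
    · simp [hy]
  have hnot := Nat.find_min hQ hlt
  have : ∃ r, ∀ y, ¬ Covers (Function.update j x (j x - 1)) y r := by
    by_contra hcon
    push Not at hcon
    refine hnot ⟨_, rfl, fun y => ?_, hcon⟩
    by_cases hy : y = x
    · subst hy; have := hji y; simp; omega
    · simpa [hy] using hji y
  obtain ⟨r, hr⟩ := this
  have honly : ∀ y, Covers j y r → y = x := by
    rintro y ⟨δ, h1, h2, h3⟩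
    by_contra hy
    exact hr y ⟨δ, h1, by simpa [hy] using h2, h3⟩
  obtain ⟨y, hy⟩ := hj r
  obtain rfl := honly y hy
  obtain ⟨δ, h1, h2, h3⟩ := hy
  have hδ : δ = j y := by
    by_contra hne
    exact hr y ⟨δ, h1, by simp; omega, h3⟩
  subst hδ
  rcases h3 with h3 | h3
  · exact ⟨1, Or.inl rfl, by simpa [h3] using honly⟩
  · exact ⟨-1, Or.inr rfl, by simpa [h3, sub_eq_add_neg] using honly⟩

theorem intCast_eq_of_lt {a b : ℤ} (hab : (a : ZMod k) = b) (h1 : a - b < k) (h2 : b - a < k) :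
    a = b := by
  rw [ZMod.intCast_eq_intCast_iff_dvd_sub] at hab
  have := Int.eq_zero_of_abs_lt_dvd hab (by rw [abs_lt]; omega)
  omega

/-- If every residue is covered and every `x` has a privately covered residue at distance `j x`
in direction `σ x`, then some residue lies in none of the intervals from `x` in direction `σ x`. -/
theorem exists_notMem_arms (hk : k = 2 * h + 1) {j : ZMod k → ℕ} (hjh : ∀ x, j x ≤ h)
    (hcov : ∀ r, ∃ x, Covers j x r) {σ : ZMod k → ℤ} (hσ : ∀ x, σ x = 1 ∨ σ x = -1)
    (hpriv : ∀ x, 0 < j x → ∀ y, Covers j y (x + (σ x : ZMod k) * (j x : ZMod k)) → y = x) :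
    ∃ u : ZMod k, ∀ (x : ZMod k) (δ : ℕ), 1 ≤ δ → δ ≤ j x → u ≠ x + (σ x : ZMod k) * (δ : ZMod k) := by
  by_contra hcon
  push Not at hcon
  have : NeZero k := ⟨by omega⟩
  -- Extremal choice: the interval around `x₀` has the largest radius `I`, so any private end other
  -- than `x₀` within distance `I` of `x₀` belongs to `x₀` itself.
  obtain ⟨x₀, -, hmax⟩ := Finset.exists_max_image Finset.univ j ⟨0, Finset.mem_univ _⟩
  have hmax : ∀ y, j y ≤ j x₀ := fun y => hmax y (Finset.mem_univ _)
  have hI : 1 ≤ j x₀ := by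
    obtain ⟨x, δ, h1, h2, -⟩ := hcov 0
    have := hmax x; omega
  have hIh := hjh x₀
  set I := j x₀ with hIdef
  -- Coordinates centred at `x₀` in which its own arm points in the positive direction.
  set e : ℤ → ZMod k := fun t => x₀ + (σ x₀ : ZMod k) * (t : ZMod k) with he
  have hσσ : ((σ x₀ : ZMod k)) * (σ x₀ : ZMod k) = 1 := by
    rcases hσ x₀ with h | h <;> simp [h]
  have e_inj : ∀ a b : ℤ, e a = e b → a - b < k → b - a < k → a = b := by
    intro a b hab h1 h2
    refine intCast_eq_of_lt (k := k) ?_ h1 h2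
    have := congrArg (fun t => (σ x₀ : ZMod k) * (t - x₀)) hab
    simp only [he, add_sub_cancel_left, ← mul_assoc, hσσ, one_mul] at this
    exact this
  have e_zero : e 0 = x₀ := by simp [he]
  have e_cov : ∀ a b : ℤ, a ≠ b → a - b ≤ j (e a) → b - a ≤ j (e a) → Covers j (e a) (e b) := by
    intro a b hab h1 h2
    refine ⟨(b - a).natAbs, by omega, by omega, ?_⟩
    rcases le_total a b with hle | hle
    · have : (((b - a).natAbs : ℕ) : ZMod k) = (b : ZMod k) - a := by
        rw [← Int.cast_natCast, Int.natAbs_of_nonneg (by omega)]; push_cast; ring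
      rcases hσ x₀ with h | h <;> simp only [he, h, this] <;> push_cast
      · left; ring
      · right; ring
    · have : (((b - a).natAbs : ℕ) : ZMod k) = (a : ZMod k) - b := by
        rw [← Int.cast_natCast, ← Int.natAbs_neg, Int.natAbs_of_nonneg (by omega)]; push_cast; ring
      rcases hσ x₀ with h | h <;> simp only [he, h, this] <;> push_cast
      · right; ring
      · left; ring
  -- every point `e t` lies in an arm, described in the coordinates given by `e`
  have arm : ∀ t : ℤ, ∃ (s : ℤ) (δ m : ℕ), (s = 1 ∨ s = -1) ∧ 1 ≤ δ ∧
      j (e (t - s * δ)) = δ + m ∧ s = σ (e (t - s * δ)) * σ x₀ ∧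
      ∀ y, Covers j y (e (t + s * m)) → y = e (t - s * δ) := by
    intro t
    obtain ⟨y, δ, h1, h2, h3⟩ := hcon (e t)
    have hs : σ y * σ x₀ = 1 ∨ σ y * σ x₀ = -1 := by
      rcases hσ y with h | h <;> rcases hσ x₀ with h' | h' <;> simp [h, h']
    have hy : e (t - σ y * σ x₀ * δ) = y := by
      have : e (t - σ y * σ x₀ * δ) =
          e t - (σ x₀ : ZMod k) * (σ x₀ : ZMod k) * ((σ y : ZMod k) * (δ : ZMod k)) := by
        simp only [he]; push_cast; ring
      rw [this, hσσ, one_mul, h3]; ring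
    refine ⟨σ y * σ x₀, δ, j y - δ, hs, h1, ?_, ?_, ?_⟩
    · rw [hy]; omega
    · rw [hy]
    · rw [hy]
      intro z hz
      refine hpriv y (by omega) z ?_
      convert hz using 1
      have : e (t + σ y * σ x₀ * ((j y - δ : ℕ) : ℤ)) = e t +
          (σ x₀ : ZMod k) * (σ x₀ : ZMod k) * ((σ y : ZMod k) * ((j y : ZMod k) - δ)) := by
        simp only [he]; push_cast [h2]; ring
      rw [this, hσσ, one_mul, h3]; ring
  have h1s : σ x₀ * σ x₀ = 1 := by rcases hσ x₀ with h | h <;> simp [h]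
  -- an arm whose private end is covered by `x₀` belongs to `x₀`
  have near : ∀ a b : ℤ, (∀ y, Covers j y (e b) → y = e a) → b ≠ 0 → -I ≤ b → b ≤ I →
      e a = e 0 := by
    intro a b hb h0 h1 h2
    exact (hb _ (e_cov 0 b h0.symm (by rw [e_zero]; omega) (by rw [e_zero]; omega))).symm
  obtain ⟨s, d, m, hs, hd, hjy, hsy, hy⟩ := arm 0
  have hjmax := hmax (e (0 - s * d))
  -- The arm through `x₀` ends exactly at `x₀`: otherwise its end would be within distance `I` of
  -- `x₀` and the arm would belong to `x₀`, which is not on its own arm.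
  have hm : m = 0 := by
    by_contra hm0
    have := near _ _ hy (by rcases hs with rfl | rfl <;> omega)
      (by rcases hs with rfl | rfl <;> omega) (by rcases hs with rfl | rfl <;> omega)
    have := e_inj _ _ this (by rcases hs with rfl | rfl <;> omega)
      (by rcases hs with rfl | rfl <;> omega)
    rcases hs with rfl | rfl <;> omega
  subst hm
  simp only [Nat.cast_zero, mul_zero, add_zero] at hy hjy
  obtain ⟨s', δ, m, hs', hδ, hjz, hsz, hz⟩ := arm (-1)
  have hjmax' := hmax (e (-1 - s' * δ))
  -- Consider the arm through `-1`. If it pointed downwards, its end would make it the arm of `x₀`,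
  -- which points upwards. So it points upwards and must end at `0`, whence it is the arm found
  -- above.
  have hB : s = 1 ∧ 2 ≤ d := by
    rcases hs' with rfl | rfl
    · by_cases hm1 : m = 1
      · subst hm1
        have hyz := hz (e (0 - s * d)) (by
          have := e_cov (0 - s * d) 0 (by rcases hs with rfl | rfl <;> omega)
            (by rw [hjy]; rcases hs with rfl | rfl <;> omega)
            (by rw [hjy]; rcases hs with rfl | rfl <;> omega)
          simpa using this)
        rw [← hyz, hjy] at hjz
        rw [← hyz, ← hsy] at hsz
        exact ⟨hsz.symm, by omega⟩
      · have := near _ _ hz (by omega) (by omega) (by omega)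
        have := e_inj _ _ this (by omega) (by omega)
        omega
    · have := near _ _ hz (by omega) (by omega) (by omega)
      rw [this, e_zero, h1s] at hsz
      omega
  obtain ⟨rfl, hd2⟩ := hB
  -- Finally, consider the arm through the owner `e (-d)` of the arm ending at `0`. If it pointed
  -- upwards, its end would be `0`, private to `e (-d)`, or another point close to `x₀`; neither is
  -- possible.
  obtain ⟨s'', δ', m', hs'', hδ', hjw, hsw, hw⟩ := arm (-d)
  have hjmax'' := hmax (e (-d - s'' * δ'))
  have hd_eq : (0 : ℤ) - 1 * d = -d := by ring
  rw [hd_eq] at hy hjy hsy hjmax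
  rcases hs'' with rfl | rfl
  · by_cases hmd : m' = d
    · subst hmd
      have := hw (e (-m')) (by
        have := e_cov (-m') 0 (by omega) (by omega) (by omega)
        simpa using this)
      have := e_inj _ _ this (by omega) (by omega)
      omega
    · have := near _ _ hw (by omega) (by omega) (by omega)
      have := e_inj _ _ this (by omega) (by omega)
      omega
  -- If it points downwards, its owner must not cover `0`, so its radius is less than `d - δ'`. Then
  -- its end is either `e (-d)` itself, which `x₀` covers, or a point covered by `e (-d)`,
  -- contradicting privacy.
  · have hne : e (-d - -1 * δ') ≠ e 0 := by
      intro h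
      rw [h, e_zero, h1s] at hsw
      omega
    have hfar : ¬ ((d : ℤ) + m' ≤ I) := fun hle =>
      hne (near _ _ hw (by omega) (by omega) (by omega))
    have hcov0 : ¬ Covers j (e (-d - -1 * δ')) (e 0) := by
      intro hc
      have := e_inj _ _ (hy _ hc) (by omega) (by omega)
      omega
    have hδd : (-d - -1 * δ' : ℤ) ≠ 0 := fun h => hne (by rw [h])
    have h2 : (δ' : ℤ) + m' < d - δ' := by
      by_contra hle
      exact hcov0 (e_cov _ _ hδd (by rw [hjw]; push_cast; omega) (by rw [hjw]; push_cast; omega))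
    by_cases hm0 : m' = 0
    · omega
    · have := hw (e (-d)) (e_cov _ _ (by omega) (by omega) (by omega))
      have := e_inj _ _ this (by omega) (by omega)
      omega

/-- From a cover of all residues by punctured intervals one can select a cover, and more residues
than there are intervals, such that each half of an interval contains at most one of them. -/
theorem exists_sparse_residues (hk : k = 2 * h + 1) {i : ZMod k → ℕ} (hih : ∀ x, i x ≤ h)
    (hcov : ∀ r, ∃ x, Covers i x r) :
    ∃ j : ZMod k → ℕ, (∀ x, j x ≤ i x) ∧ (∀ r, ∃ x, Covers j x r) ∧
      ∃ U : Finset (ZMod k), ({x | 0 < j x} : Set (ZMod k)).ncard < U.card ∧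
        ∀ (x : ZMod k) (δ δ' : ℕ), 1 ≤ δ → δ ≤ j x → 1 ≤ δ' → δ' ≤ j x →
          (x + δ ∈ U → x + δ' ∈ U → δ = δ') ∧ (x - δ ∈ U → x - δ' ∈ U → δ = δ') := by
  classical
  have : NeZero k := ⟨by omega⟩
  obtain ⟨j, hji, hj, hpriv⟩ := exists_minimal_cover hcov
  have hjh : ∀ x, j x ≤ h := fun x => (hji x).trans (hih x)
  have hpriv' : ∀ x, ∃ σ : ℤ, (σ = 1 ∨ σ = -1) ∧
      (0 < j x → ∀ y, Covers j y (x + (σ : ZMod k) * (j x : ZMod k)) → y = x) := by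
    intro x
    by_cases hx : 0 < j x
    · obtain ⟨σ, h1, h2⟩ := hpriv x hx
      exact ⟨σ, h1, fun _ => h2⟩
    · exact ⟨1, Or.inl rfl, fun h => absurd h hx⟩
  choose σ hσ hp using hpriv'
  obtain ⟨u, hu⟩ := exists_notMem_arms hk hjh hj hσ hp
  set p : ZMod k → ZMod k := fun x => x + (σ x : ZMod k) * (j x : ZMod k) with hpdef
  have hself : ∀ x, 0 < j x → Covers j x (p x) := by
    intro x hx
    refine ⟨j x, hx, le_rfl, ?_⟩
    rcases hσ x with h | h
    · left; simp [hpdef, h]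
    · right; simp [hpdef, h, sub_eq_add_neg]
  set S : Finset (ZMod k) := Finset.univ.filter fun x => 0 < j x with hS
  have hpinj : Set.InjOn p S := by
    intro x hx y hy hxy
    simp only [hS, Finset.coe_filter, Finset.mem_univ, true_and, Set.mem_ofPred_eq] at hx hy
    exact hp y hy x (by change Covers j x (p y); rw [← hxy]; exact hself x hx)
  have hunot : u ∉ S.image p := by
    intro h
    obtain ⟨x, hx, hxu⟩ := Finset.mem_image.1 h
    exact hu x (j x) (by simpa [hS, Nat.one_le_iff_ne_zero, Nat.pos_iff_ne_zero] using hx) le_rfl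
      hxu.symm
  -- One private end for each interval, plus a residue `u` on no arm: one more than the number of
  -- intervals.
  refine ⟨j, hji, hj, insert u (S.image p), ?_, ?_⟩
  · rw [Finset.card_insert_of_notMem hunot, Finset.card_image_of_injOn hpinj,
      ← Set.ncard_coe_finset]
    simp [hS]
  · have hmem : ∀ x v, 0 < j x → Covers j x v → v ∈ insert u (S.image p) → v = u ∨ v = p x := by
      intro x v _ hc hv
      rcases Finset.mem_insert.1 hv with rfl | hv
      · exact Or.inl rfl
      · obtain ⟨y, hy, rfl⟩ := Finset.mem_image.1 hv
        right
        rw [hp y (by simpa [hS] using hy) x hc]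
    -- In the interval around `x` only `u` and `p x` can be in the set; on the same side of `x`, the
    -- residue `u` would lie on the arm of `x`.
    have key : ∀ (x : ZMod k) (τ : ℤ) (δ δ' : ℕ), (τ = 1 ∨ τ = -1) → 1 ≤ δ → δ ≤ j x → 1 ≤ δ' →
        δ' ≤ j x → x + (τ : ZMod k) * δ = u → x + (τ : ZMod k) * δ' = p x → False := by
      intro x τ δ δ' hτ h1 h2 h3 h4 h5 h6
      have hjx := hjh x
      have h6 : ((τ * δ' : ℤ) : ZMod k) = ((σ x * j x : ℤ) : ZMod k) := by
        push_cast; exact add_left_cancel h6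
      have h6 := intCast_eq_of_lt h6
        (by rcases hτ with rfl | rfl <;> rcases hσ x with h | h <;> rw [h] <;> omega)
        (by rcases hτ with rfl | rfl <;> rcases hσ x with h | h <;> rw [h] <;> omega)
      have hτσ : τ = σ x := by
        rcases hτ with rfl | rfl <;> rcases hσ x with h | h <;> rw [h] at h6 ⊢ <;> omega
      subst hτσ
      exact hu x δ h1 h2 h5.symm
    have main : ∀ (x : ZMod k) (τ : ℤ) (δ δ' : ℕ), (τ = 1 ∨ τ = -1) → 1 ≤ δ → δ ≤ j x → 1 ≤ δ' →
        δ' ≤ j x → x + (τ : ZMod k) * δ ∈ insert u (S.image p) →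
        x + (τ : ZMod k) * δ' ∈ insert u (S.image p) → δ = δ' := by
      intro x τ δ δ' hτ h1 h2 h3 h4 h5 h6
      have hjx := hjh x
      have hc : ∀ δ : ℕ, 1 ≤ δ → δ ≤ j x → Covers j x (x + (τ : ZMod k) * δ) := by
        intro δ h1 h2
        refine ⟨δ, h1, h2, ?_⟩
        rcases hτ with rfl | rfl
        · left; simp
        · right; simp [sub_eq_add_neg]
      have hinj : x + (τ : ZMod k) * δ = x + (τ : ZMod k) * δ' → δ = δ' := by
        intro h
        have h6 : ((τ * δ : ℤ) : ZMod k) = ((τ * δ' : ℤ) : ZMod k) := by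
          push_cast; exact add_left_cancel h
        have h6 := intCast_eq_of_lt h6 (by rcases hτ with rfl | rfl <;> omega)
          (by rcases hτ with rfl | rfl <;> omega)
        rcases hτ with rfl | rfl <;> omega
      rcases hmem x _ (by omega) (hc δ h1 h2) h5 with h5 | h5 <;>
        rcases hmem x _ (by omega) (hc δ' h3 h4) h6 with h6 | h6
      · exact hinj (h5.trans h6.symm)
      · exact (key x τ δ δ' hτ h1 h2 h3 h4 h5 h6).elim
      · exact (key x τ δ' δ hτ h3 h4 h1 h2 h6 h5).elim
      · exact hinj (h5.trans h6.symm)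
    intro x δ δ' h1 h2 h3 h4
    refine ⟨fun h5 h6 => main x 1 δ δ' (Or.inl rfl) h1 h2 h3 h4 ?_ ?_,
      fun h5 h6 => main x (-1) δ δ' (Or.inr rfl) h1 h2 h3 h4 ?_ ?_⟩
    · simpa using h5
    · simpa using h6
    · simpa [sub_eq_add_neg] using h5
    · simpa [sub_eq_add_neg] using h6

end Residues

end KPath

namespace KPath

variable {V : Type u} {G : SimpleGraph V}

/-! ### Ears and pendant paths of cycles when all cycle lengths are divisible by `k` -/

theorem exists_first_mem {l : List V} {S : Set V} (h : ∃ z ∈ l, z ∈ S) :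
    ∃ l₁ z l₂, l = l₁ ++ z :: l₂ ∧ z ∈ S ∧ ∀ v ∈ l₁, v ∉ S := by
  induction l with
  | nil => simp at h
  | cons a l ih =>
    by_cases ha : a ∈ S
    · exact ⟨[], a, l, rfl, ha, by simp⟩
    · obtain ⟨z, hz, hzS⟩ := h
      rcases List.mem_cons.1 hz with rfl | hz
      · exact absurd hzS ha
      · obtain ⟨l₁, z, l₂, rfl, hz, hl⟩ := ih ⟨z, hz, hzS⟩
        refine ⟨a :: l₁, z, l₂, rfl, hz, fun v hv => ?_⟩
        rcases List.mem_cons.1 hv with rfl | hv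
        · exact ha
        · exact hl v hv

theorem reverse_arc_neg (c : ℤ → V) (p : ℤ) (L : ℕ) :
    (arc (fun i => c (-i)) (-p) L).reverse = arc c (p - L + 1) L := by
  induction L generalizing p with
  | zero => simp [arc]
  | succ L ih =>
    rw [arc_succ, List.reverse_cons, show -p + 1 = -(p - 1) by ring, ih, arc_succ']
    congr 2
    · push_cast; ring
    · push_cast; congr 2; ring

/-- The list `l` continues the vertex `c p` to a path that is otherwise disjoint from `c`. -/
structure IsPend (G : SimpleGraph V) (c : ℤ → V) (p : ℤ) (l : List V) : Prop where
  path : IsPathList G (c p :: l)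
  notMem : ∀ v ∈ l, v ∉ Set.range c

theorem IsPend.take {c : ℤ → V} {p : ℤ} {l : List V} (h : IsPend G c p l) (m : ℕ) :
    IsPend G c p (l.take m) where
  path := h.path.infix ⟨[], l.drop m, by simp⟩
  notMem v hv := h.notMem v (List.mem_of_mem_take hv)

theorem IsPend.neg {c : ℤ → V} {p : ℤ} {l : List V} (h : IsPend G c p l) :
    IsPend G (fun i => c (-i)) (-p) l where
  path := by simpa using h.path
  notMem v hv := by rw [IsCyc.range_neg]; exact h.notMem v hv

/-- The ear and the arc from `p` up to `n` close to a cycle of the given order. -/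
theorem IsCyc.dvd_of_ear_aux {k n : ℕ} {c : ℤ → V} (hc : IsCyc G n c)
    (hD : ∀ n c, IsCyc G n c → k ∣ n) {p : ℕ} (h0 : 0 < p) (hpn : p < n) {l : List V}
    (hl : IsPathList G (c 0 :: (l ++ [c p]))) (hout : ∀ v ∈ l, v ∉ Set.range c)
    (h3 : 3 ≤ l.length + (n - p) + 1) : k ∣ l.length + (n - p) + 1 := by
  have hlen : (l ++ arc c p (n - p + 1)).length = l.length + (n - p) + 1 := by
    rw [List.length_append, length_arc]; omega
  obtain ⟨a, ha, hadj⟩ : ∃ a, (l ++ arc c p (n - p + 1)).head? = some a ∧ G.Adj (c 0) a := by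
    cases l with
    | nil => exact ⟨c p, by rw [List.nil_append, head?_arc _ _ (by omega)], hl.chain.rel⟩
    | cons x l => exact ⟨x, rfl, hl.chain.rel⟩
  have hpath : IsPathList G (l ++ arc c p (n - p + 1)) := by
    refine ⟨?_, ?_⟩
    · rw [arc_succ, List.isChain_split, ← arc_succ]
      exact ⟨hl.chain.tail, hc.isChain_arc _ _⟩
    · refine List.nodup_append'.2 ⟨?_, hc.nodup_arc _ (by omega), ?_⟩
      · exact (List.nodup_cons.1 hl.nodup).2.sublist (List.sublist_append_left _ _)
      · intro v hv hv'
        exact hout v hv (mem_range_of_mem_arc hv')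
  obtain ⟨c', hc', -⟩ := exists_isCyc_of_isPathList hpath (by omega) ha
    (b := c 0) (by
      rw [List.getLast?_append, getLast?_arc, Option.some_or, Option.some_inj, hc.eq_iff]
      exact ⟨1, by rw [Nat.cast_sub hpn.le]; ring⟩) hadj
  have := hD _ _ hc'
  rwa [hlen] at this

section Odd

variable {k n : ℕ} {c : ℤ → V}

/-- The ear closes up with either arc of the cycle. The two orders add up to `n + 2 * (l.length +
1)`, and oddness of `k` cancels the factor two. The bounds `h1` and `h2` exclude an ear that is an
edge of the cycle. -/
theorem IsCyc.dvd_of_ear (hc : IsCyc G n c) (hk : Odd k) (hD : ∀ n c, IsCyc G n c → k ∣ n)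
    {p : ℕ} (h0 : 0 < p) (hpn : p < n) {a b : ℤ} (hb : c b = c (a + p)) {l : List V}
    (hl : IsPathList G (c a :: (l ++ [c b]))) (hout : ∀ v ∈ l, v ∉ Set.range c)
    (h1 : 3 ≤ l.length + p + 1) (h2 : 3 ≤ l.length + (n - p) + 1) :
    k ∣ l.length + 1 ∧ k ∣ p := by
  have e1 := (hc.shift a).dvd_of_ear_aux hD h0 hpn (l := l) (by simpa [← hb] using hl)
    (by rw [IsCyc.range_shift]; exact hout) h2
  have e2 := (hc.shift a).neg.dvd_of_ear_aux hD (p := n - p) (by omega) (by omega) (l := l)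
    (by
      have : c (a + -((n - p : ℕ) : ℤ)) = c b := by
        rw [hb, hc.eq_iff, Nat.cast_sub hpn.le]; exact ⟨-1, by ring⟩
      simpa [this] using hl)
    (by rw [IsCyc.range_neg (fun i => c (a + i)), IsCyc.range_shift]; exact hout) (by omega)
  have e3 := hD _ _ hc
  have hsum : k ∣ 2 * (l.length + 1) := by
    have := Nat.dvd_add e1 e2
    rw [show l.length + (n - p) + 1 + (l.length + (n - (n - p)) + 1) = 2 * (l.length + 1) + n by
      omega] at this
    exact (Nat.dvd_add_left e3).1 this
  have hl1 : k ∣ l.length + 1 :=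
    (Nat.Coprime.dvd_mul_left (Nat.coprime_two_right.2 hk)).1 hsum
  refine ⟨hl1, ?_⟩
  rw [show l.length + (n - (n - p)) + 1 = l.length + 1 + p by omega] at e2
  exact (Nat.dvd_add_right hl1).1 e2

theorem IsCyc.exists_offset (hc : IsCyc G n c) {a b : ℤ} (hab : c a ≠ c b) :
    ∃ p : ℕ, 0 < p ∧ p < n ∧ c b = c (a + p) := by
  obtain ⟨p, hp, hb⟩ := hc.exists_nat_lt a b
  refine ⟨p, ?_, hp, hb.symm⟩
  rcases Nat.eq_zero_or_pos p with rfl | h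
  · simp at hb; exact absurd hb hab
  · exact h

theorem IsCyc.dvd_ear (hc : IsCyc G n c) (hk : Odd k) (hD : ∀ n c, IsCyc G n c → k ∣ n) {a b : ℤ}
    (hab : c a ≠ c b) {l : List V} (hl : IsPathList G (c a :: (l ++ [c b])))
    (hout : ∀ v ∈ l, v ∉ Set.range c) (hne : l ≠ []) : k ∣ l.length + 1 ∧ (k : ℤ) ∣ a - b := by
  obtain ⟨p, h0, hpn, hb⟩ := hc.exists_offset hab
  have := List.length_pos_of_ne_nil hne
  obtain ⟨h1, h2⟩ := hc.dvd_of_ear hk hD h0 hpn hb hl hout (by omega) (by omega)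
  refine ⟨h1, ?_⟩
  have e1 := (hc.eq_iff _ _).1 hb
  have e2 : (k : ℤ) ∣ b - (a + p) := (Int.natCast_dvd_natCast.2 (hD _ _ hc)).trans e1
  have e3 := dvd_add e2 (Int.natCast_dvd_natCast.2 h2)
  rw [← dvd_neg]
  convert e3 using 1
  ring

/-- A chord would be an ear of length one, which `k` cannot divide. -/
theorem IsCyc.eq_of_adj (hc : IsCyc G n c) (hk : Odd k) (hk1 : 1 < k)
    (hD : ∀ n c, IsCyc G n c → k ∣ n) {a b : ℤ} (hab : G.Adj (c a) (c b)) :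
    c b = c (a + 1) ∨ c b = c (a - 1) := by
  obtain ⟨p, h0, hpn, hb⟩ := hc.exists_offset hab.ne
  by_cases h1 : p = 1
  · left; rw [hb, h1]; rfl
  by_cases h2 : p = n - 1
  · right
    rw [hb, hc.eq_iff, h2, Nat.cast_sub (by omega)]
    exact ⟨1, by push_cast; ring⟩
  have := (hc.dvd_of_ear hk hD h0 hpn hb (l := []) ⟨by simpa using hab, by simpa using hab.ne⟩
    (by simp) (by simp; omega) (by simp; omega)).1
  simp at this
  omega

/-- There are no chords, so the path follows the cycle in one direction until it leaves. It cannot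
return: the excursion would be an ear with at least `k - 1` inner vertices, too many for a path of
at most `k` vertices. -/
theorem IsCyc.eq_arc_append (hc : IsCyc G n c) (hk : Odd k) (hk1 : 1 < k)
    (hD : ∀ n c, IsCyc G n c → k ∣ n) {p : ℤ} {l : List V} (hl : IsPathList G (c p :: l))
    (hlen : l.length < k) (hhead : l.head? ≠ some (c (p - 1))) :
    ∃ L l₂, 1 ≤ L ∧ c p :: l = arc c p L ++ l₂ ∧ ∀ v ∈ l₂, v ∉ Set.range c := by
  induction l generalizing p with
  | nil => exact ⟨1, [], le_rfl, by simp [arc], by simp⟩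
  | cons y l ih =>
    by_cases hy : y ∈ Set.range c
    · obtain ⟨b, rfl⟩ := hy
      rcases hc.eq_of_adj hk hk1 hD hl.chain.rel with h | h
      · rw [h] at hl ⊢
        obtain ⟨L, l₂, hL, he, h2⟩ := ih (p := p + 1) (hl.infix ⟨[c p], [], by simp⟩)
          (by simp at hlen; omega) (by
            rw [add_sub_cancel_right]
            intro hh
            have := List.mem_of_head? hh
            exact (List.nodup_cons.1 hl.nodup).1 (List.mem_cons_of_mem _ this))
        exact ⟨L + 1, l₂, by omega, by rw [he, arc_succ, List.cons_append], h2⟩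
      · exact absurd (by rw [h]; rfl) hhead
    · refine ⟨1, y :: l, le_rfl, by simp [arc], ?_⟩
      by_contra hcon
      push Not at hcon
      obtain ⟨l₁, z, l₂, hz, ⟨b, rfl⟩, hout⟩ := exists_first_mem hcon
      have hne : l₁ ≠ [] := by
        rintro rfl
        rw [List.nil_append] at hz
        exact hy ⟨b, (List.cons.inj hz).1.symm⟩
      rw [hz] at hl hlen
      have hab : c p ≠ c b := fun h => (List.nodup_cons.1 hl.nodup).1 (by rw [h]; simp)
      have := (hc.dvd_ear hk hD hab (hl.infix ⟨[], l₂, by simp⟩) hout hne).1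
      have := Nat.le_of_dvd (by omega) this
      simp at hlen
      omega

/-- A path of at most `k` vertices meets a cycle in consecutive vertices. -/
theorem IsCyc.path_structure (hc : IsCyc G n c) (hk : Odd k) (hk1 : 1 < k)
    (hD : ∀ n c, IsCyc G n c → k ∣ n) {Q : List V} (hQ : IsPathList G Q) (hlen : Q.length ≤ k)
    (hmeet : ∃ z ∈ Q, z ∈ Set.range c) :
    ∃ (p : ℤ) (L : ℕ) (l₁ l₂ : List V), 1 ≤ L ∧
      (Q = l₁ ++ arc c p L ++ l₂ ∨ Q.reverse = l₁ ++ arc c p L ++ l₂) ∧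
      (∀ v ∈ l₁, v ∉ Set.range c) ∧ ∀ v ∈ l₂, v ∉ Set.range c := by
  obtain ⟨l₁, z, l, rfl, ⟨p, rfl⟩, hout⟩ := exists_first_mem hmeet
  have hl : IsPathList G (c p :: l) := hQ.infix ⟨l₁, [], by simp⟩
  have hlen' : l.length < k := by simp at hlen; omega
  by_cases hhead : l.head? = some (c (p - 1))
  · have hne : l.head? ≠ some (c (-(-p - 1))) := by
      rw [hhead, Ne, Option.some_inj, hc.eq_iff]
      intro h
      have := Int.le_of_dvd (by omega) (dvd_neg.2 h)
      have := hc.three_le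
      omega
    obtain ⟨L, l₂, hL, he, h2⟩ := hc.neg.eq_arc_append hk hk1 hD (p := -p) (by simpa using hl)
      hlen' hne
    rw [neg_neg] at he
    refine ⟨p - L + 1, L, l₂.reverse, l₁.reverse, hL, Or.inr ?_, ?_, ?_⟩
    · rw [he, List.reverse_append, List.reverse_append, reverse_arc_neg]
    · intro v hv; rw [IsCyc.range_neg] at h2; exact h2 v (List.mem_reverse.1 hv)
    · intro v hv; exact hout v (List.mem_reverse.1 hv)
  · obtain ⟨L, l₂, hL, he, h2⟩ := hc.eq_arc_append hk hk1 hD hl hlen' hhead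
    exact ⟨p, L, l₁, l₂, hL, Or.inl (by rw [he, List.append_assoc]), hout, h2⟩

/-- A long enough pendant path at a vertex outside the residue class of `r` can be cut to one that
extends, together with an arc, to a path of order `k` avoiding that class. -/
theorem exists_pend_of_le {h : ℕ} (hkh : k = 2 * h + 1) {p r : ℤ} {l : List V}
    (hl : IsPend G c p l) {t : ℕ} (h0 : 0 < t) (htk : t < k) (ht : (k : ℤ) ∣ p - t - r)
    (hlen : t ≤ l.length ∨ k - t ≤ l.length) : ∃ (δ : ℕ) (l : List V), 1 ≤ δ ∧ δ ≤ h ∧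
      l.length = δ ∧ IsPend G c p l ∧ ((k : ℤ) ∣ p - δ - r ∨ (k : ℤ) ∣ p + δ - r) := by
  -- The distances `t` and `k - t` to the class on the two sides add up to `2 * h + 1`. The smaller
  -- one is at most `h`, and either alternative of `hlen` supplies enough vertices for it.
  by_cases hth : t ≤ h
  · exact ⟨t, l.take t, h0, hth, by rw [List.length_take]; omega, hl.take t, Or.inl ht⟩
  · refine ⟨k - t, l.take (k - t), by omega, by omega, by rw [List.length_take]; omega,
      hl.take _, Or.inr ?_⟩
    rw [Nat.cast_sub htk.le, show p + ((k : ℤ) - t) - r = p - t - r + k by ring]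
    exact dvd_add ht dvd_rfl

theorem exists_offset_mod (hk : 0 < k) (p r : ℤ) : ∃ t : ℕ, t < k ∧ (k : ℤ) ∣ p - t - r := by
  have h0 := Int.emod_nonneg (p - r) (by omega : (k : ℤ) ≠ 0)
  have h1 := Int.emod_lt_of_pos (p - r) (by omega : (0 : ℤ) < k)
  refine ⟨((p - r) % k).toNat, by omega, ?_⟩
  rw [Int.toNat_of_nonneg h0]
  refine ⟨(p - r) / k, ?_⟩
  have := Int.emod_add_mul_ediv (p - r) k
  linarith

/-- A path of order `k` that meets a cycle and avoids the residue class of `r` yields a pendant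
path whose length is the distance of its attachment vertex to the class. -/
theorem IsCyc.exists_pend_of_avoid {h : ℕ} (hc : IsCyc G n c) (hkh : k = 2 * h + 1) (hh : 1 ≤ h)
    (hD : ∀ n c, IsCyc G n c → k ∣ n) {Q : List V} (hQ : IsPathList G Q) (hlen : Q.length = k)
    (hmeet : ∃ z ∈ Q, z ∈ Set.range c) {r : ℤ} (hr : ∀ j, (k : ℤ) ∣ j - r → c j ∉ Q) :
    ∃ (p : ℤ) (δ : ℕ) (l : List V), 1 ≤ δ ∧ δ ≤ h ∧ l.length = δ ∧ IsPend G c p l ∧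
      ((k : ℤ) ∣ p - δ - r ∨ (k : ℤ) ∣ p + δ - r) := by
  have hk : Odd k := ⟨h, hkh⟩
  have main : ∀ (Q : List V) (p : ℤ) (L : ℕ) (l₁ l₂ : List V), IsPathList G Q → Q.length = k →
      (∀ j, (k : ℤ) ∣ j - r → c j ∉ Q) → 1 ≤ L → Q = l₁ ++ arc c p L ++ l₂ →
      (∀ v ∈ l₁, v ∉ Set.range c) → (∀ v ∈ l₂, v ∉ Set.range c) →
      ∃ (p : ℤ) (δ : ℕ) (l : List V), 1 ≤ δ ∧ δ ≤ h ∧ l.length = δ ∧ IsPend G c p l ∧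
      ((k : ℤ) ∣ p - δ - r ∨ (k : ℤ) ∣ p + δ - r) := by
    intro Q p L l₁ l₂ hQ hlen hr hL he h1 h2
    obtain ⟨t, htk, ht⟩ := exists_offset_mod (by omega : 0 < k) p r
    rw [he, List.length_append, List.length_append, length_arc] at hlen
    have hmem : ∀ j : ℕ, j < L → c (p + j) ∈ Q := by
      intro j hj
      rw [he]
      simp only [List.mem_append]
      exact Or.inl (Or.inr (mem_arc.2 ⟨j, hj, rfl⟩))
    have ht0 : 0 < t := by
      rcases Nat.eq_zero_or_pos t with rfl | h
      · exact absurd (hmem 0 (by omega)) (hr _ (by simpa using ht))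
      · exact h
    have htL : t + L ≤ k := by
      by_contra hcon
      refine hr _ ?_ (hmem (k - t) (by omega))
      rw [Nat.cast_sub htk.le, show p + ((k : ℤ) - t) - r = p - t - r + k by ring]
      exact dvd_add ht dvd_rfl
    -- The parts have `k` vertices in total: if `l₁` is too short to span the distance down to the
    -- class, then `l₂` is long enough to span the distance up to it from the other end of the arc.
    rcases Nat.lt_or_ge l₁.length t with hlt | hge
    · obtain ⟨L, rfl⟩ : ∃ L', L = L' + 1 := ⟨L - 1, by omega⟩
      have hpend : IsPend G c (p + L) l₂ := by
        refine ⟨hQ.infix ⟨l₁ ++ arc c p L, [], ?_⟩, h2⟩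
        rw [he, arc_succ']; simp
      obtain ⟨δ, l, h⟩ := exists_pend_of_le hkh hpend (r := r) (t := t + L) (by omega) (by omega)
        (by push_cast; rwa [show p + (L : ℤ) - (t + L) - r = p - t - r by ring])
        (Or.inr (by omega))
      exact ⟨_, δ, l, h⟩
    · have hpend : IsPend G c p l₁.reverse := by
        refine ⟨?_, fun v hv => h1 v (List.mem_reverse.1 hv)⟩
        have : IsPathList G (l₁ ++ [c p]) := by
          obtain ⟨L, rfl⟩ : ∃ L', L = L' + 1 := ⟨L - 1, by omega⟩
          refine hQ.infix ⟨[], arc c (p + 1) L ++ l₂, ?_⟩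
          rw [he, arc_succ]; simp
        simpa using this.reverse
      obtain ⟨δ, l, h⟩ := exists_pend_of_le hkh hpend ht0 htk ht (Or.inl (by simpa using hge))
      exact ⟨_, δ, l, h⟩
  obtain ⟨p, L, l₁, l₂, hL, he, h1, h2⟩ :=
    hc.path_structure hk (by omega) hD hQ hlen.le hmeet
  rcases he with he | he
  · exact main Q p L l₁ l₂ hQ hlen hr hL he h1 h2
  · exact main Q.reverse p L l₁ l₂ hQ.reverse (by simpa using hlen)
      (fun j hj => by simpa using hr j hj) hL he h1 h2

/-- Converse of `exists_pend_of_avoid`: after the pendant path, continue on the cycle away from the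
class position at distance `l.length`. An arc of `k - l.length` vertices stops just short of the
next position of the class. -/
theorem IsPend.exists_isKSet (hc : IsCyc G n c) (hkn : k ≤ n) {p r : ℤ} {l : List V}
    (hl : IsPend G c p l) (h1 : 1 ≤ l.length) (hlk : l.length < k)
    (hr : (k : ℤ) ∣ p - l.length - r ∨ (k : ℤ) ∣ p + l.length - r) :
    ∃ T, IsKSet G k T ∧ c p ∈ T ∧ ∀ v ∈ T, v ∈ l ∨ ∃ j, v = c j ∧ ¬ (k : ℤ) ∣ j - r := by
  have main : ∀ (c : ℤ → V) (p r : ℤ), IsCyc G n c → IsPend G c p l →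
      (k : ℤ) ∣ p - l.length - r → ∃ T, IsKSet G k T ∧ c p ∈ T ∧
        ∀ v ∈ T, v ∈ l ∨ ∃ j, v = c j ∧ ¬ (k : ℤ) ∣ j - r := by
    intro c p r hc hl hr
    obtain ⟨L, hL⟩ : ∃ L, k - l.length = L + 1 := ⟨k - l.length - 1, by omega⟩
    refine ⟨{v | v ∈ l.reverse ++ arc c p (L + 1)}, ⟨_, ⟨?_, ?_⟩, ?_, rfl⟩, ?_, ?_⟩
    · rw [arc_succ, List.isChain_split, ← arc_succ]
      have := hl.path.reverse.chain
      rw [List.reverse_cons] at this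
      exact ⟨this, hc.isChain_arc _ _⟩
    · refine List.nodup_append'.2 ⟨?_, hc.nodup_arc _ (by omega), ?_⟩
      · exact List.nodup_reverse.2 (List.nodup_cons.1 hl.path.nodup).2
      · intro v hv hv'
        exact hl.notMem v (List.mem_reverse.1 hv) (mem_range_of_mem_arc hv')
    · rw [List.length_append, List.length_reverse, length_arc]; omega
    · exact List.mem_append_right _ (mem_arc.2 ⟨0, by omega, by simp⟩)
    · intro v hv
      rcases List.mem_append.1 hv with hv | hv
      · exact Or.inl (List.mem_reverse.1 hv)
      · obtain ⟨j, hj, rfl⟩ := mem_arc.1 hv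
        refine Or.inr ⟨_, rfl, fun hdvd => ?_⟩
        have := dvd_sub hdvd hr
        rw [show p + (j : ℤ) - r - (p - l.length - r) = ((j + l.length : ℕ) : ℤ) by
          push_cast; ring] at this
        have := Nat.le_of_dvd (by omega) (Int.natCast_dvd_natCast.1 this)
        omega
  rcases hr with hr | hr
  · exact main c p r hc hl hr
  · obtain ⟨T, hT, hp, h⟩ := main (fun i => c (-i)) (-p) (-r) hc.neg hl.neg (by
      rw [← dvd_neg, show -(-p - (l.length : ℤ) - -r) = p + l.length - r by ring]; exact hr)
    refine ⟨T, hT, by simpa using hp, fun v hv => ?_⟩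
    rcases h v hv with h | ⟨j, hj, hjr⟩
    · exact Or.inl h
    · refine Or.inr ⟨-j, hj, fun hd => hjr ?_⟩
      rw [← dvd_neg, show -(j - -r) = -j - r by ring]; exact hd

end Odd

/-! ### Graphs in `classG'` have covers of their cycles -/

/-- A weight bound for matchings: `W` serves as a fractional cover. -/
theorem ncard_mul_le [Finite V] {M : Set (Set V)} (hM : M.Pairwise fun T T' => Disjoint T T')
    {W : Set V} {t : ℕ} (ht : ∀ T ∈ M, t ≤ (T ∩ W).ncard) : M.ncard * t ≤ W.ncard := by
  classical
  have hf := Set.toFinite M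
  have := Fintype.ofFinite V
  have hcard : ((hf.toFinset).biUnion fun T => (T ∩ W).toFinset).card =
      ∑ T ∈ hf.toFinset, (T ∩ W).toFinset.card := by
    refine Finset.card_biUnion fun T hT T' hT' hne => ?_
    change Disjoint (T ∩ W).toFinset (T' ∩ W).toFinset
    rw [Set.disjoint_toFinset]
    exact (hM (hf.mem_toFinset.1 hT) (hf.mem_toFinset.1 hT') hne).mono
      Set.inter_subset_left Set.inter_subset_left
  calc M.ncard * t = ∑ T ∈ hf.toFinset, t := by
        rw [Finset.sum_const, smul_eq_mul, Set.ncard_eq_toFinset_card M hf]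
    _ ≤ ∑ T ∈ hf.toFinset, (T ∩ W).toFinset.card := by
        refine Finset.sum_le_sum fun T hT => ?_
        rw [← Set.ncard_eq_toFinset_card']
        exact ht T (hf.mem_toFinset.1 hT)
    _ = ((hf.toFinset).biUnion fun T => (T ∩ W).toFinset).card := hcard.symm
    _ ≤ W.toFinset.card := by
        refine Finset.card_le_card fun x hx => ?_
        obtain ⟨T, -, hx⟩ := Finset.mem_biUnion.1 hx
        exact Set.mem_toFinset.2 (Set.mem_toFinset.1 hx).2
    _ = W.ncard := (Set.ncard_eq_toFinset_card' W).symm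

theorem IsCyc.ncard_range [Finite V] {n : ℕ} {c : ℤ → V} (hc : IsCyc G n c) :
    (Set.range c).ncard = n := by
  have : Set.range c = {v | v ∈ arc c 0 n} := by
    ext v
    constructor
    · rintro ⟨i, rfl⟩
      obtain ⟨j, hj, h⟩ := hc.exists_nat_lt 0 i
      exact mem_arc.2 ⟨j, hj, h⟩
    · exact fun h => mem_range_of_mem_arc h
  rw [this]
  exact (hc.isKSet_arc 0 le_rfl).ncard_eq

/-- Disjoint `k`-paths on the cycle number at most `n / k`, so the cover is small enough for
`equally_spaced`. -/
theorem IsCyc.dvd_of_konigIn [Finite V] {k n : ℕ} {c : ℤ → V} (hc : IsCyc G n c) (hkn : k ≤ n)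
    (h : KonigIn G k (Set.range c)) : k ∣ n := by
  obtain ⟨M, X, hM, hd, hX, hle⟩ := h
  have h1 : M.ncard * k ≤ n := by
    rw [← hc.ncard_range]
    refine ncard_mul_le hd fun T hT => ?_
    rw [Set.inter_eq_left.2 (hM T hT).2, (hM T hT).1.ncard_eq]
  have h2 : k * X.ncard ≤ n :=
    (Nat.mul_le_mul_left k hle).trans ((Nat.mul_comm _ _).trans_le h1)
  refine ⟨X.ncard, (hc.equally_spaced h2 fun p => ?_).2.1.symm⟩
  obtain ⟨v, hvX, hv⟩ := hX _ (hc.isKSet_arc p hkn) fun v hv => mem_range_of_mem_arc hv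
  obtain ⟨j, hj, rfl⟩ := mem_arc.1 hv
  exact ⟨j, hj, hvX⟩

/-- The vertices of the cycle `c` whose positions have their residue in `U`. -/
def residueSet {k : ℕ} (c : ℤ → V) (U : Finset (ZMod k)) : Set V :=
  {v | ∃ a : ℤ, v = c a ∧ (a : ZMod k) ∈ U}

theorem IsCyc.ncard_residueSet_le {k m : ℕ} (hk : 0 < k) {c : ℤ → V} (hc : IsCyc G (k * m) c)
    (U : Finset (ZMod k)) : (residueSet c U).ncard ≤ m * U.card := by
  classical
  have : NeZero k := ⟨hk.ne'⟩
  have hm : 0 < m := by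
    have := hc.three_le
    exact Nat.pos_of_ne_zero (by rintro rfl; simp at this)
  have hsub : residueSet c U ⊆ ((U ×ˢ Finset.range m).image
      fun x : ZMod k × ℕ => c ((x.1.val : ℤ) + k * x.2) : Finset V) := by
    rintro _ ⟨a, rfl, ha⟩
    rw [Finset.mem_coe, Finset.mem_image]
    have hval : (((a : ZMod k).val : ℕ) : ℤ) = a % k := ZMod.val_intCast a
    have h0 := Int.emod_nonneg (a / k) (by omega : (m : ℤ) ≠ 0)
    have h1 := Int.emod_lt_of_pos (a / k) (by omega : (0 : ℤ) < m)
    refine ⟨(a, ((a / k) % m).toNat), ?_, ?_⟩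
    · rw [Finset.mem_product, Finset.mem_range]
      exact ⟨ha, by omega⟩
    · simp only [hval, Int.toNat_of_nonneg h0]
      rw [hc.eq_iff]
      have e1 := Int.emod_add_mul_ediv a k
      have e2 := Int.emod_add_mul_ediv (a / k) m
      refine ⟨-(a / k / m), ?_⟩
      push_cast
      linear_combination e1 + (k : ℤ) * e2
  calc (residueSet c U).ncard ≤ _ := Set.ncard_le_ncard hsub (Finset.finite_toSet _)
    _ ≤ (U ×ˢ Finset.range m).card := by
        rw [Set.ncard_coe_finset]; exact Finset.card_image_le
    _ = m * U.card := by rw [Finset.card_product, Finset.card_range, Nat.mul_comm]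

section Odd

variable {k n : ℕ} {c : ℤ → V}

/-- A connection outside the cycle between two different cycle vertices is an ear. This keeps
pendant paths at different residues apart. -/
theorem IsCyc.dvd_of_reachable (hc : IsCyc G n c) (hk : Odd k)
    (hD : ∀ n c, IsCyc G n c → k ∣ n) {a b : ℤ} {v w : V} (hv : v ∉ Set.range c)
    (h : (within G (Set.range c)ᶜ).Reachable v w) (hav : G.Adj (c a) v) (hwb : G.Adj w (c b)) :
    (k : ℤ) ∣ a - b := by
  by_cases hab : c a = c b
  · exact (Int.natCast_dvd_natCast.2 (hD _ _ hc)).trans ((hc.eq_iff _ _).1 hab)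
  obtain ⟨l, hl, hout, hh, ht⟩ := exists_pathList_of_reachable h hv
  refine (hc.dvd_ear hk hD hab (l := l) ⟨?_, ?_⟩ hout (by rintro rfl; simp at hh)).2
  · rw [List.isChain_cons, List.isChain_append]
    refine ⟨?_, hl.chain, List.isChain_singleton _, ?_⟩
    · rw [List.head?_append, hh]
      simpa using hav
    · rw [ht]; simpa using hwb
  · rw [List.nodup_cons, List.nodup_append']
    refine ⟨?_, hl.nodup, List.nodup_singleton _, ?_⟩
    · rw [List.mem_append, List.mem_singleton]
      rintro (h | h)
      · exact hout _ h ⟨a, rfl⟩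
      · exact hab h
    · intro x hx hx'
      rw [List.mem_singleton] at hx'
      exact hout x hx ⟨b, hx'.symm⟩

theorem intCast_eq_of_eq (hc : IsCyc G n c) (hkn : k ∣ n) {a b : ℤ} (hab : c a = c b) :
    (a : ZMod k) = b := by
  rw [ZMod.intCast_eq_intCast_iff_dvd_sub]
  exact (Int.natCast_dvd_natCast.2 hkn).trans ((hc.eq_iff _ _).1 hab.symm)

/-- In a pendant path with fewer than `k - 1` vertices only the first vertex has a neighbour on
the cycle. -/
theorem IsPend.eq_of_adj (hc : IsCyc G n c) (hk : Odd k) (hD : ∀ n c, IsCyc G n c → k ∣ n)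
    {p b : ℤ} {l : List V} (hl : IsPend G c p l) (hlen : l.length + 1 < k) {v : V} (hv : v ∈ l)
    (hvb : G.Adj v (c b)) : c b = c p ∧ l.head? = some v := by
  obtain ⟨l₁, l₂, rfl⟩ := List.append_of_mem hv
  have hpath : IsPathList G (c p :: (l₁ ++ [v])) := hl.path.infix ⟨[], l₂, by simp⟩
  simp only [List.length_append, List.length_cons] at hlen
  have hpb : c b = c p := by
    by_contra hne
    have := (hc.dvd_ear hk hD (Ne.symm hne) (l := l₁ ++ [v]) ⟨?_, ?_⟩
      (fun w hw => hl.notMem w (by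
        simp only [List.mem_append, List.mem_cons] at hw ⊢; tauto))
      (by simp)).1
    · have := Nat.le_of_dvd (by omega) this
      simp at this
      omega
    · rw [← List.cons_append, List.isChain_append]
      refine ⟨hpath.chain, List.isChain_singleton _, ?_⟩
      rw [← List.cons_append, List.getLast?_append]
      simpa using hvb
    · rw [← List.cons_append, List.nodup_append']
      refine ⟨hpath.nodup, List.nodup_singleton _, ?_⟩
      intro x hx hx'
      rw [List.mem_singleton] at hx'
      subst hx'
      rcases List.mem_cons.1 hx with hx | hx
      · exact hne hx
      · exact hl.notMem _ (by
          simp only [List.mem_append, List.mem_cons] at hx ⊢; tauto) ⟨b, rfl⟩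
  refine ⟨hpb, ?_⟩
  rcases List.eq_nil_or_concat l₁ with rfl | ⟨l₁, z, rfl⟩
  · rfl
  · exfalso
    obtain ⟨c', hc', -⟩ := exists_isCyc_of_isPathList hpath (by simp) rfl (b := v)
      (by rw [← List.cons_append, List.getLast?_append]; simp) (hpb ▸ hvb)
    have := Nat.le_of_dvd (by simp) (hD _ _ hc')
    simp at this hlen
    omega

/-- Pendant paths of a cycle, one of length `j x` for every residue `x`. -/
structure PendSystem (G : SimpleGraph V) (c : ℤ → V) (k : ℕ) (j : ZMod k → ℕ) where
  pos : ZMod k → ℤ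
  list : ZMod k → List V
  cast_pos : ∀ x, (pos x : ZMod k) = x
  length_list : ∀ x, (list x).length = j x
  isPend : ∀ x, IsPend G c (pos x) (list x)

/-! ### Counting in the union of a cycle and a system of pendant paths -/

namespace PendSystem

variable {j : ZMod k → ℕ} (P : PendSystem G c k j)

/-- The vertices of the pendant paths. -/
def verts : Set V := {v | ∃ x, v ∈ P.list x}

/-- The first vertices of the pendant paths. -/
def firsts : Set V := {v | ∃ x, (P.list x).head? = some v}

include P in
theorem notMem_range {v : V} (hv : v ∈ P.verts) : v ∉ Set.range c := by
  obtain ⟨x, hx⟩ := hv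
  exact (P.isPend x).notMem v hx

theorem eq_of_reachable (hc : IsCyc G n c) (hk : Odd k) (hD : ∀ n c, IsCyc G n c → k ∣ n)
    {x y : ZMod k} {v w : V} (hv : v ∈ P.list x) (hw : w ∈ P.list y)
    (h : (within G (Set.range c)ᶜ).Reachable v w) : x = y := by
  have hx := P.isPend x
  have hy := P.isPend y
  have aux : ∀ {p : ℤ} {l : List V} {v : V}, IsPend G c p l → v ∈ l →
      ∃ a ∈ l, G.Adj (c p) a ∧ (within G (Set.range c)ᶜ).Reachable a v := by
    intro p l v hl hv
    cases l with
    | nil => simp at hv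
    | cons a l =>
      exact ⟨a, by simp, hl.path.chain.rel,
        reachable_of_isChain hl.path.chain.tail hl.notMem (by simp) hv⟩
  obtain ⟨a, ha, hpa, hav⟩ := aux hx hv
  obtain ⟨b, hb, hpb, hbw⟩ := aux hy hw
  have := hc.dvd_of_reachable hk hD (hx.notMem a ha) ((hav.trans h).trans hbw.symm) hpa hpb.symm
  rw [← P.cast_pos x, ← P.cast_pos y]
  exact ((ZMod.intCast_eq_intCast_iff_dvd_sub _ _ _).2 this).symm

theorem subset_list (hc : IsCyc G n c) (hk : Odd k) (hD : ∀ n c, IsCyc G n c → k ∣ n)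
    {l : List V} (hl : IsPathList G l) (hlP : ∀ v ∈ l, v ∈ P.verts) {x : ZMod k} {v : V}
    (hv : v ∈ l) (hvx : v ∈ P.list x) : (∀ w ∈ l, w ∈ P.list x) ∧ l.length ≤ j x := by
  have hsub : ∀ w ∈ l, w ∈ P.list x := by
    intro w hw
    obtain ⟨y, hy⟩ := hlP w hw
    have := P.eq_of_reachable hc hk hD hvx hy
      (reachable_of_isChain hl.chain (fun v hv => P.notMem_range (hlP v hv)) hv hw)
    rwa [this]
  refine ⟨hsub, ?_⟩
  rw [← P.length_list x]
  exact (List.subperm_of_subset hl.nodup hsub).length_le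

/-- Only the first vertex of a short pendant path sees the cycle, so any pendant path inside the
system enters one of its paths at the first vertex and stays in it. -/
theorem of_isPend {h : ℕ} (hkh : k = 2 * h + 1) (hh : 1 ≤ h) (hjh : ∀ x, j x ≤ h)
    (hc : IsCyc G n c) (hD : ∀ n c, IsCyc G n c → k ∣ n) {q : ℤ} {l : List V}
    (hl : IsPend G c q l) (hlP : ∀ v ∈ l, v ∈ P.verts) (hne : l ≠ []) :
    (∃ f ∈ l, f ∈ P.firsts) ∧ l.length ≤ j q := by
  have hk : Odd k := ⟨h, hkh⟩
  cases l with
  | nil => exact absurd rfl hne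
  | cons v l =>
    obtain ⟨x, hx⟩ := hlP v (by simp)
    have hlen := P.length_list x
    have := hjh x
    obtain ⟨h1, h2⟩ := (P.isPend x).eq_of_adj hc hk hD (by omega) hx hl.path.chain.rel.symm
    have hxq : (q : ZMod k) = x := by
      rw [← P.cast_pos x]; exact intCast_eq_of_eq hc (hD _ _ hc) h1
    refine ⟨⟨v, by simp, x, h2⟩, ?_⟩
    rw [hxq]
    exact (P.subset_list hc hk hD (hl.path.infix ⟨[c q], [], by simp⟩) hlP
      (List.mem_cons_self) hx).2

/-- A path of order `k` in the union of the cycle and the pendant paths has at least `|U|` vertices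
that are first vertices of pendant paths or have their residue in the sparse set `U`. -/
theorem card_le_ncard_inter [Finite V] {h : ℕ} (hkh : k = 2 * h + 1) (hh : 1 ≤ h)
    (hjh : ∀ x, j x ≤ h) (hc : IsCyc G n c) (hD : ∀ n c, IsCyc G n c → k ∣ n)
    {U : Finset (ZMod k)} (hU : ∀ (x : ZMod k) (δ δ' : ℕ), 1 ≤ δ → δ ≤ j x → 1 ≤ δ' → δ' ≤ j x →
      (x + δ ∈ U → x + δ' ∈ U → δ = δ') ∧ (x - δ ∈ U → x - δ' ∈ U → δ = δ'))
    {T : Set V} (hT : IsKSet G k T) (hTS : T ⊆ Set.range c ∪ P.verts) :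
    U.card ≤ (T ∩ (residueSet c U ∪ P.firsts)).ncard := by
  have hk : Odd k := ⟨h, hkh⟩
  obtain ⟨Q, hQ, hlen, rfl⟩ := hT
  have hmeet : ∃ z ∈ Q, z ∈ Set.range c := by
    by_contra hcon
    push Not at hcon
    have hQP : ∀ v ∈ Q, v ∈ P.verts := fun v hv => (hTS hv).resolve_left (hcon v hv)
    obtain ⟨v, hv⟩ := List.exists_mem_of_ne_nil Q (by rintro rfl; simp at hlen; omega)
    obtain ⟨x, hx⟩ := hQP v hv
    have := (P.subset_list hc hk hD hQ hQP hv hx).2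
    have := hjh x
    omega
  have main : ∀ (Q : List V) (p : ℤ) (L : ℕ) (l₁ l₂ : List V), IsPathList G Q → Q.length = k →
      (∀ v ∈ Q, v ∈ Set.range c ∪ P.verts) → 1 ≤ L → Q = l₁ ++ arc c p L ++ l₂ →
      (∀ v ∈ l₁, v ∉ Set.range c) → (∀ v ∈ l₂, v ∉ Set.range c) →
      U.card ≤ ({v | v ∈ Q} ∩ (residueSet c U ∪ P.firsts)).ncard := by
    intro Q p L l₁ l₂ hQ hlen hQS hL he h1 h2
    obtain ⟨L, rfl⟩ : ∃ L', L = L' + 1 := ⟨L - 1, by omega⟩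
    have hmem1 : ∀ v ∈ l₁, v ∈ Q := fun v hv => by rw [he]; simp [hv]
    have hmem2 : ∀ v ∈ l₂, v ∈ Q := fun v hv => by rw [he]; simp [hv]
    have hpend2 : IsPend G c (p + L) l₂ := by
      refine ⟨hQ.infix ⟨l₁ ++ arc c p L, [], ?_⟩, h2⟩
      rw [he, arc_succ']; simp
    have hpend1 : IsPend G c p l₁.reverse := by
      refine ⟨?_, fun v hv => h1 v (List.mem_reverse.1 hv)⟩
      have : IsPathList G (l₁ ++ [c p]) := by
        refine hQ.infix ⟨[], arc c (p + 1) L ++ l₂, ?_⟩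
        rw [he, arc_succ]; simp
      simpa using this.reverse
    have hf2 := P.of_isPend hkh hh hjh hc hD hpend2
      (fun v hv => (hQS v (hmem2 v hv)).resolve_left (h2 v hv))
    have hf1 := P.of_isPend hkh hh hjh hc hD hpend1 (fun v hv =>
      (hQS v (hmem1 v (List.mem_reverse.1 hv))).resolve_left (h1 v (List.mem_reverse.1 hv)))
    rw [List.length_reverse] at hf1
    have hdisj : ∀ v ∈ l₁, v ∉ l₂ := by
      have := hQ.nodup
      rw [he, List.append_assoc, List.nodup_append'] at this
      intro v hv hv'
      exact this.2.2 hv (List.mem_append_right _ hv')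
    rw [he, List.length_append, List.length_append, length_arc] at hlen
    -- Number the positions beyond the arc along both pendant ends: the `k` vertices of the path
    -- then run through all residues once. A residue of `U` on the arc is charged to its cycle
    -- vertex, any other one to the first vertex of the pendant end where it falls. By `hU` each end
    -- is charged at most once.
    have hex : ∀ u ∈ U, ∃ v, v ∈ Q ∧ v ∈ residueSet c U ∪ P.firsts ∧
        ((∃ i : ℕ, v = c (p + i) ∧ ((p + i : ℤ) : ZMod k) = u) ∨
        (v ∈ l₂ ∧ ∃ δ : ℕ, 1 ≤ δ ∧ δ ≤ j ((p + L : ℤ) : ZMod k) ∧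
          u = ((p + L : ℤ) : ZMod k) + δ) ∨
        (v ∈ l₁ ∧ ∃ δ : ℕ, 1 ≤ δ ∧ δ ≤ j (p : ZMod k) ∧ u = (p : ZMod k) - δ)) := by
      intro u hu
      obtain ⟨a, ha⟩ := ZMod.intCast_surjective u
      obtain ⟨t, htk, ht⟩ := exists_offset_mod (by omega : 0 < k) a p
      have hut : u = (p : ZMod k) + t := by
        have := (ZMod.intCast_eq_intCast_iff_dvd_sub (p + t) a k).2 (by
          rwa [show a - (p + (t : ℤ)) = a - t - p by ring])
        rw [← ha, ← this]; push_cast; ring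
      rcases Nat.lt_or_ge L t with hLt | hLt
      · rcases Nat.lt_or_ge l₂.length (t - L) with hlt | hge
        · have hne : l₁ ≠ [] := by rintro rfl; simp at hlen; omega
          obtain ⟨⟨f, hf, hfP⟩, hle⟩ := hf1 (by simpa using hne)
          refine ⟨f, hmem1 f (List.mem_reverse.1 hf), Or.inr hfP,
            Or.inr (Or.inr ⟨List.mem_reverse.1 hf, k - t, by omega, by omega, ?_⟩)⟩
          rw [hut, Nat.cast_sub htk.le]; simp
        · have hne : l₂ ≠ [] := by rintro rfl; simp at hge; omega
          obtain ⟨⟨f, hf, hfP⟩, hle⟩ := hf2 hne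
          refine ⟨f, hmem2 f hf, Or.inr hfP, Or.inr (Or.inl ⟨hf, t - L, by omega, by omega, ?_⟩)⟩
          rw [hut, Nat.cast_sub hLt.le]; push_cast; ring
      · have hu' : ((p + t : ℤ) : ZMod k) = u := by rw [hut]; push_cast; ring
        refine ⟨c (p + t), ?_, Or.inl ⟨_, rfl, by rw [hu']; exact hu⟩, Or.inl ⟨t, rfl, hu'⟩⟩
        rw [he]
        simp only [List.mem_append]
        exact Or.inl (Or.inr (mem_arc.2 ⟨t, by omega, rfl⟩))
    have : Nonempty V := ⟨c 0⟩
    choose! g hgQ hgW hg using hex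
    rw [← Set.ncard_coe_finset]
    refine Set.ncard_le_ncard_of_injOn g (fun u hu => ⟨hgQ u hu, hgW u hu⟩) ?_ (Set.toFinite _)
    intro u hu u' hu' hgg
    have g1 := hg u hu
    have g2 := hg u' hu'
    rw [← hgg] at g2
    rcases g1 with ⟨i, hi, rfl⟩ | ⟨hm, δ, hδ, hδ', rfl⟩ | ⟨hm, δ, hδ, hδ', rfl⟩ <;>
      rcases g2 with ⟨i', hi', rfl⟩ | ⟨hm', ε, hε, hε', rfl⟩ | ⟨hm', ε, hε, hε', rfl⟩
    · exact intCast_eq_of_eq hc (hD _ _ hc) (hi.symm.trans hi')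
    · exact absurd ⟨_, hi.symm⟩ (h2 _ hm')
    · exact absurd ⟨_, hi.symm⟩ (h1 _ hm')
    · exact absurd ⟨_, hi'.symm⟩ (h2 _ hm)
    · rw [(hU _ δ ε hδ hδ' hε hε').1 hu hu']
    · exact absurd hm (hdisj _ hm')
    · exact absurd ⟨_, hi'.symm⟩ (h1 _ hm)
    · exact absurd hm' (hdisj _ hm)
    · rw [(hU _ δ ε hδ hδ' hε hε').2 hu hu']
  obtain ⟨p, L, l₁, l₂, hL, he, h1, h2⟩ :=
    hc.path_structure hk (by omega) hD hQ hlen.le hmeet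
  rcases he with he | he
  · exact main Q p L l₁ l₂ hQ hlen hTS hL he h1 h2
  · have := main Q.reverse p L l₁ l₂ hQ.reverse (by simpa using hlen)
      (fun v hv => hTS (List.mem_reverse.1 hv)) hL he h1 h2
    simpa using this

theorem ncard_firsts_le [NeZero k] : P.firsts.ncard ≤ ({x | 0 < j x} : Set (ZMod k)).ncard := by
  have hsub : P.firsts ⊆ (fun x => (P.list x).headD (c 0)) '' {x | 0 < j x} := by
    rintro v ⟨x, hx⟩
    refine ⟨x, ?_, by simp [List.headD_eq_head?_getD, hx]⟩
    change 0 < j x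
    rw [← P.length_list x]
    exact List.length_pos_of_ne_nil (by intro h; rw [h] at hx; simp at hx)
  exact (Set.ncard_le_ncard hsub (Set.toFinite _)).trans (Set.ncard_image_le (Set.toFinite _))

end PendSystem

/-- If `ν_k = τ_k` for all induced subgraphs, then the residue class of some `r` on the cycle meets
all paths of order `k` that meet the cycle. -/
theorem IsCyc.exists_residue [Finite V] {h : ℕ} (hkh : k = 2 * h + 1) (hh : 1 ≤ h)
    (hG : ∀ S : Set V, KonigIn G k S) (hD : ∀ n c, IsCyc G n c → k ∣ n) (hc : IsCyc G n c) :
    ∃ r : ℤ, ∀ Q : List V, IsPathList G Q → Q.length = k → (∃ z ∈ Q, z ∈ Set.range c) →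
      ∃ a, (k : ℤ) ∣ a - r ∧ c a ∈ Q := by
  classical
  by_contra hcon
  push Not at hcon
  have : NeZero k := ⟨by omega⟩
  have hk : Odd k := ⟨h, hkh⟩
  obtain ⟨m, hm⟩ := hD _ _ hc
  have hkn : k ≤ n := Nat.le_of_dvd (by have := hc.three_le; omega) (hD _ _ hc)
  -- The radius around `x` is the greatest length, up to `h`, of a pendant path at residue `x`. The
  -- `k`-paths avoiding the various classes make these intervals cover every residue.
  let Av : ZMod k → ℕ → Prop := fun x δ =>
    ∃ (p : ℤ) (l : List V), (p : ZMod k) = x ∧ l.length = δ ∧ IsPend G c p l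
  have hAv0 : ∀ x, Av x 0 := fun x => by
    obtain ⟨p, hp⟩ := ZMod.intCast_surjective x
    exact ⟨p, [], hp, rfl, ⟨⟨List.isChain_singleton _, List.nodup_singleton _⟩, by simp⟩⟩
  have hcov : ∀ r, ∃ x, Covers (fun x => Nat.findGreatest (Av x) h) x r := by
    intro r
    obtain ⟨a, rfl⟩ := ZMod.intCast_surjective r
    obtain ⟨Q, hQ, hlen, hmeet, hav⟩ := hcon a
    obtain ⟨p, δ, l, h1, h2, hl, hpend, hr⟩ :=
      hc.exists_pend_of_avoid hkh hh hD hQ hlen hmeet hav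
    refine ⟨p, δ, h1, Nat.le_findGreatest h2 ⟨p, l, rfl, hl, hpend⟩, ?_⟩
    rcases hr with hr | hr
    · right
      have := (ZMod.intCast_eq_intCast_iff_dvd_sub a (p - δ) k).2 hr
      rw [this]; push_cast; ring
    · left
      have := (ZMod.intCast_eq_intCast_iff_dvd_sub a (p + δ) k).2 hr
      rw [this]; push_cast; ring
  obtain ⟨j, hji, hjcov, U, hUcard, hU⟩ :=
    exists_sparse_residues hkh (fun x => Nat.findGreatest_le h) hcov
  have hjh : ∀ x, j x ≤ h := fun x => (hji x).trans (Nat.findGreatest_le h)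
  have hsys : ∀ x, Av x (j x) := by
    intro x
    obtain ⟨p, l, hp, hl, hpend⟩ := Nat.findGreatest_spec (P := Av x) (Nat.zero_le h) (hAv0 x)
    have := hji x
    exact ⟨p, l.take (j x), hp, by rw [List.length_take]; omega, hpend.take _⟩
  choose pos list hpos hlist hpend using hsys
  let P : PendSystem G c k j := ⟨pos, list, hpos, hlist, hpend⟩
  obtain ⟨M, X, hM, hd, hX, hle⟩ := hG (Set.range c ∪ P.verts)
  -- The last summand is smaller than `|U|`, so `M` has at most `m = n / k` members. Hence `X` is a
  -- residue class on the cycle.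
  have h1 : M.ncard * U.card ≤ m * U.card + ({x | 0 < j x} : Set (ZMod k)).ncard := by
    refine (ncard_mul_le hd (W := residueSet c U ∪ P.firsts) fun T hT =>
      P.card_le_ncard_inter hkh hh hjh hc hD hU (hM T hT).1 (hM T hT).2).trans ?_
    refine (Set.ncard_union_le _ _).trans ?_
    subst hm
    exact add_le_add (hc.ncard_residueSet_le (by omega) U) P.ncard_firsts_le
  have h2 : M.ncard ≤ m := by
    by_contra hlt
    have : (m + 1) * U.card ≤ M.ncard * U.card := Nat.mul_le_mul_right _ (by omega)
    rw [Nat.succ_mul] at this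
    omega
  have hXn : k * X.ncard ≤ n := by
    rw [hm]; exact Nat.mul_le_mul_left k (hle.trans h2)
  obtain ⟨hXc, -, r, hr⟩ := hc.equally_spaced hXn fun p => by
    obtain ⟨v, hvX, hv⟩ := hX _ (hc.isKSet_arc p hkn) fun v hv => Or.inl (mem_range_of_mem_arc hv)
    obtain ⟨i, hi, rfl⟩ := mem_arc.1 hv
    exact ⟨i, hi, hvX⟩
  -- The class found is itself covered by an interval, whose pendant path extends to a `k`-path
  -- missing `X`.
  obtain ⟨x, δ, hδ, hδj, hrx⟩ := hjcov r
  have hlen : ((P.list x).take δ).length = δ := by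
    rw [List.length_take, P.length_list]; omega
  have := hjh x
  obtain ⟨T, hT, -, hTv⟩ := ((P.isPend x).take δ).exists_isKSet hc hkn (r := r)
    (by omega) (by omega) (by
      rw [hlen]
      rcases hrx with hrx | hrx
      · right
        rw [← ZMod.intCast_eq_intCast_iff_dvd_sub, hrx]
        push_cast; rw [P.cast_pos]
      · left
        rw [← ZMod.intCast_eq_intCast_iff_dvd_sub, hrx]
        push_cast; rw [P.cast_pos])
  have hTS : T ⊆ Set.range c ∪ P.verts := by
    intro v hv
    rcases hTv v hv with h | ⟨i, rfl, -⟩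
    · exact Or.inr ⟨x, List.mem_of_mem_take h⟩
    · exact Or.inl ⟨i, rfl⟩
  obtain ⟨v, hvX, hv⟩ := hX T hT hTS
  rcases hTv v hv with h | ⟨i, rfl, hi⟩
  · exact P.notMem_range ⟨x, List.mem_of_mem_take h⟩ (hXc hvX)
  · exact hi ((hr i).1 hvX)

end Odd

theorem cycCoverable_of_mem_classG' [Finite V] {k : ℕ} (hk : Odd k)
    (hG : G ∈ PathKE.classG' k V) : CycCoverable G k := by
  intro n c hc
  obtain ⟨h, hkh⟩ := hk
  rcases Nat.eq_zero_or_pos h with rfl | hh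
  · refine ⟨Set.range c, subset_rfl, by rw [hkh, hc.ncard_range]; omega, fun T _ hT => hT⟩
  have hKon := (mem_classG_iff (by omega : 0 < k)).1 hG.1
  have hshort : ∀ n c, IsCyc G n c → k ≤ n := by
    intro n c hc
    obtain ⟨w, hw, rfl⟩ := hc.exists_isCycle
    exact hG.2 _ w hw
  have hD : ∀ n c, IsCyc G n c → k ∣ n := fun n c hc =>
    hc.dvd_of_konigIn (hshort n c hc) (hKon _)
  obtain ⟨r, hr⟩ := hc.exists_residue hkh hh hKon hD
  obtain ⟨m, hm⟩ := hD _ _ hc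
  have hkn := hshort n c hc
  refine ⟨residueSet c {(r : ZMod k)}, ?_, ?_, ?_⟩
  · rintro _ ⟨a, rfl, -⟩; exact ⟨a, rfl⟩
  · have hle : k * (residueSet c {(r : ZMod k)}).ncard ≤ n := by
      subst hm
      refine Nat.mul_le_mul_left k ((hc.ncard_residueSet_le (by omega) _).trans ?_)
      simp
    refine (hc.equally_spaced hle fun p => ?_).2.1
    obtain ⟨a, ha, hmem⟩ := hr (arc c p k) (hc.isPathList_arc p hkn) (length_arc _ _ _)
      ⟨c p, mem_arc.2 ⟨0, by omega, by simp⟩, p, rfl⟩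
    obtain ⟨i, hi, hia⟩ := mem_arc.1 hmem
    refine ⟨i, hi, a, hia, Finset.mem_singleton.2 ?_⟩
    exact ((ZMod.intCast_eq_intCast_iff_dvd_sub _ _ _).2 ha).symm
  · rintro T ⟨Q, hQ, hlen, rfl⟩ ⟨z, hz, hzc⟩
    obtain ⟨a, ha, hmem⟩ := hr Q hQ hlen ⟨z, hz, hzc⟩
    exact ⟨c a, hmem, a, rfl, Finset.mem_singleton.2
      ((ZMod.intCast_eq_intCast_iff_dvd_sub _ _ _).2 ha).symm⟩

/-! ### Blocks -/

/-- The vertices of `B` in `S` are joined by paths of `B` inside `S`. -/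
def ConnIn (B : G.Subgraph) (S : Set V) : Prop :=
  ∀ a ∈ B.verts, ∀ b ∈ B.verts, a ∈ S → b ∈ S → (within B.spanningCoe S).Reachable a b

theorem preconnected_induce_iff {B : G.Subgraph} {S : Set V} :
    (B.coe.induce (Subtype.val ⁻¹' S)).Preconnected ↔ ConnIn B S := by
  constructor
  · intro h a ha b hb haS hbS
    let f : B.coe.induce (Subtype.val ⁻¹' S) →g within B.spanningCoe S :=
      ⟨fun v => v.1.1, fun {v w} hvw => ⟨hvw, v.2, w.2⟩⟩
    exact (h ⟨⟨a, ha⟩, haS⟩ ⟨⟨b, hb⟩, hbS⟩).map f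
  · rintro h ⟨⟨a, ha⟩, haS⟩ ⟨⟨b, hb⟩, hbS⟩
    have := mem_of_reachable (h a ha b hb haS hbS) (D := {v | ∃ (hv : v ∈ B.verts) (hvS : v ∈ S),
      (B.coe.induce (Subtype.val ⁻¹' S)).Reachable ⟨⟨a, ha⟩, haS⟩ ⟨⟨v, hv⟩, hvS⟩})
      ⟨ha, haS, SimpleGraph.Reachable.refl _⟩ ?_
    · exact this.2.2
    · rintro x ⟨hx, hxS, hr⟩ y hyS - hxy
      have hxy : B.Adj x y := hxy
      have hadj : (B.coe.induce (Subtype.val ⁻¹' S)).Adj ⟨⟨x, hx⟩, hxS⟩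
        ⟨⟨y, B.edge_vert hxy.symm⟩, hyS⟩ := hxy
      exact ⟨_, hyS, hr.trans hadj.reachable⟩

theorem connected_iff_connIn {B : G.Subgraph} :
    B.Connected ↔ B.verts.Nonempty ∧ ConnIn B Set.univ := by
  rw [SimpleGraph.Subgraph.connected_iff, and_comm]
  refine and_congr_right fun _ => ?_
  rw [← preconnected_induce_iff, SimpleGraph.Subgraph.preconnected_iff]
  exact (SimpleGraph.induceUnivIso B.coe).preconnected_iff.symm

/-- A connected subgraph without cutvertices, in terms of paths. -/
structure NoCut (B : G.Subgraph) : Prop where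
  nonempty : B.verts.Nonempty
  conn : ConnIn B Set.univ
  conn_compl : ∀ x, ConnIn B {x}ᶜ

theorem ConnIn.of_notMem {B : G.Subgraph} (h : ConnIn B Set.univ) {x : V} (hx : x ∉ B.verts) :
    ConnIn B {x}ᶜ := by
  intro a ha b hb _ _
  have hle : within B.spanningCoe Set.univ ≤ within B.spanningCoe {x}ᶜ := by
    rintro v w ⟨hvw, -⟩
    have hvw : B.Adj v w := hvw
    refine ⟨hvw, ?_, ?_⟩
    · rintro rfl; exact hx (B.edge_vert hvw)
    · rintro rfl; exact hx (B.edge_vert hvw.symm)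
  exact (h a ha b hb trivial trivial).mono hle

theorem not_isCutvertex_iff [Finite V] {B : G.Subgraph} (hB : B.Connected) (x : B.verts) :
    ¬ PathKE.IsCutvertex B.coe x ↔ ConnIn B {(x : V)}ᶜ := by
  have h1 : Nat.card B.coe.ConnectedComponent = 1 := by
    have := hB.coe.preconnected.subsingleton_connectedComponent
    have := hB.coe.nonempty.map B.coe.connectedComponentMk
    rw [Nat.card_eq_one_iff_unique]
    exact ⟨inferInstance, this⟩
  have hset : ({x}ᶜ : Set B.verts) = Subtype.val ⁻¹' ({(x : V)}ᶜ : Set V) := by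
    ext y; simp [Subtype.ext_iff]
  rw [PathKE.IsCutvertex, h1, not_lt, Finite.card_le_one_iff_subsingleton, hset,
    ← preconnected_induce_iff]
  constructor
  · intro h a b
    exact SimpleGraph.ConnectedComponent.exact (Subsingleton.elim _ _)
  · exact fun h => h.subsingleton_connectedComponent

theorem noCut_iff [Finite V] {B : G.Subgraph} :
    (B.Connected ∧ ∀ x : B.verts, ¬ PathKE.IsCutvertex B.coe x) ↔ NoCut B := by
  constructor
  · rintro ⟨h, hx⟩
    obtain ⟨h1, h2⟩ := connected_iff_connIn.1 h
    refine ⟨h1, h2, fun x => ?_⟩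
    by_cases hxB : x ∈ B.verts
    · exact (not_isCutvertex_iff h ⟨x, hxB⟩).1 (hx ⟨x, hxB⟩)
    · exact h2.of_notMem hxB
  · rintro ⟨h1, h2, h3⟩
    have h := connected_iff_connIn.2 ⟨h1, h2⟩
    exact ⟨h, fun x => (not_isCutvertex_iff h x).2 (h3 x)⟩

theorem isBlock_iff [Finite V] {B : G.Subgraph} : PathKE.IsBlock G B ↔ Maximal NoCut B := by
  rw [PathKE.IsBlock, show (fun C : G.Subgraph => C.Connected ∧
    ∀ x : C.verts, ¬ PathKE.IsCutvertex C.coe x) = NoCut from funext fun C => propext noCut_iff]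

theorem ConnIn.sup {B D : G.Subgraph} {S : Set V} (hB : ConnIn B S) (hD : ConnIn D S) {y : V}
    (hyB : y ∈ B.verts) (hyD : y ∈ D.verts) (hy : y ∈ S) : ConnIn (B ⊔ D) S := by
  have hle : ∀ C ≤ B ⊔ D, within C.spanningCoe S ≤ within (B ⊔ D).spanningCoe S :=
    fun C hC v w hvw => ⟨hC.2 hvw.1, hvw.2⟩
  have key : ∀ a ∈ (B ⊔ D).verts, a ∈ S → (within (B ⊔ D).spanningCoe S).Reachable a y := by
    rintro a (ha | ha) haS
    · exact (hB a ha y hyB haS hy).mono (hle B le_sup_left)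
    · exact (hD a ha y hyD haS hy).mono (hle D le_sup_right)
  exact fun a ha b hb haS hbS => (key a ha haS).trans (key b hb hbS).symm

/-- After the deletion of any vertex, at least one of the two common vertices still joins the parts.
-/
theorem NoCut.sup {B D : G.Subgraph} (hB : NoCut B) (hD : NoCut D) {p q : V} (hpq : p ≠ q)
    (hpB : p ∈ B.verts) (hpD : p ∈ D.verts) (hqB : q ∈ B.verts) (hqD : q ∈ D.verts) :
    NoCut (B ⊔ D) := by
  refine ⟨⟨p, Or.inl hpB⟩, hB.conn.sup hD.conn hpB hpD trivial, fun x => ?_⟩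
  by_cases hx : p = x
  · exact (hB.conn_compl x).sup (hD.conn_compl x) hqB hqD fun h => hpq (hx.trans h.symm)
  · exact (hB.conn_compl x).sup (hD.conn_compl x) hpB hpD hx

/-- The subgraph formed by a cycle. -/
def cycSubgraph {n : ℕ} {c : ℤ → V} (hc : IsCyc G n c) : G.Subgraph where
  verts := Set.range c
  Adj a b := ∃ i, (a = c i ∧ b = c (i + 1)) ∨ (a = c (i + 1) ∧ b = c i)
  adj_sub := by
    rintro a b ⟨i, ⟨rfl, rfl⟩ | ⟨rfl, rfl⟩⟩
    · exact hc.adj i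
    · exact (hc.adj i).symm
  edge_vert := by
    rintro a b ⟨i, ⟨rfl, rfl⟩ | ⟨rfl, rfl⟩⟩
    · exact ⟨_, rfl⟩
    · exact ⟨_, rfl⟩
  symm := ⟨by
    rintro a b ⟨i, h | h⟩
    · exact ⟨i, Or.inr ⟨h.2, h.1⟩⟩
    · exact ⟨i, Or.inl ⟨h.2, h.1⟩⟩⟩

theorem noCut_cycSubgraph {n : ℕ} {c : ℤ → V} (hc : IsCyc G n c) : NoCut (cycSubgraph hc) := by
  have key : ∀ (S : Set V) (p : ℤ) (m : ℕ), (∀ j : ℕ, j < m → c (p + j) ∈ S) → ∀ j : ℕ, j < m →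
      (within (cycSubgraph hc).spanningCoe S).Reachable (c p) (c (p + j)) := by
    intro S p m hS j hj
    induction j with
    | zero => simp
    | succ j ih =>
      refine (ih (by omega)).trans (SimpleGraph.Adj.reachable ⟨?_, hS j (by omega), hS _ hj⟩)
      exact ⟨p + j, Or.inl ⟨rfl, by push_cast; rw [add_assoc]⟩⟩
  have hn := hc.three_le
  have hconn : ConnIn (cycSubgraph hc) Set.univ := by
    have : ∀ i, (within (cycSubgraph hc).spanningCoe Set.univ).Reachable (c 0) (c i) := by
      intro i
      obtain ⟨j, hj, h⟩ := hc.exists_nat_lt 0 i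
      rw [← h]
      exact by simpa using key Set.univ 0 n (fun _ _ => trivial) j hj
    rintro _ ⟨i, rfl⟩ _ ⟨j, rfl⟩ _ _
    exact (this i).symm.trans (this j)
  refine ⟨⟨c 0, 0, rfl⟩, hconn, fun x => ?_⟩
  by_cases hx : x ∈ Set.range c
  · obtain ⟨p, rfl⟩ := hx
    have hS : ∀ j : ℕ, j < n - 1 → c (p + 1 + j) ∈ ({c p}ᶜ : Set V) := by
      intro j hj h
      have := hc.eq_of_lt h (by omega) (by omega)
      omega
    have : ∀ i, c i ∈ ({c p}ᶜ : Set V) →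
        (within (cycSubgraph hc).spanningCoe {c p}ᶜ).Reachable (c (p + 1)) (c i) := by
      intro i hi
      obtain ⟨j, hj, h⟩ := hc.exists_nat_lt (p + 1) i
      rw [← h]
      refine key _ _ (n - 1) hS j ?_
      by_contra hjn
      refine hi ?_
      change c i = c p
      rw [← h, hc.eq_iff]
      exact ⟨1, by rw [show j = n - 1 by omega]; push_cast [show 1 ≤ n by omega]; ring⟩
    rintro _ ⟨i, rfl⟩ _ ⟨j, rfl⟩ hi hj
    exact (this i hi).symm.trans (this j hj)
  · exact hconn.of_notMem hx

theorem IsCyc.exists_isNontrivialBlock [Finite V] {n : ℕ} {c : ℤ → V} (hc : IsCyc G n c) :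
    ∃ B, PathKE.IsNontrivialBlock G B ∧ cycSubgraph hc ≤ B := by
  obtain ⟨B, hle, hB⟩ := Finite.exists_le_maximal (noCut_cycSubgraph hc)
  refine ⟨B, ⟨isBlock_iff.2 hB, ?_⟩, hle⟩
  have h1 := hc.ncard_range
  have h2 : (Set.range c).ncard ≤ B.verts.ncard := Set.ncard_le_ncard hle.1 (Set.toFinite _)
  have := hc.three_le
  omega

theorem IsCyc.of_le {B : G.Subgraph} {n : ℕ} {c : ℤ → V} (hc : IsCyc G n c)
    (h : cycSubgraph hc ≤ B) : IsCyc B.spanningCoe n c :=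
  hc.mono fun i _ => h.2 ⟨i, Or.inl ⟨rfl, rfl⟩⟩

theorem IsCyc.of_spanningCoe {B : G.Subgraph} {n : ℕ} {c : ℤ → V}
    (hc : IsCyc B.spanningCoe n c) : IsCyc G n c :=
  hc.mono fun i _ => B.adj_sub (hc.adj i)

theorem IsCyc.mem_verts {B : G.Subgraph} {n : ℕ} {c : ℤ → V}
    (hc : IsCyc B.spanningCoe n c) (i : ℤ) : c i ∈ B.verts :=
  B.edge_vert (hc.adj i)

/-! ### Cycles through given edges and vertices of a block -/

theorem NoCut.exists_adj {B : G.Subgraph} (hB : NoCut B) {a w x : V} (ha : a ∈ B.verts)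
    (hw : w ∈ B.verts) (haw : a ≠ w) (hax : a ≠ x) (hwx : w ≠ x) : ∃ z, B.Adj a z ∧ z ≠ x := by
  obtain ⟨p⟩ := hB.conn_compl x a ha w hw hax hwx
  cases p with
  | nil => exact absurd rfl haw
  | cons h p => exact ⟨_, h.1, h.2.2⟩

/-- In a connected graph with at least three vertices and no cutvertex, each edge is on a cycle. -/
theorem NoCut.exists_isCyc {B : G.Subgraph} (hB : NoCut B) (h2 : 2 < B.verts.ncard) {a b : V}
    (hab : B.Adj a b) : ∃ n c, IsCyc B.spanningCoe n c ∧ c 0 = a ∧ c 1 = b := by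
  have ha := B.edge_vert hab
  have hb := B.edge_vert (hab.symm)
  obtain ⟨w, hw, hwab⟩ : ∃ w ∈ B.verts, w ∉ ({a, b} : Set V) := by
    by_contra hcon
    push Not at hcon
    have := Set.ncard_le_ncard hcon (Set.toFinite _)
    have := (Set.ncard_insert_le a {b}).trans_eq (by rw [Set.ncard_singleton])
    omega
  have hwa : a ≠ w := fun h => hwab (Or.inl h.symm)
  have hwb : w ≠ b := fun h => hwab (Or.inr h)
  have hne : a ≠ b := (B.adj_sub hab).ne
  -- As `b` is no cutvertex, `a` has a second neighbour `z`; as `a` is none, `b` and `z` are joined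
  -- off `a`.
  obtain ⟨z, hz, hzb⟩ := hB.exists_adj ha hw hwa hne hwb
  obtain ⟨n, c, hc, h0, h1, -, -⟩ := exists_isCyc_of_reachable (G := B.spanningCoe) (S := {a}ᶜ)
    (v := a) (by simp)
    (hB.conn_compl a b hb z (B.edge_vert (hz.symm)) hne.symm (B.adj_sub hz).ne.symm)
    hne.symm hzb.symm hab hz
  exact ⟨n, c, hc, h0, h1⟩

theorem NoCut.exists_isCyc_of_mem {B : G.Subgraph} (hB : NoCut B) (h2 : 2 < B.verts.ncard) {a : V}
    (ha : a ∈ B.verts) : ∃ n c, IsCyc B.spanningCoe n c ∧ c 0 = a := by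
  obtain ⟨w, hw, hwa⟩ : ∃ w ∈ B.verts, w ≠ a := by
    by_contra hcon
    push Not at hcon
    have := Set.ncard_le_ncard (show B.verts ⊆ {a} from hcon) (Set.toFinite _)
    simp at this
    omega
  obtain ⟨p⟩ := hB.conn a ha w hw trivial trivial
  cases p with
  | nil => exact absurd rfl hwa
  | cons h p =>
    obtain ⟨n, c, hc, h0, -⟩ := hB.exists_isCyc h2 h.1
    exact ⟨n, c, hc, h0⟩

theorem le_of_maximal_noCut {B D : G.Subgraph} (hB : Maximal NoCut B) (hD : NoCut D) {p q : V}
    (hpq : p ≠ q) (hpB : p ∈ B.verts) (hpD : p ∈ D.verts) (hqB : q ∈ B.verts)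
    (hqD : q ∈ D.verts) : D ≤ B :=
  le_sup_right.trans (hB.2 (hB.1.sup hD hpq hpB hpD hqB hqD) le_sup_left)

/-! ### Branch vertices of a block -/

/-- A position outside the class `X` has distance at most `h` to it on one side, so a pendant path
of that length gives a `k`-path missing `X`. -/
theorem IsCycCover.mem_of_isPend [Finite V] {k h n : ℕ} {c : ℤ → V} {X : Set V}
    (hX : IsCycCover G k n c X) (hc : IsCyc G n c) (hkh : k = 2 * h + 1) {p : ℤ} {l : List V}
    (hl : IsPend G c p l) (hlen : h ≤ l.length) : c p ∈ X := by
  have hk : 0 < k := by omega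
  obtain ⟨r, hr⟩ := hX.spaced hk hc
  by_contra hp
  obtain ⟨t, htk, ht⟩ := exists_offset_mod hk p r
  have h0 : 0 < t := by
    rcases Nat.eq_zero_or_pos t with rfl | h0
    · exact absurd ((hr p).2 (by simpa using ht)) hp
    · exact h0
  obtain ⟨δ, l', h1, hδ, hlδ, hl', hd⟩ := exists_pend_of_le hkh hl h0 htk ht (by omega)
  have hkn : k ≤ n := Nat.le_of_dvd (by have := hc.three_le; omega) hX.dvd
  obtain ⟨T, hT, hpT, hTv⟩ := hl'.exists_isKSet hc hkn (by omega) (by omega) (hlδ ▸ hd)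
  obtain ⟨v, hvT, hvX⟩ := hX.inter_nonempty T hT ⟨_, hpT, p, rfl⟩
  rcases hTv v hvT with hv | ⟨j, rfl, hj⟩
  · exact hl'.notMem v hv (hX.subset hvX)
  · exact hj ((hr j).1 hvX)

theorem CycCoverable.dvd {k : ℕ} (h : CycCoverable G k) {n : ℕ} {c : ℤ → V} (hc : IsCyc G n c) :
    k ∣ n := by
  obtain ⟨X, hX⟩ := h n c hc
  exact hX.dvd

/-- A vertex of a cycle in `B` with a further neighbour in `B` is in every cover of that cycle. -/
theorem IsCycCover.mem_of_adj [Finite V] {k n : ℕ} (hk : Odd k) (hG : CycCoverable G k)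
    {B : G.Subgraph} (hB : NoCut B) {c : ℤ → V} (hc : IsCyc B.spanningCoe n c) {X : Set V}
    (hX : IsCycCover G k n c X) {p : ℤ} {u : V} (hu : B.Adj (c p) u) (h1 : u ≠ c (p + 1))
    (h2 : u ≠ c (p - 1)) : c p ∈ X := by
  have hc' := hc.of_spanningCoe
  obtain ⟨h, hkh⟩ := id hk
  rcases Nat.eq_zero_or_pos h with rfl | hh
  · obtain ⟨r, hr⟩ := hX.spaced hk.pos hc'
    exact (hr p).2 (by simp [hkh])
  have hD : ∀ n c, IsCyc G n c → k ∣ n := fun n c hc => hG.dvd hc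
  have hur : u ∉ Set.range c := by
    rintro ⟨b, rfl⟩
    rcases hc'.eq_of_adj hk (by omega) hD (B.adj_sub hu) with h | h
    · exact h1 h
    · exact h2 h
  -- Since `c p` does not cut `B`, the extra neighbour `u` starts an ear back to the cycle. Its
  -- length is a multiple of `k`, so it contains a pendant path with at least `k - 1 ≥ h` vertices.
  obtain ⟨l, hl, hlS, hhead, hlast⟩ := exists_pathList_of_reachable
    (hB.conn_compl (c p) u (B.edge_vert hu.symm) (c (p + 1)) (hc.mem_verts _)
      (B.adj_sub hu).ne.symm (hc.adj p).ne.symm) (B.adj_sub hu).ne.symm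
  obtain ⟨l₁, z, l₂, rfl, ⟨b, rfl⟩, hout⟩ := exists_first_mem (S := Set.range c)
    ⟨_, List.mem_of_getLast? hlast, p + 1, rfl⟩
  have hne : l₁ ≠ [] := by
    rintro rfl
    exact hur ⟨b, Option.some.inj hhead⟩
  have hpath : IsPathList G (c p :: (l₁ ++ [c b])) := by
    have h3 : IsPathList G (l₁ ++ [c b]) :=
      (hl.mono B.spanningCoe_le).infix ⟨[], l₂, by simp⟩
    refine ⟨List.isChain_cons.2 ⟨fun y hy => ?_, h3.chain⟩, List.nodup_cons.2 ⟨fun hp => ?_, h3.nodup⟩⟩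
    · rw [List.head?_append_of_ne_nil _ hne] at hy hhead
      rw [Option.mem_def, hhead] at hy
      rw [← Option.some.inj hy]
      exact B.adj_sub hu
    · refine hlS (c p) ?_ rfl
      rw [List.mem_append, List.mem_singleton] at hp
      rcases hp with hp | hp
      · simp [hp]
      · simp [hp]
  have hne' : c p ≠ c b := fun h => hlS (c b) (by simp) h.symm
  obtain ⟨hdvd, -⟩ := hc'.dvd_ear hk hD hne' hpath hout hne
  have := Nat.le_of_dvd (by omega) hdvd
  exact hX.mem_of_isPend hc' hkh (l := l₁) ⟨hpath.infix ⟨[], [c b], by simp⟩, hout⟩ (by omega)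

theorem eq_or_eq_of_forall_adj {B : G.Subgraph} {n : ℕ} {c : ℤ → V} (hc : IsCyc B.spanningCoe n c)
    {p : ℤ} (h : ∃ a b, ∀ u, B.Adj (c p) u → u = a ∨ u = b) {u : V} (hu : B.Adj (c p) u) :
    u = c (p + 1) ∨ u = c (p - 1) := by
  obtain ⟨a, b, hab⟩ := h
  have hne : c (p + 1) ≠ c (p - 1) := fun h => by
    have := hc.three_le
    have := hc.eq_of_lt h (by omega) (by omega)
    omega
  have h1 := hab _ (hc.adj p)
  have h2 := hab _ (hc.adj_sub p)
  have h3 := hab _ hu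
  grind

/-- Two cycles that start with the same edge agree as long as there is no branching. -/
theorem IsCyc.agree {B : G.Subgraph} {n' : ℕ} {c c' : ℤ → V}
    (hc' : IsCyc B.spanningCoe n' c') (h0 : c 0 = c' 0) (h1 : c 1 = c' 1) {m : ℕ}
    (hm : ∀ i : ℕ, 0 < i → i < m → ∀ u, B.Adj (c i) u → u = c (i + 1) ∨ u = c (i - 1)) :
    ∀ i : ℕ, i ≤ m → c i = c' i := by
  intro i
  induction i using Nat.strong_induction_on with
  | _ i ih =>
    intro hi
    match i with
    | 0 => exact h0
    | 1 => exact h1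
    | i + 2 =>
      have e0 := ih i (by omega) (by omega)
      have e1 := ih (i + 1) (by omega) (by omega)
      have hadj : B.Adj (c (i + 1 : ℕ)) (c' ((i + 1 : ℕ) + 1)) := by
        rw [e1]; exact hc'.adj _
      rcases hm (i + 1) (by omega) (by omega) _ hadj with h | h
      · rw [show ((i + 2 : ℕ) : ℤ) = (i + 1 : ℕ) + 1 by push_cast; ring, h]
      · have h4 : c' ((i + 1 : ℕ) + 1) = c' i := by
          rw [h, ← e0]; congr 1; push_cast; ring
        have := hc'.three_le
        have := hc'.eq_of_lt h4 (by push_cast; omega) (by push_cast; omega)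
        push_cast at this
        omega

theorem exists_branch_or_range_eq {B : G.Subgraph} (hB : NoCut B) {n : ℕ} {c : ℤ → V}
    (hc : IsCyc B.spanningCoe n c) :
    (∃ p, ¬ ∃ a b, ∀ u, B.Adj (c p) u → u = a ∨ u = b) ∨ Set.range c = B.verts := by
  by_cases h : ∃ p, ¬ ∃ a b, ∀ u, B.Adj (c p) u → u = a ∨ u = b
  · exact Or.inl h
  · right
    push Not at h
    refine Set.Subset.antisymm (by rintro _ ⟨i, rfl⟩; exact hc.mem_verts i) fun v hv => ?_
    refine mem_of_reachable (hB.conn (c 0) (hc.mem_verts 0) v hv trivial trivial) ⟨0, rfl⟩ ?_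
    rintro _ ⟨p, rfl⟩ y - - hy
    rcases eq_or_eq_of_forall_adj hc (h p) hy with rfl | rfl
    · exact ⟨_, rfl⟩
    · exact ⟨_, rfl⟩

theorem IsCycCover.neg {k n : ℕ} {c : ℤ → V} {X : Set V} (h : IsCycCover G k n c X) :
    IsCycCover G k n (fun i => c (-i)) X := by
  refine ⟨?_, h.card_eq, ?_⟩
  · rw [IsCyc.range_neg]; exact h.subset
  · rw [IsCyc.range_neg]; exact h.inter_nonempty

theorem IsCycCover.shift {k n : ℕ} {c : ℤ → V} {X : Set V} (h : IsCycCover G k n c X) (a : ℤ) :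
    IsCycCover G k n (fun i => c (a + i)) X := by
  refine ⟨?_, h.card_eq, ?_⟩
  · rw [IsCyc.range_shift]; exact h.subset
  · rw [IsCyc.range_shift]; exact h.inter_nonempty

/-- The two cycles run together up to the first branch vertex, which is in both covers. Both covers
are residue classes, so they agree at the common start as well. -/
theorem IsCycCover.mem_of_mem_aux [Finite V] {k n n' : ℕ} (hk : Odd k) (hG : CycCoverable G k)
    {B : G.Subgraph} (hB : NoCut B) {c c' : ℤ → V} (hc : IsCyc B.spanningCoe n c)
    (hc' : IsCyc B.spanningCoe n' c') {X X' : Set V} (hX : IsCycCover G k n c X)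
    (hX' : IsCycCover G k n' c' X') (h0 : c 0 = c' 0) (h1 : c 1 = c' 1)
    (hbr : ∃ p, ¬ ∃ a b, ∀ u, B.Adj (c p) u → u = a ∨ u = b) (hmem : c' 0 ∈ X') : c 0 ∈ X := by
  classical
  have hmemX : ∀ (n : ℕ) (c : ℤ → V) (X : Set V), IsCyc B.spanningCoe n c → IsCycCover G k n c X →
      ∀ p, (¬ ∃ a b, ∀ u, B.Adj (c p) u → u = a ∨ u = b) → c p ∈ X := by
    intro n c X hc hX p hp
    push Not at hp
    obtain ⟨u, hu, hu1, hu2⟩ := hp (c (p + 1)) (c (p - 1))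
    exact hX.mem_of_adj hk hG hB hc hu hu1 hu2
  obtain ⟨r, hr⟩ := hX.spaced hk.pos hc.of_spanningCoe
  obtain ⟨r', hr'⟩ := hX'.spaced hk.pos hc'.of_spanningCoe
  have hex : ∃ m : ℕ, ¬ ∃ a b, ∀ u, B.Adj (c m) u → u = a ∨ u = b := by
    obtain ⟨p, hp⟩ := hbr
    obtain ⟨m, -, hm⟩ := hc.exists_nat_lt 0 p
    refine ⟨m, ?_⟩
    rw [zero_add] at hm
    rwa [hm]
  have hm := Nat.find_spec hex
  set m := Nat.find hex
  have hag := hc'.agree h0 h1 (m := m)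
    (fun i _ hi u hu => eq_or_eq_of_forall_adj hc (not_not.1 (Nat.find_min hex hi)) hu) m le_rfl
  have e1 := (hr m).1 (hmemX n c X hc hX m hm)
  have e2 := (hr' m).1 (hmemX n' c' X' hc' hX' m (by rwa [← hag]))
  have e3 := (hr' 0).1 hmem
  rw [hr]
  rw [show (0 : ℤ) - r = 0 - r' - (m - r') + (m - r) by ring]
  exact dvd_add (dvd_sub e3 e2) e1

theorem IsCycCover.mem_of_mem [Finite V] {k n n' : ℕ} (hk : Odd k) (hG : CycCoverable G k)
    {B : G.Subgraph} (hB : NoCut B) {c c' : ℤ → V} (hc : IsCyc B.spanningCoe n c)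
    (hc' : IsCyc B.spanningCoe n' c') {X X' : Set V} (hX : IsCycCover G k n c X)
    (hX' : IsCycCover G k n' c' X')
    (hbr : ∃ p, ¬ ∃ a b, ∀ u, B.Adj (c p) u → u = a ∨ u = b) {v : V} (hv : v ∈ X')
    (hvc : v ∈ Set.range c) : v ∈ X := by
  obtain ⟨j, rfl⟩ := hX'.subset hv
  obtain ⟨i, hi⟩ := hvc
  rw [← hi]
  have hc1 := hc.shift i
  have hc1' := hc'.shift j
  have hbr1 : ∃ p, ¬ ∃ a b, ∀ u, B.Adj (c (i + p)) u → u = a ∨ u = b := by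
    obtain ⟨p, hp⟩ := hbr
    exact ⟨p - i, by rwa [add_sub_cancel]⟩
  by_cases hadj : ∃ a b, ∀ u, B.Adj (c i) u → u = a ∨ u = b
  · have h1 : B.Adj (c i) (c' (j + 1)) := by rw [hi]; exact hc'.adj j
    rcases eq_or_eq_of_forall_adj hc hadj h1 with h | h
    · have := (hX.shift i).mem_of_mem_aux hk hG hB hc1 hc1' (hX'.shift j) (by simpa using hi)
        h.symm hbr1 (by simpa using hv)
      simpa using this
    · have := (hX.shift i).neg.mem_of_mem_aux hk hG hB hc1.neg hc1' (hX'.shift j)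
        (by simpa using hi) (by simpa [sub_eq_add_neg] using h.symm)
        (by obtain ⟨p, hp⟩ := hbr1; exact ⟨-p, by simpa using hp⟩) (by simpa using hv)
      simpa using this
  · push Not at hadj
    obtain ⟨u, hu, hu1, hu2⟩ := hadj (c (i + 1)) (c (i - 1))
    exact hX.mem_of_adj hk hG hB hc hu hu1 hu2

/-- The set `W` covers all cycles of `B` in the sense of `IsCycCover`. -/
structure IsHub (k : ℕ) (B : G.Subgraph) (W : Set V) : Prop where
  subset : W ⊆ B.verts
  cover : ∀ n c, IsCyc B.spanningCoe n c → IsCycCover G k n c (W ∩ Set.range c)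

theorem exists_isHub [Finite V] {k : ℕ} (hk : Odd k) (hG : CycCoverable G k) {B : G.Subgraph}
    (hB : NoCut B) : ∃ W, IsHub k B W := by
  by_cases hbr : ∀ n c, IsCyc B.spanningCoe n c →
    ∃ p, ¬ ∃ a b, ∀ u, B.Adj (c p) u → u = a ∨ u = b
  -- With a branch vertex on every cycle, covers of different cycles agree on common vertices, so
  -- their union is taken.
  · refine ⟨{v | ∃ n c X, IsCyc B.spanningCoe n c ∧ IsCycCover G k n c X ∧ v ∈ X}, ?_, ?_⟩
    · rintro v ⟨n, c, X, hc, hX, hv⟩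
      obtain ⟨i, rfl⟩ := hX.subset hv
      exact hc.mem_verts i
    · intro n c hc
      obtain ⟨X, hX⟩ := hG n c hc.of_spanningCoe
      convert hX using 1
      ext v
      constructor
      · rintro ⟨⟨n', c', X', hc', hX', hv⟩, hvc⟩
        exact hX.mem_of_mem hk hG hB hc hc' hX' (hbr n c hc) hv hvc
      · exact fun hv => ⟨⟨n, c, X, hc, hX, hv⟩, hX.subset hv⟩
  -- A cycle without branch vertices is all of `B`. Its cover need not be unique, so one is fixed
  -- for every cycle of `B`.
  · push Not at hbr
    obtain ⟨n, c, hc, hn⟩ := hbr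
    have hrange : ∀ n' c', IsCyc B.spanningCoe n' c' → Set.range c' = B.verts := by
      intro n' c' hc'
      have h1 : Set.range c = B.verts :=
        (exists_branch_or_range_eq hB hc).resolve_left fun ⟨p, hp⟩ => hp (hn p)
      refine (exists_branch_or_range_eq hB hc').resolve_left fun ⟨p, hp⟩ => hp ?_
      obtain ⟨q, hq⟩ : c' p ∈ Set.range c := h1 ▸ hc'.mem_verts p
      rw [← hq]
      exact hn q
    obtain ⟨X, hX⟩ := hG n c hc.of_spanningCoe
    refine ⟨X, hrange n c hc ▸ hX.subset, fun n' c' hc' => ?_⟩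
    have he : Set.range c' = Set.range c := (hrange _ _ hc').trans (hrange _ _ hc).symm
    rw [he, Set.inter_eq_left.2 hX.subset]
    refine ⟨he ▸ hX.subset, ?_, he ▸ hX.inter_nonempty⟩
    rw [hX.card_eq, ← hc.ncard_range, ← hc'.ncard_range, he]

theorem IsHub.eq_or_eq [Finite V] {k : ℕ} {B : G.Subgraph} {W : Set V} (hW : IsHub k B W)
    (hk : Odd k) (hG : CycCoverable G k) (hB : NoCut B) {n : ℕ} {c : ℤ → V}
    (hc : IsCyc B.spanningCoe n c) {p : ℤ} (hp : c p ∉ W) {u : V} (hu : B.Adj (c p) u) :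
    u = c (p + 1) ∨ u = c (p - 1) := by
  by_contra hcon
  push Not at hcon
  exact hp ((hW.cover n c hc).mem_of_adj hk hG hB hc hu hcon.1 hcon.2).1

/-! ### Recognizing subdivisions -/

/-- Every edge of `B` is on a cycle, the vertices of `W` are spaced at distance `k` along each cycle,
and the vertices outside `W` have degree two in `B`. -/
structure IsSkeleton (k : ℕ) (B : G.Subgraph) (W : Set V) : Prop where
  subset : W ⊆ B.verts
  exists_isCyc : ∀ a b, B.Adj a b → ∃ n c, IsCyc B.spanningCoe n c ∧ c 0 = a ∧ c 1 = b
  exists_adj : ∀ a ∈ B.verts, ∃ b, B.Adj a b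
  spaced : ∀ n c, IsCyc B.spanningCoe n c → ∃ r : ℤ, ∀ j, c j ∈ W ↔ (k : ℤ) ∣ j - r
  eq_or_eq : ∀ n c, IsCyc B.spanningCoe n c → ∀ p, c p ∉ W → ∀ u, B.Adj (c p) u →
    u = c (p + 1) ∨ u = c (p - 1)

theorem IsHub.isSkeleton [Finite V] {k : ℕ} {B : G.Subgraph} {W : Set V} (hW : IsHub k B W)
    (hk : Odd k) (hG : CycCoverable G k) (hB : NoCut B) (h2 : 2 < B.verts.ncard) :
    IsSkeleton k B W where
  subset := hW.subset
  exists_isCyc a b hab := hB.exists_isCyc h2 hab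
  exists_adj a ha := by
    obtain ⟨n, c, hc, rfl⟩ := hB.exists_isCyc_of_mem h2 ha
    exact ⟨_, hc.adj 0⟩
  spaced n c hc := by
    obtain ⟨r, hr⟩ := (hW.cover n c hc).spaced hk.pos hc.of_spanningCoe
    exact ⟨r, fun j => by rw [← hr]; simp⟩
  eq_or_eq n c hc p hp u hu := hW.eq_or_eq hk hG hB hc hp hu

/-- `d` is an oriented edge of `B` that starts in `W`. -/
def IsDart (B : G.Subgraph) (W : Set V) (d : V × V) : Prop := d.1 ∈ W ∧ B.Adj d.1 d.2

/-- `th` associates with each dart a cycle that starts with this dart. -/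
structure IsThreading (B : G.Subgraph) (W : Set V) (th : V × V → ℤ → V) : Prop where
  isCyc : ∀ d, IsDart B W d → ∃ n, IsCyc B.spanningCoe n (th d)
  zero : ∀ d, IsDart B W d → th d 0 = d.1
  one : ∀ d, IsDart B W d → th d 1 = d.2

theorem IsSkeleton.exists_isThreading {k : ℕ} {B : G.Subgraph} {W : Set V}
    (hS : IsSkeleton k B W) : ∃ th, IsThreading B W th := by
  have : ∀ d, ∃ c : ℤ → V, IsDart B W d →
      (∃ n, IsCyc B.spanningCoe n c) ∧ c 0 = d.1 ∧ c 1 = d.2 := by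
    intro d
    by_cases hd : IsDart B W d
    · obtain ⟨n, c, hc, h⟩ := hS.exists_isCyc _ _ hd.2
      exact ⟨c, fun _ => ⟨⟨n, hc⟩, h⟩⟩
    · exact ⟨fun _ => d.1, fun h => absurd h hd⟩
  choose th hth using this
  exact ⟨th, fun d hd => (hth d hd).1, fun d hd => (hth d hd).2.1, fun d hd => (hth d hd).2.2⟩

/-! ### Threads between vertices of `W` and the multigraph they form -/

namespace IsThreading

variable {k : ℕ} {B : G.Subgraph} {W : Set V} {th : V × V → ℤ → V}

theorem adj (hT : IsThreading B W th) {d : V × V} (hd : IsDart B W d) (i : ℤ) :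
    B.Adj (th d i) (th d (i + 1)) := by
  obtain ⟨n, hc⟩ := hT.isCyc d hd
  exact hc.adj i

theorem mem_iff (hT : IsThreading B W th) (hS : IsSkeleton k B W) {d : V × V}
    (hd : IsDart B W d) (i : ℤ) : th d i ∈ W ↔ (k : ℤ) ∣ i := by
  obtain ⟨n, hc⟩ := hT.isCyc d hd
  obtain ⟨r, hr⟩ := hS.spaced n _ hc
  have h0 := (hr 0).1 (by rw [hT.zero d hd]; exact hd.1)
  rw [hr]
  constructor
  · intro h
    have := dvd_sub h h0
    simpa using this
  · intro h
    have := dvd_add h h0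
    simpa [sub_eq_add_neg] using this

theorem notMem (hT : IsThreading B W th) (hS : IsSkeleton k B W) {d : V × V}
    (hd : IsDart B W d) {i : ℤ} (h0 : 0 < i) (h1 : i < k) : th d i ∉ W := by
  rw [hT.mem_iff hS hd]
  intro h
  have := Int.le_of_dvd h0 h
  omega

/-- The chosen cycle does not matter: inner vertices of a thread have degree two in `B`, so the dart
determines the first `k` steps. -/
theorem eq_of_isCyc (hT : IsThreading B W th) (hS : IsSkeleton k B W) {d : V × V}
    (hd : IsDart B W d) {n : ℕ} {c : ℤ → V} (hc : IsCyc B.spanningCoe n c) (h0 : c 0 = d.1)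
    (h1 : c 1 = d.2) {i : ℕ} (hi : i ≤ k) : th d i = c i := by
  obtain ⟨m, hm⟩ := hT.isCyc d hd
  refine hc.agree (by rw [hT.zero d hd, h0]) (by rw [hT.one d hd, h1]) (m := k) ?_ i hi
  intro i h0 h1 u hu
  exact hS.eq_or_eq m _ hm _ (hT.notMem hS hd (by omega) (by omega)) u hu

/-- The thread of `d` traversed backwards. -/
def rev (k : ℕ) (th : V × V → ℤ → V) (d : V × V) : V × V := (th d k, th d (k - 1))

theorem isDart_rev (hT : IsThreading B W th) (hS : IsSkeleton k B W) {d : V × V}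
    (hd : IsDart B W d) : IsDart B W (rev k th d) := by
  refine ⟨(hT.mem_iff hS hd _).2 dvd_rfl, ?_⟩
  have := (hT.adj hd (k - 1)).symm
  rwa [sub_add_cancel] at this

theorem apply_rev (hT : IsThreading B W th) (hS : IsSkeleton k B W) {d : V × V}
    (hd : IsDart B W d) {i : ℕ} (hi : i ≤ k) : th (rev k th d) i = th d (k - i) := by
  obtain ⟨n, hc⟩ := hT.isCyc d hd
  refine hT.eq_of_isCyc hS (hT.isDart_rev hS hd) (n := n) (c := fun i => th d (k - i)) ?_ ?_ ?_ hi
  · have := (hc.shift k).neg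
    simpa [sub_eq_add_neg] using this
  · simp [rev]
  · simp [rev]

theorem rev_rev (hT : IsThreading B W th) (hS : IsSkeleton k B W) (hk : 0 < k) {d : V × V}
    (hd : IsDart B W d) : rev k th (rev k th d) = d := by
  refine Prod.ext ?_ ?_
  · change th (rev k th d) k = _
    rw [hT.apply_rev hS hd le_rfl, sub_self, hT.zero d hd]
  · change th (rev k th d) (k - 1) = _
    have := hT.apply_rev hS hd (Nat.sub_le k 1)
    rw [Nat.cast_sub hk, Nat.cast_one, sub_sub_cancel, hT.one d hd] at this
    exact this

/-- For odd `k` a thread has a middle edge, whose two ends would coincide if the thread were its own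
reverse. -/
theorem rev_ne (hT : IsThreading B W th) (hS : IsSkeleton k B W) (hk : Odd k) {d : V × V}
    (hd : IsDart B W d) : rev k th d ≠ d := by
  intro h
  obtain ⟨m, hm⟩ := hk
  have h1 := hT.apply_rev hS hd (i := m) (by omega)
  rw [h, show (k : ℤ) - m = m + 1 by omega] at h1
  exact (B.adj_sub (hT.adj hd m)).ne h1

/-- Going backwards from the common edge, the threads agree down to the start of `d`. That vertex is
in `W` and has position `i' - i` on the cycle of `d'`, so `k` divides `i' - i`. -/
theorem eq_and_eq (hT : IsThreading B W th) (hS : IsSkeleton k B W) {d d' : V × V}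
    (hd : IsDart B W d) (hd' : IsDart B W d') {i i' : ℕ} (hi : i < k) (hi' : i' < k)
    (h0 : th d i = th d' i') (h1 : th d (i + 1) = th d' (i' + 1)) : d = d' ∧ i = i' := by
  obtain ⟨n, hc⟩ := hT.isCyc d hd
  obtain ⟨n', hc'⟩ := hT.isCyc d' hd'
  have hc1' := (hc'.shift (i' + 1)).neg
  have key := hc1'.agree (c := fun t => th d (i + 1 + -t)) (by simpa using h1) (by simpa using h0)
    (m := i + 1) (by
      intro t ht hti u hu
      rcases hS.eq_or_eq n _ hc _ (hT.notMem hS hd (by omega) (by omega)) u hu with h | h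
      · right; rw [h]; ring_nf
      · left; rw [h]; ring_nf)
  have e1 := key (i + 1) le_rfl
  have e2 := key i (by omega)
  rw [show ((i : ℤ) + 1 + -((i + 1 : ℕ) : ℤ)) = 0 by push_cast; ring] at e1
  rw [show ((i : ℤ) + 1 + -(i : ℤ)) = 1 by ring] at e2
  have h3 : th d' (i' + 1 + -((i + 1 : ℕ) : ℤ)) ∈ W := by
    rw [← e1, hT.zero d hd]; exact hd.1
  rw [hT.mem_iff hS hd', show ((i' : ℤ) + 1 + -((i + 1 : ℕ) : ℤ)) = i' - i by push_cast; ring] at h3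
  have h4 := Int.eq_zero_of_abs_lt_dvd h3 (by rw [abs_lt]; omega)
  obtain rfl : i = i' := by omega
  refine ⟨Prod.ext ?_ ?_, rfl⟩
  · rw [← hT.zero d hd, ← hT.zero d' hd', e1]; congr 1; push_cast; ring
  · rw [← hT.one d hd, ← hT.one d' hd', e2]; congr 1; ring

theorem eq_rev (hT : IsThreading B W th) (hS : IsSkeleton k B W) {d d' : V × V}
    (hd : IsDart B W d) (hd' : IsDart B W d') {i i' : ℕ} (hi : i < k) (hi' : i' < k)
    (h0 : th d i = th d' (i' + 1)) (h1 : th d (i + 1) = th d' i') : d = rev k th d' := by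
  refine (hT.eq_and_eq hS hd (hT.isDart_rev hS hd') hi (i' := k - 1 - i') (by omega) ?_ ?_).1
  · rw [h0, hT.apply_rev hS hd' (by omega)]
    congr 1; omega
  · have := hT.apply_rev hS hd' (i := k - 1 - i' + 1) (by omega)
    rw [h1]
    push_cast at this ⊢
    rw [this]
    congr 1; omega

theorem exists_dart (hT : IsThreading B W th) (hS : IsSkeleton k B W) (hk : 0 < k) {x y : V}
    (hxy : B.Adj x y) : ∃ d, IsDart B W d ∧ ∃ i : ℕ, i < k ∧ th d i = x ∧ th d (i + 1) = y := by
  obtain ⟨n, c, hc, rfl, rfl⟩ := hS.exists_isCyc x y hxy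
  obtain ⟨r, hr⟩ := hS.spaced n c hc
  obtain ⟨t, htk, ht⟩ := exists_offset_mod hk 0 r
  have hd : IsDart B W (c (-t), c (-t + 1)) := ⟨(hr _).2 (by simpa using ht), hc.adj _⟩
  have key := fun i => hT.eq_of_isCyc hS hd (i := i) (hc.shift (-t)) (by simp) rfl
  refine ⟨_, hd, t, htk, ?_, ?_⟩
  · rw [key t htk.le]; simp
  · have := key (t + 1) htk
    push_cast at this
    rw [this]; simp

/-- The multigraph on `W` with edges given by a set `O` of darts. -/
def multigraph (hT : IsThreading B W th) (hS : IsSkeleton k B W) (O : Set (V × V))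
    (hO : ∀ d ∈ O, IsDart B W d) : Graph V (V × V) where
  vertexSet := W
  edgeSet := O
  IsLink d x y := d ∈ O ∧ s(x, y) = s(d.1, th d k)
  isLink_symm d _ := ⟨fun x y h => ⟨h.1, by rw [Sym2.eq_swap]; exact h.2⟩⟩
  eq_or_eq_of_isLink_of_isLink d x y z w h1 h2 := by
    have h3 := h1.2.trans h2.2.symm
    rw [Sym2.eq_iff] at h3
    exact h3.imp And.left And.left
  edge_mem_iff_exists_isLink d := ⟨fun hd => ⟨_, _, hd, rfl⟩, fun ⟨_, _, hd⟩ => hd.1⟩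
  left_mem_of_isLink d x y h := by
    have h3 := Sym2.eq_iff.1 h.2
    rcases h3 with h3 | h3
    · rw [h3.1]; exact (hO d h.1).1
    · rw [h3.1]; exact (hT.isDart_rev hS (hO d h.1)).1

/-- The vertex of `B` corresponding to a vertex of the subdivision. -/
def toVert (th : V × V → ℤ → V) : V ⊕ (V × V) × ℕ → V
  | Sum.inl w => w
  | Sum.inr (d, i) => th d i

theorem toVert_subPos (hT : IsThreading B W th) (hk : 0 < k) {d : V × V} (hd : IsDart B W d)
    (i : ℕ) : toVert th (PathKE.subPos k Prod.fst (fun d => th d k) d i) = th d i := by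
  unfold PathKE.subPos
  split_ifs with h0 hik
  · subst h0; exact (hT.zero d hd).symm
  · subst hik; rfl
  · rfl

variable {O : Set (V × V)} {hO : ∀ d ∈ O, IsDart B W d}

theorem isOrientation (hT : IsThreading B W th) (hS : IsSkeleton k B W) :
    PathKE.IsOrientation (hT.multigraph hS O hO) Prod.fst (fun d => th d k) :=
  fun _ hd => ⟨hd, rfl⟩

theorem injOn_toVert (hT : IsThreading B W th) (hS : IsSkeleton k B W)
    (hrev : ∀ d ∈ O, rev k th d ∉ O) :
    Set.InjOn (toVert th) (PathKE.subVerts k (hT.multigraph hS O hO)) := by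
  rintro p (⟨x, hx, rfl⟩ | ⟨d, hd, i, h0, hik, rfl⟩) q (⟨y, hy, rfl⟩ | ⟨d', hd', i', h0', hik', rfl⟩) h
  · exact congrArg Sum.inl h
  · have h : x = th d' i' := h
    exact absurd (h ▸ hx) (hT.notMem hS (hO _ hd') (by omega) (by omega))
  · have h : th d i = y := h
    exact absurd (h ▸ hy) (hT.notMem hS (hO _ hd) (by omega) (by omega))
  · have h : th d i = th d' i' := h
    obtain ⟨n, hc⟩ := hT.isCyc d (hO d hd)
    obtain ⟨n', hc'⟩ := hT.isCyc d' (hO d' hd')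
    have hadj : B.Adj (th d' i') (th d (i + 1)) := h ▸ hc.adj i
    rcases hS.eq_or_eq _ _ hc' _ (hT.notMem hS (hO _ hd') (by omega) (by omega)) _ hadj with h1 | h1
    · obtain ⟨rfl, rfl⟩ := hT.eq_and_eq hS (hO _ hd) (hO _ hd') hik hik' h h1
      rfl
    · have := hT.eq_rev hS (hO _ hd) (hO _ hd') hik (i' := i' - 1) (by omega)
        (by rw [h]; congr 1; omega) (by rw [h1]; congr 1; omega)
      exact absurd (this ▸ hd) (hrev _ hd')

theorem simple_sub (hT : IsThreading B W th) (hS : IsSkeleton k B W) (hk : 0 < k)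
    (hrev : ∀ d ∈ O, rev k th d ∉ O) :
    (PathKE.Sub k (hT.multigraph hS O hO) _ _ (hT.isOrientation hS)).Simple := by
  refine { not_isLoopAt := ?_, eq_of_isLink := ?_ }
  · rintro ⟨d, i⟩ x ⟨⟨hd, hi⟩, h⟩
    have hd' := hO d hd
    have h3 : PathKE.subPos k Prod.fst (fun d => th d k) d i =
        PathKE.subPos k Prod.fst (fun d => th d k) d (i + 1) := by
      rcases Sym2.eq_iff.1 h with ⟨h1, h2⟩ | ⟨h1, h2⟩
      · exact h1.symm.trans h2
      · exact h2.symm.trans h1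
    replace h3 := congrArg (toVert th) h3
    rw [hT.toVert_subPos hk hd', hT.toVert_subPos hk hd'] at h3
    exact (B.adj_sub (hT.adj hd' i)).ne (by simpa using h3)
  · rintro ⟨d, i⟩ ⟨d', i'⟩ x y ⟨⟨hd, hi⟩, h⟩ ⟨⟨hd', hi'⟩, h'⟩
    have h3 := congrArg (Sym2.map (toVert th)) (h.symm.trans h')
    simp only [Sym2.map_mk, hT.toVert_subPos hk (hO d hd), hT.toVert_subPos hk (hO d' hd')] at h3
    rcases Sym2.eq_iff.1 h3 with ⟨h4, h5⟩ | ⟨h4, h5⟩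
    · obtain ⟨rfl, rfl⟩ := hT.eq_and_eq hS (hO _ hd) (hO _ hd') hi hi' h4 (by exact_mod_cast h5)
      rfl
    · have := hT.eq_rev hS (hO _ hd) (hO _ hd') hi hi' (by exact_mod_cast h4) (by exact_mod_cast h5)
      exact absurd (this ▸ hd) (hrev _ hd')

theorem toVert_mem (hT : IsThreading B W th) (hS : IsSkeleton k B W) {p : V ⊕ (V × V) × ℕ}
    (hp : p ∈ PathKE.subVerts k (hT.multigraph hS O hO)) : toVert th p ∈ B.verts := by
  rcases hp with ⟨x, hx, rfl⟩ | ⟨d, hd, i, -, -, rfl⟩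
  · exact hS.subset hx
  · exact B.edge_vert (hT.adj (hO d hd) i)

theorem exists_isLink (hT : IsThreading B W th) (hS : IsSkeleton k B W) (hk : 0 < k)
    (hcov : ∀ d, IsDart B W d → d ∈ O ∨ rev k th d ∈ O) {x y : V} (hxy : B.Adj x y) :
    ∃ d ∈ O, ∃ i : ℕ, i < k ∧ s(th d i, th d (i + 1 : ℕ)) = s(x, y) := by
  obtain ⟨d, hd, i, hik, rfl, rfl⟩ := hT.exists_dart hS hk hxy
  rcases hcov d hd with hdO | hdO
  · exact ⟨d, hdO, i, hik, by push_cast; rfl⟩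
  · refine ⟨_, hdO, k - 1 - i, by omega, ?_⟩
    rw [hT.apply_rev hS hd (by omega), hT.apply_rev hS hd (by omega), Sym2.eq_swap]
    congr 2 <;> omega

theorem exists_toVert_eq (hT : IsThreading B W th) (hS : IsSkeleton k B W) (hk : 0 < k)
    (hcov : ∀ d, IsDart B W d → d ∈ O ∨ rev k th d ∈ O) {x : V} (hx : x ∈ B.verts) :
    ∃ p ∈ PathKE.subVerts k (hT.multigraph hS O hO), toVert th p = x := by
  obtain ⟨y, hxy⟩ := hS.exists_adj x hx
  obtain ⟨d, hd, i, hik, h⟩ := hT.exists_isLink hS hk hcov hxy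
  have hmem := fun j hj => PathKE.subPos_mem k (hT.multigraph hS O hO) _ _
    (hT.isOrientation hS) hd (i := j) hj
  rcases Sym2.eq_iff.1 h with ⟨h, -⟩ | ⟨-, h⟩
  · exact ⟨_, hmem i hik.le, by rw [hT.toVert_subPos hk (hO d hd), h]⟩
  · exact ⟨_, hmem (i + 1) hik, by rw [hT.toVert_subPos hk (hO d hd), h]⟩

theorem adj_toVert_iff (hT : IsThreading B W th) (hS : IsSkeleton k B W) (hk : 0 < k)
    (hrev : ∀ d ∈ O, rev k th d ∉ O) (hcov : ∀ d, IsDart B W d → d ∈ O ∨ rev k th d ∈ O)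
    (p q : (PathKE.Sub k (hT.multigraph hS O hO) _ _ (hT.isOrientation hS)).vertexSet) :
    B.Adj (toVert th p) (toVert th q) ↔
      (PathKE.Sub k (hT.multigraph hS O hO) _ _ (hT.isOrientation hS)).toSimpleGraph.Adj p q := by
  have hinj := hT.injOn_toVert hS (hO := hO) hrev
  constructor
  · intro h
    refine ⟨fun hpq => (B.adj_sub h).ne (by rw [hpq]), ?_⟩
    obtain ⟨d, hd, i, hik, h'⟩ := hT.exists_isLink hS hk hcov h
    refine ⟨(d, i), ⟨hd, hik⟩, ?_⟩
    have hmem := fun j hj => PathKE.subPos_mem k (hT.multigraph hS O hO) _ _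
      (hT.isOrientation hS) hd (i := j) hj
    have hv := hT.toVert_subPos hk (hO d hd)
    rw [← hv, ← hv] at h'
    rw [Sym2.eq_iff] at h' ⊢
    rcases h' with ⟨h1, h2⟩ | ⟨h1, h2⟩
    · exact Or.inl ⟨(hinj (hmem i hik.le) p.2 h1).symm, (hinj (hmem (i + 1) hik) q.2 h2).symm⟩
    · exact Or.inr ⟨(hinj (hmem (i + 1) hik) p.2 h2).symm, (hinj (hmem i hik.le) q.2 h1).symm⟩
  · rintro ⟨-, ⟨d, i⟩, ⟨hd, hik⟩, h⟩
    have h3 := congrArg (Sym2.map (toVert th)) h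
    simp only [Sym2.map_mk, hT.toVert_subPos hk (hO d hd)] at h3
    have hadj := hT.adj (hO d hd) i
    rcases Sym2.eq_iff.1 h3 with ⟨h4, h5⟩ | ⟨h4, h5⟩
    · rw [h4, h5]; exact_mod_cast hadj
    · rw [h4, h5]; exact_mod_cast hadj.symm

theorem isSubdivisionWith [Finite V] (hT : IsThreading B W th) (hS : IsSkeleton k B W)
    (hk : Odd k) : PathKE.IsSubdivisionWith k B W := by
  let e := Finite.equivFin (V × V)
  -- An arbitrary enumeration selects one of the two directions of each thread, giving one edge per
  -- thread.
  let O : Set (V × V) := {d | IsDart B W d ∧ e d < e (rev k th d)}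
  have hO : ∀ d ∈ O, IsDart B W d := fun d hd => hd.1
  have hrev : ∀ d ∈ O, rev k th d ∉ O := by
    rintro d hd ⟨-, h⟩
    rw [hT.rev_rev hS hk.pos hd.1] at h
    exact lt_asymm h hd.2
  have hcov : ∀ d, IsDart B W d → d ∈ O ∨ rev k th d ∈ O := by
    intro d hd
    rcases lt_trichotomy (e d) (e (rev k th d)) with h | h | h
    · exact Or.inl ⟨hd, h⟩
    · exact absurd (e.injective h).symm (hT.rev_ne hS hk hd)
    · exact Or.inr ⟨hT.isDart_rev hS hd, by rwa [hT.rev_rev hS hk.pos hd]⟩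
  let f : (PathKE.Sub k (hT.multigraph hS O hO) _ _ (hT.isOrientation hS)).vertexSet → B.verts :=
    fun p => ⟨toVert th p, hT.toVert_mem hS p.2⟩
  have hf : Function.Bijective f := by
    refine ⟨fun p q h => Subtype.ext (hT.injOn_toVert hS hrev p.2 q.2 (congrArg Subtype.val h)), ?_⟩
    rintro ⟨x, hx⟩
    obtain ⟨p, hp, h⟩ := hT.exists_toVert_eq hS (hO := hO) hk.pos hcov hx
    exact ⟨⟨p, hp⟩, Subtype.ext h⟩
  refine ⟨V, V × V, inferInstance, inferInstance, hT.multigraph hS O hO, _, _,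
    hT.isOrientation hS, ⟨Equiv.ofBijective f hf, fun {p q} =>
      hT.adj_toVert_iff hS hk.pos hrev hcov p q⟩, hT.simple_sub hS hk.pos hrev, ?_⟩
  ext w
  constructor
  · intro hw
    exact ⟨⟨Sum.inl w, Or.inl ⟨w, hw, rfl⟩⟩, ⟨w, rfl⟩, rfl⟩
  · rintro ⟨⟨p, hp⟩, ⟨x, rfl⟩, rfl⟩
    rcases hp with ⟨y, hy, h⟩ | ⟨d, hd, i, -, -, h⟩
    · have hx : x ∈ W := by rw [Sum.inl.inj h]; exact hy
      exact hx
    · cases h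

end IsThreading

/-! ### Components of `G - W` -/

theorem IsCyc.image_val {S : Set V} {n : ℕ} {c : ℤ → S} (h : IsCyc (G.induce S) n c) :
    IsCyc G n (fun i => (c i : V)) :=
  ⟨h.three_le, fun i j => by rw [← h.eq_iff, Subtype.ext_iff], fun i => h.adj i⟩

theorem IsCyc.codRestrict {S : Set V} {n : ℕ} {c : ℤ → V} (h : IsCyc G n c) (hS : ∀ i, c i ∈ S) :
    IsCyc (G.induce S) n (fun i => ⟨c i, hS i⟩) :=
  ⟨h.three_le, fun i j => by rw [← h.eq_iff, Subtype.ext_iff], fun i => h.adj i⟩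

/-- The vertices of a component of `G.induce S`, as vertices of `G`. -/
def compSet {S : Set V} (K : (G.induce S).ConnectedComponent) : Set V := Subtype.val '' K.supp

section Component

variable {S : Set V} {K : (G.induce S).ConnectedComponent}

theorem compSet_subset : compSet K ⊆ S := Subtype.coe_image_subset S K.supp

theorem reachable_of_mem_compSet {a b : V} (ha : a ∈ compSet K) (hb : b ∈ compSet K) :
    (within G S).Reachable a b := by
  obtain ⟨a, ha, rfl⟩ := ha
  obtain ⟨b, hb, rfl⟩ := hb
  let f : G.induce S →g within G S := ⟨Subtype.val, fun {v w} h => ⟨h, v.2, w.2⟩⟩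
  exact (SimpleGraph.ConnectedComponent.exact (ha.trans hb.symm)).map f

theorem mem_compSet_of_reachable {a b : V} (ha : a ∈ compSet K)
    (h : (within G S).Reachable a b) : b ∈ compSet K := by
  refine mem_of_reachable h ha ?_
  rintro _ ⟨x, hx, rfl⟩ y hy - hxy
  have hadj : (G.induce S).Adj x ⟨y, hy⟩ := hxy
  exact ⟨⟨y, hy⟩, (SimpleGraph.ConnectedComponent.sound hadj.reachable).symm.trans hx, rfl⟩

theorem forall_not_isKPath_iff {k : ℕ} (hk : 0 < k) :
    (∀ P : K.toSimpleGraph.Subgraph, ¬ PathKE.IsKPath K.toSimpleGraph k P) ↔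
      ∀ T, IsKSet G k T → ¬ T ⊆ compSet K := by
  constructor
  · intro h T hT hTK
    have h1 : T ⊆ S := hTK.trans compSet_subset
    have h2 : Subtype.val ⁻¹' T ⊆ K.supp := by
      intro v hv
      obtain ⟨w, hw, hwv⟩ := hTK hv
      rwa [← Subtype.ext hwv]
    obtain ⟨P, hP, -⟩ := ((hT.preimage_val h1).preimage_val h2).exists_isKPath hk
    exact h P hP
  · intro h P hP
    have h1 : IsKSet ((G.induce S).induce K.supp) k P.verts := isKSet_of_isKPath hP
    refine h _ h1.image_val.image_val (Set.image_mono ?_)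
    exact Subtype.coe_image_subset _ _

theorem isAcyclic_toSimpleGraph_iff :
    K.toSimpleGraph.IsAcyclic ↔ ∀ n c, IsCyc G n c → ¬ Set.range c ⊆ compSet K := by
  constructor
  · intro h n c hc hcK
    have h1 : ∀ i, c i ∈ S := fun i => compSet_subset (hcK ⟨i, rfl⟩)
    have h2 : ∀ i, (⟨c i, h1 i⟩ : S) ∈ K.supp := by
      intro i
      obtain ⟨w, hw, hwv⟩ := hcK ⟨i, rfl⟩
      rwa [← show w = ⟨c i, h1 i⟩ from Subtype.ext hwv]
    obtain ⟨w, hw, -⟩ := ((hc.codRestrict h1).codRestrict h2).exists_isCycle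
    exact h w hw
  · intro h v w hw
    obtain ⟨c, hc, -⟩ := exists_isCyc_of_isCycle hw
    have hc' : IsCyc ((G.induce S).induce K.supp) w.length c := hc
    refine h _ _ hc'.image_val.image_val ?_
    rintro _ ⟨i, rfl⟩
    exact ⟨_, (c i).2, rfl⟩

end Component

/-- A path of order `k` in the component of a vertex outside the hub yields a pendant path that
is long enough to violate the cover property. -/
theorem IsHub.not_subset_compSet [Finite V] {k : ℕ} (hk : Odd k) {B : G.Subgraph} {W : Set V}
    (hW : IsHub k B W) (hB : NoCut B) (h2 : 2 < B.verts.ncard)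
    {K : (G.induce Wᶜ).ConnectedComponent} {x : V} (hxK : x ∈ compSet K) (hxB : x ∈ B.verts)
    {T : Set V} (hT : IsKSet G k T) : ¬ T ⊆ compSet K := by
  intro hTK
  obtain ⟨h, hkh⟩ := id hk
  obtain ⟨n, c, hc, rfl⟩ := hB.exists_isCyc_of_mem h2 hxB
  have hX := hW.cover n c hc
  by_cases hmeet : (T ∩ Set.range c).Nonempty
  · obtain ⟨v, hvT, hvW, -⟩ := hX.inter_nonempty T hT hmeet
    exact compSet_subset (hTK hvT) hvW
  obtain ⟨v₀, hv₀⟩ := hT.nonempty hk.pos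
  obtain ⟨Q, hQ, hlen, rfl⟩ := hT
  have hQc : ∀ v ∈ Q, v ∉ Set.range c := fun v hv hvc => hmeet ⟨v, hv, hvc⟩
  -- Inside the component, join the cycle to the path `Q` and keep the piece from the last cycle
  -- vertex `c p` to the first vertex `z` of `Q`.
  obtain ⟨l, hl, hlW, hhead, hlast⟩ := exists_pathList_of_reachable
    (reachable_of_mem_compSet hxK (hTK hv₀)) (compSet_subset hxK)
  obtain ⟨l₁, z, l₂, rfl, hz, hl₁⟩ := exists_first_mem (S := {v | v ∈ Q})
    ⟨v₀, List.mem_of_getLast? hlast, hv₀⟩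
  have hne : l₁ ≠ [] := by
    rintro rfl
    have : z = c 0 := Option.some.inj hhead
    exact hQc z hz ⟨0, this.symm⟩
  rw [List.head?_append_of_ne_nil _ hne] at hhead
  obtain ⟨m₁, y, m₂, hm, ⟨p, rfl⟩, hm₁⟩ := exists_first_mem (l := l₁.reverse) (S := Set.range c)
    ⟨c 0, List.mem_reverse.2 (List.mem_of_mem_head? hhead), 0, rfl⟩
  -- From `z` the path continues along the longer side of `Q`, which has at least `h` further
  -- vertices. This makes a pendant path long enough to force `c p` into `W`.
  obtain ⟨q₁, q₂, hq, hqlen⟩ : ∃ q₁ q₂, IsPathList G (q₁ ++ z :: q₂) ∧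
      (∀ v ∈ q₁ ++ z :: q₂, v ∈ Q) ∧ h ≤ q₂.length := by
    obtain ⟨q₁, q₂, rfl⟩ := List.append_of_mem hz
    rcases le_total h q₂.length with hh | hh
    · exact ⟨q₁, q₂, hQ, fun _ hv => hv, hh⟩
    · refine ⟨q₂.reverse, q₁.reverse, by simpa using hQ.reverse, fun v hv => ?_, ?_⟩
      · simp only [List.mem_append, List.mem_reverse, List.mem_cons] at hv ⊢
        tauto
      · simp only [List.length_append, List.length_cons] at hlen
        rw [List.length_reverse]; omega
  have hl₁' : l₁ = m₂.reverse ++ c p :: m₁.reverse := by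
    rw [← List.reverse_reverse l₁, hm]; simp
  have hpath : IsPathList G (c p :: (m₁.reverse ++ [z])) :=
    hl.infix ⟨m₂.reverse, l₂, by rw [hl₁']; simp⟩
  have hpl : IsPend G c p (m₁.reverse ++ z :: q₂) := by
    refine ⟨⟨?_, ?_⟩, ?_⟩
    · rw [← List.cons_append, List.isChain_split]
      exact ⟨hpath.chain, (hq.infix ⟨q₁, [], by simp⟩).chain⟩
    · rw [← List.cons_append, List.nodup_append]
      refine ⟨(hpath.infix ⟨[], [z], by simp⟩).nodup, (hq.infix ⟨q₁, [], by simp⟩).nodup, ?_⟩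
      rintro a ha _ hb rfl
      refine hl₁ a ?_ (hqlen.1 a (List.mem_append_right _ hb))
      rw [hl₁']
      exact List.mem_append_right _ ha
    · intro v hv
      rcases List.mem_append.1 hv with hv | hv
      · exact hm₁ v (List.mem_reverse.1 hv)
      · exact hQc v (hqlen.1 v (List.mem_append_right _ hv))
  have := hX.mem_of_isPend hc.of_spanningCoe hkh hpl (by simp; omega)
  exact hlW (c p) (by rw [hl₁']; simp) this.1

theorem CycCoverable.mem_classH' [Finite V] {k : ℕ} (hk : Odd k) (hG : CycCoverable G k) :
    G ∈ PathKE.classH' k V := by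
  rintro B ⟨hB, h2⟩
  have hB' := (isBlock_iff.1 hB).1
  obtain ⟨W, hW⟩ := exists_isHub hk hG hB'
  have hS := hW.isSkeleton hk hG hB' h2
  obtain ⟨th, hT⟩ := hS.exists_isThreading
  refine ⟨W, hT.isSubdivisionWith hS hk, ?_⟩
  rintro K ⟨x, hxK, hxB⟩
  have hpath : ∀ T, IsKSet G k T → ¬ T ⊆ compSet K := fun T hT' =>
    hW.not_subset_compSet hk hB' h2 ⟨x, hxK, rfl⟩ hxB hT'
  refine ⟨⟨K.connected_toSimpleGraph, isAcyclic_toSimpleGraph_iff.2 fun n c hc hcK => ?_⟩,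
    (forall_not_isKPath_iff hk.pos).2 hpath⟩
  have hkn : k ≤ n := Nat.le_of_dvd (by have := hc.three_le; omega) (hG.dvd hc)
  refine hpath _ (hc.isKSet_arc 0 hkn) fun v hv => hcK (mem_range_of_mem_arc hv)

/-! ### Cycles in subdivisions -/

/-- Outside `W` the subgraph `B` has maximum degree two, and it consists of threads of length `k`
with ends in `W`. -/
structure IsThreaded (k : ℕ) (B : G.Subgraph) (W : Set V) : Prop where
  subset : W ⊆ B.verts
  eq_or_eq : ∀ v ∈ B.verts, v ∉ W → ∃ a b, ∀ u, B.Adj v u → u = a ∨ u = b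
  exists_thread : ∀ w ∈ W, ∀ u, B.Adj w u → ∃ g : ℤ → V, g 0 = w ∧ g 1 = u ∧ g k ∈ W ∧
    ∀ j : ℕ, 0 < j → j < k → g j ∉ W ∧ ∀ u, B.Adj (g j) u → u = g (j + 1) ∨ u = g (j - 1)

section SubPos

variable {α : Type u} {β : Type v} {k : ℕ} {src tgt : β → α} {e e' : β}

theorem subPos_of_lt {i : ℕ} (h0 : 0 < i) (hi : i < k) :
    PathKE.subPos k src tgt e i = Sum.inr (e, i) := by
  rw [PathKE.subPos, if_neg (by omega), if_neg (by omega)]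

theorem subPos_eq_inl {i : ℕ} {x : α} (hi : i ≤ k)
    (h : PathKE.subPos k src tgt e i = Sum.inl x) : i = 0 ∨ i = k := by
  by_contra hcon
  rw [subPos_of_lt (by omega) (by omega)] at h
  cases h

theorem subPos_eq_inr {i i' : ℕ} (h : PathKE.subPos k src tgt e i = Sum.inr (e', i')) :
    e = e' ∧ i = i' := by
  unfold PathKE.subPos at h
  split_ifs at h
  cases h
  exact ⟨rfl, rfl⟩

theorem exists_subPos_eq_inl {i : ℕ} (hi : i = 0 ∨ i = k) :
    ∃ x, PathKE.subPos k src tgt e i = Sum.inl x := by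
  unfold PathKE.subPos
  split_ifs with h1 h2
  · exact ⟨_, rfl⟩
  · exact ⟨_, rfl⟩
  · omega

end SubPos

theorem isThreaded_of_isSubdivisionWith {k : ℕ} (hk : 1 < k) {B : G.Subgraph} {W : Set V}
    (h : PathKE.IsSubdivisionWith k B W) : IsThreaded k B W := by
  classical
  obtain ⟨α, β, -, -, H, src, tgt, ho, φ, -, hWφ⟩ := h
  rcases isEmpty_or_nonempty V with hV | ⟨⟨v₀⟩⟩
  · exact ⟨fun v => hV.elim v, fun v => hV.elim v, fun v => hV.elim v⟩
  obtain ⟨F, hF⟩ : ∃ F : α ⊕ (β × ℕ) → V, ∀ p (hp : p ∈ PathKE.subVerts k H), F p = φ ⟨p, hp⟩ :=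
    ⟨fun p => if hp : p ∈ PathKE.subVerts k H then φ ⟨p, hp⟩ else v₀, fun p hp => dif_pos hp⟩
  have hinj : Set.InjOn F (PathKE.subVerts k H) := by
    intro p hp q hq hpq
    rw [hF p hp, hF q hq] at hpq
    exact congrArg Subtype.val (φ.injective (Subtype.ext hpq))
  have hsurj : ∀ v ∈ B.verts, ∃ p ∈ PathKE.subVerts k H, F p = v := by
    intro v hv
    obtain ⟨⟨p, hp⟩, h⟩ := φ.surjective ⟨v, hv⟩
    exact ⟨p, hp, by rw [hF p hp, h]⟩
  have hmem : ∀ p ∈ PathKE.subVerts k H,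
      F p ∈ W ↔ ∃ x, p = Sum.inl x := by
    intro p hp
    rw [hWφ]
    constructor
    · rintro ⟨y, hx, hy⟩
      rw [hF p hp] at hy
      rwa [show y = ⟨p, hp⟩ from φ.injective (Subtype.ext hy)] at hx
    · exact fun hx => ⟨⟨p, hp⟩, hx, (hF p hp).symm⟩
  have hadj : ∀ p ∈ PathKE.subVerts k H, ∀ u, B.Adj (F p) u → ∃ e ∈ H.edgeSet, ∃ i < k,
      (p = PathKE.subPos k src tgt e i ∧ u = F (PathKE.subPos k src tgt e (i + 1))) ∨
      (p = PathKE.subPos k src tgt e (i + 1) ∧ u = F (PathKE.subPos k src tgt e i)) := by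
    intro p hp u hu
    obtain ⟨q, hq, rfl⟩ := hsurj u (B.edge_vert hu.symm)
    have h1 : (PathKE.Sub k H src tgt ho).toSimpleGraph.Adj ⟨p, hp⟩ ⟨q, hq⟩ := by
      rw [← φ.map_adj_iff]
      rw [hF p hp, hF q hq] at hu
      exact hu
    obtain ⟨-, ⟨e, i⟩, ⟨he, hi⟩, h2⟩ := h1
    refine ⟨e, he, i, hi, ?_⟩
    rcases Sym2.eq_iff.1 h2 with ⟨h3, h4⟩ | ⟨h3, h4⟩
    · exact Or.inl ⟨h3, congrArg F h4⟩
    · exact Or.inr ⟨h3, congrArg F h4⟩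
  have hnbr : ∀ e ∈ H.edgeSet, ∀ i, 0 < i → i < k → ∀ u,
      B.Adj (F (PathKE.subPos k src tgt e i)) u →
      u = F (PathKE.subPos k src tgt e (i + 1)) ∨ u = F (PathKE.subPos k src tgt e (i - 1)) := by
    intro e he i h0 hi u hu
    obtain ⟨e', -, i', -, ⟨h, rfl⟩ | ⟨h, rfl⟩⟩ :=
      hadj _ (PathKE.subPos_mem k H src tgt ho he hi.le) u hu
    · rw [subPos_of_lt h0 hi] at h
      obtain ⟨rfl, rfl⟩ := subPos_eq_inr h.symm
      exact Or.inl rfl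
    · rw [subPos_of_lt h0 hi] at h
      obtain ⟨rfl, rfl⟩ := subPos_eq_inr h.symm
      exact Or.inr rfl
  have hpos : ∀ e ∈ H.edgeSet, ∀ i ≤ k, PathKE.subPos k src tgt e i ∈ PathKE.subVerts k H :=
    fun e he i hi => PathKE.subPos_mem k H src tgt ho he hi
  refine ⟨?_, ?_, ?_⟩
  · intro w hw
    rw [hWφ] at hw
    obtain ⟨y, -, rfl⟩ := hw
    exact (φ y).2
  · intro v hv hvW
    obtain ⟨p, hp, rfl⟩ := hsurj v hv
    rcases hp with ⟨x, hx, rfl⟩ | ⟨e, he, i, h0, hi, rfl⟩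
    · exact absurd ((hmem _ (Or.inl ⟨x, hx, rfl⟩)).2 ⟨x, rfl⟩) hvW
    · refine ⟨_, _, fun u hu => hnbr e he i h0 hi u ?_⟩
      rwa [subPos_of_lt h0 hi]
  · intro w hw u hu
    have hwB : w ∈ B.verts := B.edge_vert hu
    obtain ⟨p, hp, rfl⟩ := hsurj w hwB
    obtain ⟨x, rfl⟩ := (hmem p hp).1 hw
    -- The edge from `w` is the first or the last piece of a subdivided edge, which is followed
    -- forwards or backwards. Only the values of the thread at positions from `0` to `k` matter.
    obtain ⟨e, he, i, hi, ⟨h, rfl⟩ | ⟨h, rfl⟩⟩ := hadj _ hp u hu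
    · obtain rfl : i = 0 := (subPos_eq_inl hi.le h.symm).resolve_right (by omega)
      refine ⟨fun j => F (PathKE.subPos k src tgt e j.toNat), by rw [h]; rfl, rfl, ?_, ?_⟩
      · refine (hmem _ (hpos e he _ (by omega))).2 ?_
        exact exists_subPos_eq_inl (by simp)
      · intro j h0 hj
        constructor
        · refine mt (hmem _ (hpos e he _ (by omega))).1 ?_
          rintro ⟨x, hx⟩
          have := subPos_eq_inl (by omega) hx
          omega
        · have := hnbr e he j h0 hj
          beta_reduce
          rw [show ((j : ℤ) + 1).toNat = j + 1 by omega, show ((j : ℤ) - 1).toNat = j - 1 by omega]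
          exact this
    · obtain hik : i + 1 = k := (subPos_eq_inl hi h.symm).resolve_left (by omega)
      refine ⟨fun j => F (PathKE.subPos k src tgt e (k - j).toNat), ?_, ?_, ?_, ?_⟩
      · rw [h, hik]; simp
      · beta_reduce
        rw [show ((k : ℤ) - 1).toNat = i by omega]
      · refine (hmem _ (hpos e he _ (by omega))).2 ?_
        exact exists_subPos_eq_inl (by simp)
      · intro j h0 hj
        constructor
        · refine mt (hmem _ (hpos e he _ (by omega))).1 ?_
          rintro ⟨x, hx⟩
          have := subPos_eq_inl (by omega) hx
          omega
        · intro u hu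
          have := hnbr e he (k - j) (by omega) (by omega) u
            (by beta_reduce at hu; rwa [show ((k : ℤ) - j).toNat = k - j by omega] at hu)
          beta_reduce
          rw [show ((k : ℤ) - (j + 1)).toNat = k - j - 1 by omega,
            show ((k : ℤ) - (j - 1)).toNat = k - j + 1 by omega]
          exact this.symm

/-! ### From subdivided blocks back to covers of cycles -/

theorem IsThreaded.next {k : ℕ} {B : G.Subgraph} {W : Set V} (hT : IsThreaded k B W) {n : ℕ}
    {c : ℤ → V} (hc : IsCyc B.spanningCoe n c) {p : ℤ} (hp : c p ∈ W) :
    c (p + k) ∈ W ∧ ∀ j : ℕ, 0 < j → j < k → c (p + j) ∉ W := by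
  obtain ⟨g, h0, h1, hk, hj⟩ := hT.exists_thread _ hp _ (hc.adj p)
  have key := (hc.shift p).agree (c := g) (by simpa using h0) h1 (m := k)
    (fun i h0 hi => (hj i h0 hi).2)
  exact ⟨key k le_rfl ▸ hk, fun j h0 hjk => key j hjk.le ▸ (hj j h0 hjk).1⟩

theorem IsThreaded.mem_iff {k : ℕ} (hk : 0 < k) {B : G.Subgraph} {W : Set V}
    (hT : IsThreaded k B W) {n : ℕ} {c : ℤ → V} (hc : IsCyc B.spanningCoe n c) {r : ℤ}
    (hr : c r ∈ W) : k ∣ n ∧ ∀ j, c j ∈ W ↔ (k : ℤ) ∣ j - r := by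
  have h1 : ∀ t : ℕ, c (r + (k * t : ℕ)) ∈ W := by
    intro t
    induction t with
    | zero => simpa using hr
    | succ t ih =>
      have := (hT.next hc ih).1
      rwa [show r + (k * t : ℕ) + k = r + (k * (t + 1) : ℕ) by push_cast; ring] at this
  have h2 : ∀ m : ℕ, c (r + m) ∈ W ↔ k ∣ m := by
    intro m
    constructor
    · intro hm
      by_contra hkm
      refine (hT.next hc (h1 (m / k))).2 (m % k)
        (Nat.pos_of_ne_zero fun h => hkm (Nat.dvd_of_mod_eq_zero h)) (Nat.mod_lt m hk) ?_
      rwa [add_assoc, ← Nat.cast_add, Nat.div_add_mod]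
    · rintro ⟨t, rfl⟩
      exact h1 t
  have hkn : k ∣ n := by
    rw [← h2, (hc.eq_iff (r + n) r).2 (by simp)]
    exact hr
  refine ⟨hkn, fun j => ?_⟩
  obtain ⟨m, -, hm⟩ := hc.exists_nat_lt r j
  have h3 : (k : ℤ) ∣ r + m - j := (Int.natCast_dvd_natCast.2 hkn).trans ((hc.eq_iff _ _).1 hm)
  rw [← hm, h2, ← Int.natCast_dvd_natCast, show (m : ℤ) = (r + m - j) + (j - r) by ring,
    dvd_add_right h3]

theorem IsCyc.mul_ncard_eq {n k : ℕ} (hk : 0 < k) {c : ℤ → V} (hc : IsCyc G n c) {W : Set V}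
    {r : ℤ} (hkn : k ∣ n) (hr : ∀ j, c j ∈ W ↔ (k : ℤ) ∣ j - r) :
    k * (W ∩ Set.range c).ncard = n := by
  obtain ⟨m, rfl⟩ := hkn
  have : W ∩ Set.range c = (fun t : ℕ => c (r + k * t)) '' (Finset.range m : Set ℕ) := by
    ext v
    constructor
    · rintro ⟨hv, i, rfl⟩
      obtain ⟨j, hj, hji⟩ := hc.exists_nat_lt r i
      rw [← hji, hr, add_sub_cancel_left, Int.natCast_dvd_natCast] at hv
      obtain ⟨t, rfl⟩ := hv
      refine ⟨t, Finset.mem_coe.2 (Finset.mem_range.2 (Nat.lt_of_mul_lt_mul_left hj)), ?_⟩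
      rw [← hji]; push_cast; rfl
    · rintro ⟨t, -, rfl⟩
      exact ⟨(hr _).2 ⟨t, by ring⟩, _, rfl⟩
  rw [this, Set.InjOn.ncard_image, Set.ncard_coe_finset, Finset.card_range]
  intro s hs t ht hst
  have hs : s < m := Finset.mem_range.1 hs
  have ht : t < m := Finset.mem_range.1 ht
  have hs' : (k : ℤ) * s < k * m := by exact_mod_cast Nat.mul_lt_mul_of_pos_left hs hk
  have ht' : (k : ℤ) * t < k * m := by exact_mod_cast Nat.mul_lt_mul_of_pos_left ht hk
  have hs0 : (0 : ℤ) ≤ k * s := by positivity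
  have ht0 : (0 : ℤ) ≤ k * t := by positivity
  have := hc.eq_of_lt hst (by push_cast; omega) (by push_cast; omega)
  have h3 : (k : ℤ) * s = k * t := by omega
  have := mul_left_cancel₀ (by omega : (k : ℤ) ≠ 0) h3
  omega

/-- A path that leaves a cycle of a block at a vertex of degree two in the block does not return to
the block. -/
theorem notMem_of_isPathList {B : G.Subgraph} (hB : Maximal NoCut B) {n : ℕ} {c : ℤ → V}
    (hc : IsCyc B.spanningCoe n c) {q : ℤ}
    (hdeg : ∃ a b, ∀ u, B.Adj (c q) u → u = a ∨ u = b) {l : List V} (hl : IsPathList G (c q :: l))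
    (hout : ∀ v ∈ l, v ∉ Set.range c) {w : V} (hw : w ∈ l) : w ∉ B.verts := by
  intro hwB
  obtain ⟨u, l, rfl⟩ : ∃ u l', l = u :: l' := List.exists_cons_of_ne_nil (List.ne_nil_of_mem hw)
  have hnd := List.nodup_cons.1 hl.nodup
  have hS : ∀ v ∈ u :: l, v ∈ ({c q}ᶜ : Set V) := fun v hv h => hnd.1 (h ▸ hv)
  have hq1 : c (q + 1) ≠ c q := (hc.adj q).ne.symm
  have h1 := reachable_of_isChain hl.chain.tail hS (List.mem_cons_self) hw
  have h2 := hB.1.conn_compl (c q) w hwB (c (q + 1)) (hc.mem_verts _) (hS w hw) hq1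
  have h3 : (within G {c q}ᶜ).Reachable w (c (q + 1)) :=
    h2.mono (show within B.spanningCoe {c q}ᶜ ≤ within G {c q}ᶜ from
      fun _ _ h => ⟨B.adj_sub h.1, h.2⟩)
  have hu : u ≠ c (q + 1) := fun h => hout u List.mem_cons_self ⟨_, h.symm⟩
  -- A return to `B` closes a cycle through `u`, `c q` and `c (q + 1)`. It shares two vertices with
  -- the block and so lies in it, making `u` a third neighbour of `c q` in `B`.
  obtain ⟨m, d, hd, hd0, hd1, ⟨i, hi⟩, -⟩ := exists_isCyc_of_reachable (by simp) (h1.trans h3)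
    (hS u List.mem_cons_self) hu hl.chain.rel (hc.of_spanningCoe.adj q)
  have hle := le_of_maximal_noCut hB (noCut_cycSubgraph hd) hq1.symm (hc.mem_verts q) ⟨0, hd0⟩
    (hc.mem_verts (q + 1)) ⟨i, hi⟩
  have hadj : B.Adj (c q) u := hle.2 ⟨0, Or.inl ⟨hd0.symm, by simpa using hd1.symm⟩⟩
  rcases eq_or_eq_of_forall_adj hc hdeg hadj with h | h
  · exact hu h
  · exact hout u List.mem_cons_self ⟨_, h.symm⟩

theorem cycCoverable_of_mem_classH' [Finite V] {k : ℕ} (hk : 0 < k)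
    (hG : G ∈ PathKE.classH' k V) : CycCoverable G k := by
  intro n c hc
  rcases Nat.lt_or_ge 1 k with hk1 | hk1
  swap
  · obtain rfl : k = 1 := by omega
    exact ⟨Set.range c, subset_rfl, by rw [one_mul, hc.ncard_range], fun _ _ h => h⟩
  obtain ⟨B, hB, hcB⟩ := hc.exists_isNontrivialBlock
  obtain ⟨W, hW, hcomp⟩ := hG B hB
  have hBmax := isBlock_iff.1 hB.1
  have hT := isThreaded_of_isSubdivisionWith hk1 hW
  have hcB' := hc.of_le hcB
  have hcomp' : ∀ (K : (G.induce Wᶜ).ConnectedComponent) x, x ∈ compSet K → x ∈ B.verts →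
      (∀ n c, IsCyc G n c → ¬ Set.range c ⊆ compSet K) ∧
        ∀ T, IsKSet G k T → ¬ T ⊆ compSet K := by
    rintro K _ ⟨x, hx, rfl⟩ hxB
    obtain ⟨h1, h2⟩ := hcomp K ⟨x, hx, hxB⟩
    exact ⟨isAcyclic_toSimpleGraph_iff.1 h1.isAcyclic, (forall_not_isKPath_iff hk).1 h2⟩
  have hself : ∀ x (hx : x ∈ Wᶜ), x ∈ compSet ((G.induce Wᶜ).connectedComponentMk ⟨x, hx⟩) :=
    fun x hx => ⟨⟨x, hx⟩, rfl, rfl⟩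
  -- A cycle missing `W` would lie in a single component of `G - W`, which is a tree.
  obtain ⟨r, hr⟩ : ∃ r, c r ∈ W := by
    by_contra hcon
    push Not at hcon
    refine (hcomp' _ _ (hself (c 0) (hcon 0)) (hcB'.mem_verts 0)).1 n c hc ?_
    rintro _ ⟨i, rfl⟩
    refine mem_compSet_of_reachable (hself (c 0) (hcon 0)) ?_
    obtain ⟨j, -, hj⟩ := hc.exists_nat_lt 0 i
    rw [← hj]
    refine reachable_of_isChain (hc.isChain_arc 0 (j + 1)) ?_ (mem_arc.2 ⟨0, by omega, by simp⟩)
      (mem_arc.2 ⟨j, by omega, rfl⟩)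
    intro v hv
    obtain ⟨i, -, rfl⟩ := mem_arc.1 hv
    exact hcon _
  obtain ⟨hkn, hmem⟩ := hT.mem_iff hk hcB' hr
  refine ⟨W ∩ Set.range c, Set.inter_subset_right, hc.mul_ncard_eq hk hkn hmem, ?_⟩
  rintro T hT' ⟨x, hxT, hxc⟩
  by_contra hcon
  have hWc : ∀ v ∈ T, v ∈ Set.range c → v ∉ W := fun v hv hvc hvW => hcon ⟨v, hv, hvW, hvc⟩
  have hrange : Set.range c ⊆ B.verts := by
    rintro _ ⟨i, rfl⟩; exact hcB'.mem_verts i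
  have hTset := hT'
  obtain ⟨Q, hQ, -, rfl⟩ := hT'
  -- A path meeting the cycle but missing `W` there either reaches `W` off the cycle, returning to
  -- the block after leaving the cycle at a vertex of degree two in it, or lies in one component of
  -- `G - W`.
  by_cases hQW : ∃ w ∈ Q, w ∈ W
  · obtain ⟨w, hwQ, hwW⟩ := hQW
    obtain ⟨a, b, hab, hmemQ, hxa⟩ : ∃ a b, IsPathList G (a ++ w :: b) ∧
        (∀ v ∈ a ++ w :: b, v ∈ Q) ∧ x ∈ a := by
      have hxw : x ≠ w := fun h => hWc x hxT hxc (h ▸ hwW)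
      obtain ⟨a, b, rfl⟩ := List.append_of_mem hwQ
      rcases List.mem_append.1 hxT with hxa | hxb
      · exact ⟨a, b, hQ, fun _ h => h, hxa⟩
      · refine ⟨b.reverse, a.reverse, by simpa using hQ.reverse, fun v hv => ?_,
          List.mem_reverse.2 ((List.mem_cons.1 hxb).resolve_left hxw)⟩
        simp only [List.mem_append, List.mem_reverse, List.mem_cons] at hv ⊢
        tauto
    obtain ⟨l₁, y, l₂, hl, ⟨q, rfl⟩, hout⟩ := exists_first_mem (l := a.reverse)
      (S := Set.range c) ⟨x, List.mem_reverse.2 hxa, hxc⟩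
    have ha : a = l₂.reverse ++ c q :: l₁.reverse := by
      rw [← List.reverse_reverse a, hl]; simp
    have hpath : IsPathList G (c q :: (l₁.reverse ++ [w])) :=
      hab.infix ⟨l₂.reverse, b, by rw [ha]; simp⟩
    refine notMem_of_isPathList hBmax hcB' (hT.eq_or_eq (c q) (hcB'.mem_verts q) ?_) hpath ?_
      (w := w) (by simp) (hT.subset hwW)
    · exact hWc _ (hmemQ _ (by rw [ha]; simp)) ⟨q, rfl⟩
    · intro v hv
      rcases List.mem_append.1 hv with hv | hv
      · exact hout v (List.mem_reverse.1 hv)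
      · rw [List.mem_singleton.1 hv]
        exact fun hwc => hWc w hwQ hwc hwW
  · have hQW : ∀ v ∈ Q, v ∈ Wᶜ := fun v hv hvW => hQW ⟨v, hv, hvW⟩
    refine (hcomp' _ x (hself x (hQW x hxT)) (hrange hxc)).2 _ hTset fun v hv => ?_
    exact mem_compSet_of_reachable (hself x (hQW x hxT)) (reachable_of_isChain hQ.chain hQW hxT hv)

end KPath

theorem theorem4 (k : ℕ) (hk : Odd k) (V : Type u) [Finite V] :
    PathKE.classG' k V = PathKE.classH' k V := by
  ext G
  exact ⟨fun h => (KPath.cycCoverable_of_mem_classG' hk h).mem_classH' hk,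
    fun h => (KPath.cycCoverable_of_mem_classH' hk.pos h).mem_classG' hk.pos⟩
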